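/- Let $s\in(0,1)$, let $N\ge 1$ be an integer with $N>2s$, let $2<p<\frac{2N}{N-2s}$, $\lambda>0$ and $\varepsilon>0$. Let $V:\mathbb{R}^N\to[0,\infty)$ be continuous with $\liminf_{|x|\to\infty}V(x)|x|^{2s}>0$, and let $H^s_{V,\varepsilon}(\mathbb{R}^N)$ be the space of measurable functions $u:\mathbb{R}^N\to\mathbb{R}$ with $$\varepsilon^{2s}\iint_{\mathbb{R}^N\times\mathbb{R}^N}\frac{|u(x)-u(y)|^2}{|x-y|^{N+2s}}\,dx\,dy+\int_{\mathbb{R}^N}V(x)u(x)^2\,dx<\infty .$$ Let $H\subset\mathbb{R}^N$ be a half-space (open or closed), and let $v\in H^s_{V,\varepsilon}(\mathbb{R}^N)$ with $v\ge 0$ a.e. be a weak solution of $$(-\Delta)^s v+\lambda v=\chi_H v^{p-1}\quad\text{in }\mathbb{R}^N,$$ that is, for every $\varphi\in C_c^\infty(\mathbb{R}^N)$, $$\iint_{\mathbb{R}^N\times\mathbb{R}^N}\frac{(v(x)-v(y))(\varphi(x)-\varphi(y))}{|x-y|^{N+2s}}\,dx\,dy+\lambda\int_{\mathbb{R}^N}v\varphi\,dx=\int_{H}v^{p-1}\varphi\,dx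 .$$ Then $v=0$ almost everywhere in $\mathbb{R}^N$. -/

import Mathlib

open MeasureTheory Filter
open scoped ENNReal RealInnerProductSpace

/-- A half-space of `ℝ^N`, open or closed: one of the two sides of an affine hyperplane. -/
def IsHalfSpace {N : ℕ} (H : Set (EuclideanSpace ℝ (Fin N))) : Prop :=
  ∃ (e : EuclideanSpace ℝ (Fin N)) (c : ℝ), e ≠ 0 ∧
    (H = {x | c ≤ ⟪e, x⟫} ∨ H = {x | c < ⟪e, x⟫})

/-- The squared Gagliardo seminorm
`∫ |(-Δ)^{s/2} u|² = ∬ |u(x) - u(y)|² / |x - y|^{N + 2s} dx dy`, possibly infinite. -/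
noncomputable def gagliardoEnergy {N : ℕ} (s : ℝ) (u : EuclideanSpace ℝ (Fin N) → ℝ) : ℝ≥0∞ :=
  ∫⁻ z : EuclideanSpace ℝ (Fin N) × EuclideanSpace ℝ (Fin N),
    ENNReal.ofReal ((u z.1 - u z.2) ^ 2 / ‖z.1 - z.2‖ ^ ((N : ℝ) + 2 * s))

/-- The squared norm `∫ (ε^{2s} |(-Δ)^{s/2} u|² + V u²)` of the weighted space
`H^s_{V,ε}(ℝ^N)`, possibly infinite. -/
noncomputable def weightedNormSq {N : ℕ} (s ε : ℝ) (V u : EuclideanSpace ℝ (Fin N) → ℝ) : ℝ≥0∞ :=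
  ENNReal.ofReal (ε ^ (2 * s)) * gagliardoEnergy s u + ∫⁻ x, ENNReal.ofReal (V x * u x ^ 2)

/-- Membership in the weighted space `H^s_{V,ε}(ℝ^N)`. -/
structure MemWeightedSobolev {N : ℕ} (s ε : ℝ) (V u : EuclideanSpace ℝ (Fin N) → ℝ) : Prop where
  aestronglyMeasurable : AEStronglyMeasurable u volume
  weightedNormSq_lt_top : weightedNormSq s ε V u < (⊤ : ℝ≥0∞)

/-- The bilinear form of the fractional Laplacian, the polarization of `gagliardoEnergy`:
`∫ (-Δ)^{s/2} u (-Δ)^{s/2} φ = ∬ (u(x) - u(y)) (φ(x) - φ(y)) / |x - y|^{N + 2s} dx dy`. -/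
noncomputable def gagliardoForm {N : ℕ} (s : ℝ) (u φ : EuclideanSpace ℝ (Fin N) → ℝ) : ℝ :=
  ∫ z : EuclideanSpace ℝ (Fin N) × EuclideanSpace ℝ (Fin N),
    (u z.1 - u z.2) * (φ z.1 - φ z.2) / ‖z.1 - z.2‖ ^ ((N : ℝ) + 2 * s)

/-- `v` is a weak solution of `(-Δ)^s v + lam v = χ_H v^{p-1}` in `ℝ^N`: the equation holds when
tested against every function in `C_c^∞(ℝ^N)`. It is used for nonnegative `v` of finite Gagliardo
energy and for `p - 1` at most the critical Sobolev exponent, where all the integrals converge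
absolutely. -/
def IsWeakSolution {N : ℕ} (s lam p : ℝ) (H : Set (EuclideanSpace ℝ (Fin N)))
    (v : EuclideanSpace ℝ (Fin N) → ℝ) : Prop :=
  ∀ φ : EuclideanSpace ℝ (Fin N) → ℝ, ContDiff ℝ (⊤ : ℕ∞) φ → HasCompactSupport φ →
    gagliardoForm s v φ + lam * ∫ x, v x * φ x =
      ∫ x, H.indicator (fun x => v x ^ (p - 1)) x * φ x

/-!
# Nonexistence for the fractional half-space problem

The proof is the method of moving planes, carried out on energies instead of pointwise values, so
that no regularity of the solution is needed. Let `e` be the inner unit normal of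
`H = {c ≤ ⟪e, x⟫}` (or of its interior) and `σ_μ` the reflection in the hyperplane `⟪e, x⟫ = μ`. The claim is
that, unless `v = 0`, the inequality `v ≤ v ∘ σ_μ` holds on `{⟪e, x⟫ ≤ μ}` for every `μ`
(`IsEnergySolution.ae_eq_zero`). A function with this property and with `∫ v^r < ∞` vanishes: its
mass on `{⟪e, x⟫ ≤ μ}` is at most its mass on `{μ ≤ ⟪e, x⟫}`, which tends to `0` as `μ → ∞`
(`ae_eq_zero_of_forall_le_refl`). Here and below `r = 2N / (N - 2s)`, written as `2 / (1 - θ)`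
with `θ = 2s / N`, is the critical exponent.

**The function space.** The solution need not be square integrable. The decay condition on `V`
only gives finite energy and `∫ v² (1 + |x|)^{-2s} < ∞`; this is the class `HardySobolev`. The
weight is exactly what is needed for cutoffs to converge in energy
(`HardySobolev.tendsto_eLpNorm_quot_cutoff`), and so for the Sobolev inequality to hold in the
class (`HardySobolev.exists_sobolev`). By translation and averaging, the weak equation extends
from smooth test functions to all compactly supported ones of the class
(`weak_eq_of_hasCompactSupport`).

**Small mass.** Let `φ` be the positive part of `v - v ∘ σ_μ` on `{⟪e, x⟫ ≤ μ}`, extended by zero.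
Testing the equation of `v - v ∘ σ_μ` with `φ` bounds the energy of `φ` from above, by
antisymmetry and because the kernel decreases under reflection (`integral_quot_sidePos_sq_le`). On
the right-hand side `lam` absorbs small values of `v` and points outside `H` have a good sign, so
only `∫ v^{r-2} φ²` over `H ∩ {0 < φ}` is left. By the Hölder and Sobolev inequalities `φ = 0` as
soon as `∫ v^r` over `H ∩ {0 < φ}` is small (`IsEnergySolution.exists_small_mass`). For `μ ≤ c`
this set is empty.

**Moving the plane.** Let `m` be the supremum of the positions reached. Either `v < v ∘ σ_m`
almost everywhere on `{⟪e, x⟫ < m}` or `v` is symmetric, by a strong maximum principle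
(`IsEnergySolution.ae_lt_or_ae_eq`). In the first case, and trivially if `m = c`, the mass over
`H ∩ {0 < φ}` tends to `0` as `μ` decreases to `m`, and the plane can be moved further
(`IsEnergySolution.exists_lt_of_strict`). In the second case `m > c`, and the equations at mirror
points differ by `v^{p-1}`, which forces `v = 0` on `{⟪e, x⟫ < c}`; the strong maximum principle for a
hyperplane outside `H` then gives `v = 0` everywhere (`IsEnergySolution.ae_eq_zero_of_symmetric`).
-/

open Topology

namespace FracHalfSpace

variable {N : ℕ}

local notation "𝔼" => EuclideanSpace ℝ (Fin N)

/-- The Gagliardo kernel `|x - y|^{-(N + 2s)}`; it takes the harmless value `0` on the diagonal. -/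
noncomputable def kern (s : ℝ) (x y : 𝔼) : ℝ := (‖x - y‖ ^ ((N : ℝ) + 2 * s))⁻¹

/-- The weighted difference quotient `(u(x) - u(y)) / |x - y|^{(N + 2s)/2}`, so that the Gagliardo
energy is its squared `L²` norm and the Gagliardo form the corresponding `L²` pairing. -/
noncomputable def quot (s : ℝ) (u : 𝔼 → ℝ) (z : 𝔼 × 𝔼) : ℝ :=
  (u z.1 - u z.2) * √(kern s z.1 z.2)

lemma kern_nonneg (s : ℝ) (x y : 𝔼) : 0 ≤ kern s x y := by unfold kern; positivity

lemma kern_symm (s : ℝ) (x y : 𝔼) : kern s x y = kern s y x := by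
  unfold kern; rw [norm_sub_rev]

@[fun_prop]
lemma measurable_kern (s : ℝ) : Measurable fun z : 𝔼 × 𝔼 => kern s z.1 z.2 := by
  unfold kern; fun_prop

lemma quot_mul_quot (s : ℝ) (u φ : 𝔼 → ℝ) (z : 𝔼 × 𝔼) :
    quot s u z * quot s φ z = (u z.1 - u z.2) * (φ z.1 - φ z.2) * kern s z.1 z.2 := by
  unfold quot
  linear_combination (u z.1 - u z.2) * (φ z.1 - φ z.2) * Real.mul_self_sqrt (kern_nonneg s z.1 z.2)

lemma quot_sq (s : ℝ) (u : 𝔼 → ℝ) (z : 𝔼 × 𝔼) :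
    quot s u z ^ 2 = (u z.1 - u z.2) ^ 2 * kern s z.1 z.2 := by
  rw [sq, quot_mul_quot]; ring

lemma measurable_quot {s : ℝ} {u : 𝔼 → ℝ} (hu : Measurable u) : Measurable (quot s u) := by
  unfold quot
  exact ((hu.comp measurable_fst).sub (hu.comp measurable_snd)).mul (measurable_kern s).sqrt

lemma gagliardoForm_eq (s : ℝ) (u φ : 𝔼 → ℝ) :
    gagliardoForm s u φ = ∫ z, quot s u z * quot s φ z := by
  unfold gagliardoForm
  refine integral_congr_ae (.of_forall fun z => ?_)
  simp only [quot_mul_quot, kern, div_eq_mul_inv]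

lemma gagliardoEnergy_eq (s : ℝ) (u : 𝔼 → ℝ) :
    gagliardoEnergy s u = ∫⁻ z, ENNReal.ofReal (quot s u z ^ 2) := by
  unfold gagliardoEnergy
  simp only [quot_sq, kern, div_eq_mul_inv]

lemma ofReal_sq_eq_enorm (a : ℝ) : ENNReal.ofReal (a ^ 2) = ‖a‖ₑ ^ 2 := by
  rw [Real.enorm_eq_ofReal_abs, ← ENNReal.ofReal_pow (abs_nonneg _), sq_abs]

lemma eLpNorm_two_sq {α : Type*} [MeasurableSpace α] (μ : Measure α) (f : α → ℝ) :
    eLpNorm f 2 μ ^ 2 = ∫⁻ x, ENNReal.ofReal (f x ^ 2) ∂μ := by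
  have := eLpNorm_nnreal_pow_eq_lintegral (f := f) (μ := μ) (p := 2) (by norm_num)
  simpa [ofReal_sq_eq_enorm] using this

lemma gagliardoEnergy_eq_eLpNorm (s : ℝ) (u : 𝔼 → ℝ) :
    gagliardoEnergy s u = eLpNorm (quot s u) 2 volume ^ 2 := by
  rw [eLpNorm_two_sq, gagliardoEnergy_eq]

lemma memLp_quot_iff {s : ℝ} {u : 𝔼 → ℝ} (hu : Measurable u) :
    MemLp (quot s u) 2 volume ↔ gagliardoEnergy s u < ⊤ := by
  rw [gagliardoEnergy_eq_eLpNorm, MemLp]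
  simp [(measurable_quot hu).aestronglyMeasurable]

/-! ### The fractional Sobolev inequality -/

/-- Optimization of the radius: the bound `A ≤ C (ρ^{dθ} g + ρ^{dθ - d} m)`, valid for
all `ρ > 0`, is turned into its interpolated form. -/
lemma le_of_forall_radius {A C g m d θ : ℝ} (hC : 0 ≤ C) (hg : 0 ≤ g) (hm : 0 < m) (hd : 0 < d)
    (hθ1 : θ < 1)
    (h : ∀ ρ : ℝ, 0 < ρ → A ≤ C * (ρ ^ (d * θ) * g + ρ ^ (d * θ - d) * m)) :
    A ≤ 2 * C * m ^ θ * g ^ (1 - θ) := by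
  have key : ∀ g' : ℝ, g < g' → A ≤ 2 * C * m ^ θ * g' ^ (1 - θ) := by
    intro g' hg'
    have hg'0 : 0 < g' := hg.trans_lt hg'
    have hq : 0 < m / g' := by positivity
    have h1 := h ((m / g') ^ (1 / d)) (by positivity)
    have e1 : ((m / g') ^ (1 / d)) ^ (d * θ) = m ^ θ / g' ^ θ := by
      rw [← Real.rpow_mul hq.le, ← Real.div_rpow hm.le hg'0.le]
      congr 1
      field_simp
    have e2 : ((m / g') ^ (1 / d)) ^ (d * θ - d) = m ^ (θ - 1) / g' ^ (θ - 1) := by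
      rw [← Real.rpow_mul hq.le, ← Real.div_rpow hm.le hg'0.le]
      congr 1
      field_simp
    have e3 : g' ^ (1 - θ) = g' / g' ^ θ := by rw [Real.rpow_sub hg'0, Real.rpow_one]
    have e4 : m ^ (θ - 1) = m ^ θ / m := by rw [Real.rpow_sub hm, Real.rpow_one]
    have e5 : g' ^ (θ - 1) = g' ^ θ / g' := by rw [Real.rpow_sub hg'0, Real.rpow_one]
    have hp : 0 < g' ^ θ := by positivity
    rw [e1, e2, e4, e5] at h1
    rw [e3]
    have h2 : m ^ θ / g' ^ θ * g ≤ m ^ θ / g' ^ θ * g' := by gcongr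
    calc A ≤ C * (m ^ θ / g' ^ θ * g + m ^ θ / m / (g' ^ θ / g') * m) := h1
      _ ≤ C * (m ^ θ / g' ^ θ * g' + m ^ θ / m / (g' ^ θ / g') * m) := by gcongr
      _ = 2 * C * m ^ θ * (g' / g' ^ θ) := by field_simp; ring
  have hcont : Tendsto (fun g' : ℝ => 2 * C * m ^ θ * g' ^ (1 - θ)) (𝓝[>] g)
      (𝓝 (2 * C * m ^ θ * g ^ (1 - θ))) := by
    refine Tendsto.const_mul _ (Tendsto.mono_left ?_ nhdsWithin_le_nhds)
    exact (Real.continuousAt_rpow_const g (1 - θ) (Or.inr (by linarith))).tendsto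
  exact ge_of_tendsto hcont (eventually_nhdsWithin_of_forall fun g' hg' => key g' hg')

/-- The value at `x` is compared with the mean over the ball of radius `ρ`: the oscillation is paid
for by the localized Gagliardo energy, the mean by the critical norm through Hölder's inequality. -/
lemma sq_mul_volume_ball_le {s : ℝ} (hN : 0 < (N : ℝ) + 2 * s) {r θ : ℝ} (hθ0 : 0 < θ) (hθ1 : θ < 1)
    (hr : r = 2 / (1 - θ)) {u : 𝔼 → ℝ} (hu : Measurable u)
    (x : 𝔼) {ρ : ℝ} (hρ : 0 < ρ) :
    ENNReal.ofReal (u x ^ 2) * volume (Metric.ball x ρ) ≤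
      2 * (ENNReal.ofReal (ρ ^ ((N : ℝ) + 2 * s)) *
        ∫⁻ y, ENNReal.ofReal ((u x - u y) ^ 2 * kern s x y)) +
      2 * ((∫⁻ y, ‖u y‖ₑ ^ r) ^ (2 / r) * volume (Metric.ball x ρ) ^ θ) := by
  have hr0 : 0 < r := by rw [hr]; have : 0 < 1 - θ := by linarith
                         positivity
  have h1 : ENNReal.ofReal (u x ^ 2) * volume (Metric.ball x ρ) =
      ∫⁻ _ in Metric.ball x ρ, ENNReal.ofReal (u x ^ 2) := by simp
  have hm1 : Measurable fun y => ENNReal.ofReal ((u x - u y) ^ 2) := by fun_prop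
  have h2 : ∫⁻ _ in Metric.ball x ρ, ENNReal.ofReal (u x ^ 2) ≤
      ∫⁻ y in Metric.ball x ρ, (2 * ENNReal.ofReal ((u x - u y) ^ 2) +
        2 * ENNReal.ofReal (u y ^ 2)) := by
    refine lintegral_mono fun y => ?_
    have e : (2 : ℝ≥0∞) = ENNReal.ofReal 2 := by simp
    rw [e, ← ENNReal.ofReal_mul (by norm_num), ← ENNReal.ofReal_mul (by norm_num),
      ← ENNReal.ofReal_add (by positivity) (by positivity)]
    refine ENNReal.ofReal_le_ofReal ?_
    nlinarith [sq_nonneg (u x - 2 * u y)]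
  rw [lintegral_add_left (by fun_prop), lintegral_const_mul _ hm1,
    lintegral_const_mul _ (by fun_prop)] at h2
  rw [h1]
  refine h2.trans ?_
  gcongr
  · rw [← lintegral_const_mul _ (by unfold kern; fun_prop)]
    refine le_trans (setLIntegral_mono' measurableSet_ball (g := fun y =>
      ENNReal.ofReal (ρ ^ ((N : ℝ) + 2 * s)) * ENNReal.ofReal ((u x - u y) ^ 2 * kern s x y))
      fun y hy => ?_) (setLIntegral_le_lintegral _ _)
    rw [← ENNReal.ofReal_mul (by positivity)]
    refine ENNReal.ofReal_le_ofReal ?_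
    rcases eq_or_ne x y with rfl | hxy
    · simp
    have hxy' : 0 < ‖x - y‖ := norm_pos_iff.2 (sub_ne_zero.2 hxy)
    have hk : ‖x - y‖ ^ ((N : ℝ) + 2 * s) ≤ ρ ^ ((N : ℝ) + 2 * s) := by
      refine Real.rpow_le_rpow hxy'.le ?_ hN.le
      rw [Metric.mem_ball, dist_eq_norm, norm_sub_rev] at hy
      exact hy.le
    have hpos : 0 < ‖x - y‖ ^ ((N : ℝ) + 2 * s) := by positivity
    unfold kern
    have h3 : 1 ≤ ρ ^ ((N : ℝ) + 2 * s) * (‖x - y‖ ^ ((N : ℝ) + 2 * s))⁻¹ := by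
      rw [← div_eq_mul_inv, one_le_div hpos]; exact hk
    nlinarith [mul_le_mul_of_nonneg_left h3 (sq_nonneg (u x - u y))]
  · have hpq : (r / 2).HolderConjugate (1 / θ) := by
      have h1θ : 0 < 1 - θ := by linarith
      rw [Real.holderConjugate_iff, hr]
      refine ⟨?_, by field_simp; ring⟩
      rw [show 2 / (1 - θ) / 2 = 1 / (1 - θ) by field_simp, one_lt_div h1θ]
      linarith
    have h4 := ENNReal.lintegral_mul_le_Lp_mul_Lq (volume.restrict (Metric.ball x ρ)) hpq
      (f := fun y => ENNReal.ofReal (u y ^ 2)) (g := fun _ => 1) (by fun_prop) (by fun_prop)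
    simp only [Pi.mul_apply, mul_one, ENNReal.one_rpow, lintegral_const, one_mul,
      Measure.restrict_apply_univ, one_div_one_div] at h4
    refine h4.trans ?_
    gcongr
    · simp only [ofReal_sq_eq_enorm, ← ENNReal.rpow_two, ← ENNReal.rpow_mul]
      rw [one_div_div, show (2 : ℝ) * (r / 2) = r by ring]
      gcongr
      exact Measure.restrict_le_self

/-- Pointwise interpolation: a function is controlled by its localized Gagliardo energy and
its critical norm. This is `sq_mul_volume_ball_le` with the optimal radius. -/
lemma exists_enorm_rpow_le (hN0 : 0 < N) {s : ℝ} (hs : 0 < s) {r θ : ℝ} (hθ1 : θ < 1)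
    (hθ : (N : ℝ) * θ = 2 * s) (hr : r = 2 / (1 - θ)) :
    ∃ C : ℝ≥0∞, C ≠ ⊤ ∧ ∀ u : 𝔼 → ℝ, Measurable u →
      (∫⁻ y, ‖u y‖ₑ ^ r) ≠ 0 → (∫⁻ y, ‖u y‖ₑ ^ r) ≠ ⊤ → ∀ x,
      ‖u x‖ₑ ^ r ≤ C * (∫⁻ y, ‖u y‖ₑ ^ r) ^ θ *
        ∫⁻ y, ENNReal.ofReal ((u x - u y) ^ 2 * kern s x y) := by
  have hNr : 0 < (N : ℝ) := by exact_mod_cast hN0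
  have h1θ : 0 < 1 - θ := by linarith
  have hθ0 : 0 < θ := by
    by_contra h
    nlinarith
  have hr0 : 0 < r := by rw [hr]; positivity
  have : Nonempty (Fin N) := ⟨⟨0, hN0⟩⟩
  set ω : ℝ := volume.real (Metric.ball (0 : 𝔼) 1) with hω
  have hω0 : 0 < ω := by
    rw [hω, Measure.real]
    exact ENNReal.toReal_pos (Metric.measure_ball_pos _ _ one_pos).ne' measure_ball_lt_top.ne
  have hvol : ∀ (x : 𝔼) (ρ : ℝ), 0 < ρ →
      volume (Metric.ball x ρ) = ENNReal.ofReal (ρ ^ (N : ℝ) * ω) := by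
    intro x ρ hρ
    rw [Measure.addHaar_ball_of_pos _ _ hρ, hω, ENNReal.ofReal_mul (by positivity),
      ofReal_measureReal measure_ball_lt_top.ne]
    simp
  set C₁ : ℝ := 2 * (ω⁻¹ + ω ^ (θ - 1)) with hC₁
  refine ⟨ENNReal.ofReal ((2 * C₁) ^ (r / 2)), ENNReal.ofReal_ne_top, fun u hu h0 hT x => ?_⟩
  set I := ∫⁻ y, ‖u y‖ₑ ^ r with hI
  set G := ∫⁻ y, ENNReal.ofReal ((u x - u y) ^ 2 * kern s x y) with hG
  have hC₁0 : 0 < C₁ := by positivity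
  rcases eq_or_ne G ⊤ with hGT | hGT
  · rw [hGT, ENNReal.mul_top]
    · exact le_top
    · refine mul_ne_zero ?_ ?_
      · simp only [ne_eq, ENNReal.ofReal_eq_zero, not_le]; positivity
      · simp [ENNReal.rpow_eq_zero_iff, h0, hT]
  have hi0 : 0 < I.toReal := ENNReal.toReal_pos h0 hT
  have hreal := le_of_forall_radius (A := u x ^ 2) (C := C₁) (g := G.toReal)
    (m := I.toReal ^ (2 / r)) (d := N) (θ := θ) hC₁0.le ENNReal.toReal_nonneg (by positivity) hNr
    hθ1 (by
      intro ρ hρ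
      have h1 := sq_mul_volume_ball_le (N := N) (s := s) (by positivity) hθ0 hθ1 hr hu x hρ
      rw [hvol x ρ hρ, ← hI, ← hG, ← ENNReal.ofReal_toReal hGT, ← ENNReal.ofReal_toReal hT,
        ENNReal.ofReal_rpow_of_pos hi0, ENNReal.ofReal_rpow_of_pos (by positivity),
        ← ENNReal.ofReal_mul (by positivity), ← ENNReal.ofReal_mul (by positivity),
        ← ENNReal.ofReal_mul (by positivity), show (2 : ℝ≥0∞) = ENNReal.ofReal 2 by simp,
        ← ENNReal.ofReal_mul (by positivity), ← ENNReal.ofReal_mul (by positivity),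
        ← ENNReal.ofReal_add (by positivity) (by positivity),
        ENNReal.ofReal_le_ofReal_iff (by positivity)] at h1
      have hρN : 0 < ρ ^ (N : ℝ) := by positivity
      have e1 : ρ ^ ((N : ℝ) + 2 * s) = ρ ^ (N : ℝ) * ρ ^ (N * θ) := by
        rw [hθ, Real.rpow_add hρ]
      have e2 : (ρ ^ (N : ℝ) * ω) ^ θ = ρ ^ (N : ℝ) * ω * (ρ ^ (N * θ - N) * ω ^ (θ - 1)) := by
        rw [Real.mul_rpow hρN.le hω0.le, ← Real.rpow_mul hρ.le, Real.rpow_sub hρ,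
          Real.rpow_sub hω0, Real.rpow_one]
        field_simp
      rw [e1, e2] at h1
      have h2 : u x ^ 2 * (ρ ^ (N : ℝ) * ω) ≤ (ρ ^ (N : ℝ) * ω) *
          (2 * (ρ ^ (N * θ) * G.toReal * ω⁻¹ +
            I.toReal ^ (2 / r) * (ρ ^ (N * θ - N) * ω ^ (θ - 1)))) := by
        refine h1.trans_eq ?_
        field_simp
      rw [mul_comm] at h2
      have h3 := le_of_mul_le_mul_left h2 (by positivity)
      refine h3.trans ?_
      rw [hC₁]
      have p1 : 0 ≤ ρ ^ ((N : ℝ) * θ) * G.toReal * ω ^ (θ - 1) := by positivity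
      have p2 : 0 ≤ I.toReal ^ (2 / r) * ρ ^ ((N : ℝ) * θ - N) * ω⁻¹ := by positivity
      nlinarith)
  have e : ‖u x‖ₑ ^ r = ENNReal.ofReal ((u x ^ 2) ^ (r / 2)) := by
    rw [Real.enorm_eq_ofReal_abs, ENNReal.ofReal_rpow_of_nonneg (abs_nonneg _) hr0.le, ← sq_abs,
      ← Real.rpow_natCast, ← Real.rpow_mul (abs_nonneg _)]
    congr 2
    push_cast; ring
  rw [e, ← ENNReal.ofReal_toReal hGT, ← ENNReal.ofReal_toReal hT, ENNReal.ofReal_rpow_of_pos hi0,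
    ← ENNReal.ofReal_mul (by positivity), ← ENNReal.ofReal_mul (by positivity)]
  refine ENNReal.ofReal_le_ofReal ?_
  refine (Real.rpow_le_rpow (sq_nonneg _) hreal (by positivity)).trans_eq ?_
  rw [Real.mul_rpow (by positivity) (by positivity), Real.mul_rpow (by positivity) (by positivity),
    ← Real.rpow_mul (by positivity), ← Real.rpow_mul (by positivity),
    ← Real.rpow_mul (by positivity)]
  have e3 : (1 - θ) * (r / 2) = 1 := by rw [hr]; field_simp
  have e4 : 2 / r * (θ * (r / 2)) = θ := by field_simp
  rw [e3, e4, Real.rpow_one]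

/-- The Sobolev inequality under the assumption that its left-hand side is finite: integrating the
pointwise interpolation bounds `I = ∫ |u|^r` by `I^θ` times the energy, and `I^θ` is divided out. -/
lemma sobolev_of_finite (hN0 : 0 < N) {s : ℝ} (hs : 0 < s) {r θ : ℝ} (hθ1 : θ < 1)
    (hθ : (N : ℝ) * θ = 2 * s) (hr : r = 2 / (1 - θ)) :
    ∃ C : ℝ≥0∞, C ≠ ⊤ ∧ ∀ u : 𝔼 → ℝ, Measurable u → (∫⁻ y, ‖u y‖ₑ ^ r) ≠ ⊤ →
      (∫⁻ y, ‖u y‖ₑ ^ r) ^ (2 / r) ≤ C * gagliardoEnergy s u := by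
  obtain ⟨C, hC, h⟩ := exists_enorm_rpow_le hN0 hs hθ1 hθ hr
  have h1θ : 0 < 1 - θ := by linarith
  have hr0 : 0 < r := by rw [hr]; positivity
  refine ⟨C, hC, fun u hu hT => ?_⟩
  set I := ∫⁻ y, ‖u y‖ₑ ^ r with hI
  rcases eq_or_ne I 0 with h0 | h0
  · rw [h0, ENNReal.zero_rpow_of_pos (by positivity)]; exact zero_le
  have hE : gagliardoEnergy s u = ∫⁻ x, ∫⁻ y, ENNReal.ofReal ((u x - u y) ^ 2 * kern s x y) := by
    rw [gagliardoEnergy_eq]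
    simp only [quot_sq]
    rw [Measure.volume_eq_prod, lintegral_prod]
    have := measurable_kern (N := N) s
    fun_prop
  have h1 : I ≤ C * I ^ θ * gagliardoEnergy s u := by
    rw [hE, ← lintegral_const_mul]
    · exact lintegral_mono fun x => h u hu h0 hT x
    · refine Measurable.lintegral_prod_right' (f := fun z : 𝔼 × 𝔼 =>
        ENNReal.ofReal ((u z.1 - u z.2) ^ 2 * kern s z.1 z.2)) ?_
      have := measurable_kern (N := N) s
      fun_prop
  have e : 2 / r = 1 - θ := by rw [hr]; field_simp
  rw [e, ENNReal.rpow_sub _ _ h0 hT, ENNReal.rpow_one]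
  refine ENNReal.div_le_of_le_mul ?_
  rw [mul_right_comm] at h1
  exact h1

/-- The Sobolev inequality for square integrable functions. -/
lemma sobolev_of_memLp_two (hN0 : 0 < N) {s : ℝ} (hs : 0 < s) {r θ : ℝ} (hθ1 : θ < 1)
    (hθ : (N : ℝ) * θ = 2 * s) (hr : r = 2 / (1 - θ)) :
    ∃ C : ℝ≥0∞, C ≠ ⊤ ∧ ∀ u : 𝔼 → ℝ, Measurable u → MemLp u 2 volume →
      (∫⁻ y, ‖u y‖ₑ ^ r) ^ (2 / r) ≤ C * gagliardoEnergy s u := by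
  obtain ⟨C, hC, h⟩ := sobolev_of_finite hN0 hs hθ1 hθ hr
  have hNr : 0 < (N : ℝ) := by exact_mod_cast hN0
  have h1θ : 0 < 1 - θ := by linarith
  have hθ0 : 0 < θ := by
    by_contra h
    nlinarith
  have hr2 : 2 ≤ r := by rw [hr, le_div_iff₀ h1θ]; linarith
  have hr0 : 0 < r := by linarith
  refine ⟨C, hC, fun u hu hL => ?_⟩
  -- truncations of `u` at height `n` lie in every `L^q`, `q ≥ 2`, and have less energy
  let T : ℕ → 𝔼 → ℝ := fun n x => max (-(n : ℝ)) (min (u x) n)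
  have hTm : ∀ n, Measurable (T n) := fun n => by fun_prop
  have hTabs : ∀ n x, |T n x| ≤ |u x| := fun n x => by
    have : (0 : ℝ) ≤ n := n.cast_nonneg
    simp only [T]
    rcases le_total (u x) n with h1 | h1 <;> rcases le_total (-(n : ℝ)) (min (u x) n) with h2 | h2
    all_goals simp only [h1, min_eq_left, min_eq_right] at h2 ⊢
    all_goals simp only [h2, max_eq_right, max_eq_left]
    all_goals first | rfl | (rw [abs_le]; cases abs_cases (u x) <;> constructor <;> linarith)
  have hTn : ∀ n x, |T n x| ≤ n := fun n x => by
    have : (0 : ℝ) ≤ n := n.cast_nonneg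
    rw [abs_le]
    exact ⟨le_max_left _ _, max_le (by linarith) (min_le_right _ _)⟩
  have hTE : ∀ n, gagliardoEnergy s (T n) ≤ gagliardoEnergy s u := fun n => by
    rw [gagliardoEnergy_eq, gagliardoEnergy_eq]
    refine lintegral_mono fun z => ENNReal.ofReal_le_ofReal ?_
    rw [quot_sq, quot_sq]
    refine mul_le_mul_of_nonneg_right ?_ (kern_nonneg _ _ _)
    rw [sq_le_sq]
    refine (abs_max_sub_max_le_max _ _ _ _).trans ?_
    simp only [sub_self, abs_zero]
    refine max_le (abs_nonneg _) ((abs_min_sub_min_le_max _ _ _ _).trans ?_)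
    simp
  have hTfin : ∀ n, (∫⁻ y, ‖T n y‖ₑ ^ r) ≠ ⊤ := fun n => by
    have hb : ∀ y, ‖T n y‖ₑ ^ r ≤ (n : ℝ≥0∞) ^ (r - 2) * ENNReal.ofReal (u y ^ 2) := fun y => by
      have e : ‖T n y‖ₑ ^ r = ‖T n y‖ₑ ^ (r - 2) * ‖T n y‖ₑ ^ (2 : ℝ) := by
        rw [← ENNReal.rpow_add_of_nonneg _ _ (by linarith) (by norm_num)]; congr 1; ring
      rw [e, ofReal_sq_eq_enorm, ← ENNReal.rpow_two]
      gcongr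
      · rw [Real.enorm_eq_ofReal_abs]
        exact (ENNReal.ofReal_le_ofReal (hTn n y)).trans_eq (by simp)
      · rw [Real.enorm_eq_ofReal_abs, Real.enorm_eq_ofReal_abs]
        exact ENNReal.ofReal_le_ofReal (hTabs n y)
    refine ne_top_of_le_ne_top ?_ (lintegral_mono hb)
    rw [lintegral_const_mul _ (by fun_prop), ← eLpNorm_two_sq]
    exact ENNReal.mul_ne_top (ENNReal.rpow_ne_top_of_nonneg (by linarith) (by simp))
      (ENNReal.pow_ne_top hL.2.ne)
  have hpt : ∀ y, Tendsto (fun n => ‖T n y‖ₑ ^ r) atTop (𝓝 (‖u y‖ₑ ^ r)) := fun y => by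
    refine tendsto_const_nhds.congr' ?_
    filter_upwards [eventually_ge_atTop ⌈|u y|⌉₊] with n hn
    have : |u y| ≤ n := Nat.ceil_le.1 hn
    have h2 := abs_le.1 this
    simp only [T]
    rw [min_eq_left h2.2, max_eq_right h2.1]
  have hF : ∫⁻ y, ‖u y‖ₑ ^ r ≤ liminf (fun n => ∫⁻ y, ‖T n y‖ₑ ^ r) atTop := by
    refine le_trans (le_of_eq ?_) (lintegral_liminf_le fun n => ?_)
    · exact lintegral_congr fun y => ((hpt y).liminf_eq).symm
    · have := hTm n; fun_prop
  have hbound : ∀ n, ∫⁻ y, ‖T n y‖ₑ ^ r ≤ (C * gagliardoEnergy s u) ^ (r / 2) := fun n => by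
    have h1 := (h (T n) (hTm n) (hTfin n)).trans (mul_le_mul_right (hTE n) C)
    have h2 := ENNReal.rpow_le_rpow h1 (by positivity : 0 ≤ r / 2)
    rwa [← ENNReal.rpow_mul, show 2 / r * (r / 2) = 1 by field_simp, ENNReal.rpow_one] at h2
  have h3 : ∫⁻ y, ‖u y‖ₑ ^ r ≤ (C * gagliardoEnergy s u) ^ (r / 2) :=
    hF.trans (liminf_le_of_le (by isBoundedDefault) fun b hb => by
      obtain ⟨n, hn⟩ := hb.exists
      exact hn.trans (hbound n))
  have h4 := ENNReal.rpow_le_rpow h3 (by positivity : 0 ≤ 2 / r)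
  rwa [← ENNReal.rpow_mul, show r / 2 * (2 / r) = 1 by field_simp, ENNReal.rpow_one] at h4

/-! ### Cutoff functions -/

/-- Squared oscillation of a Lipschitz function with values in an interval of length one, against
the kernel: this is integrable because `0 < s < 1`. -/
lemma integrable_min_mul_kernel (hN0 : 0 < N) {s : ℝ} (hs0 : 0 < s) (hs1 : s < 1) :
    Integrable fun z : 𝔼 => min 1 (‖z‖ ^ 2) * (‖z‖ ^ ((N : ℝ) + 2 * s))⁻¹ := by
  have : Nonempty (Fin N) := ⟨⟨0, hN0⟩⟩
  refine (integrable_fun_norm_addHaar (volume : Measure 𝔼)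
    (f := fun y : ℝ => min 1 (y ^ 2) * (y ^ ((N : ℝ) + 2 * s))⁻¹)).2 ?_
  have hcast : ((N - 1 : ℕ) : ℝ) = N - 1 := by
    rw [Nat.cast_sub hN0]; simp
  simp only [finrank_euclideanSpace, Fintype.card_fin, smul_eq_mul]
  rw [← Set.Ioc_union_Ioi_eq_Ioi zero_le_one]
  refine IntegrableOn.union ?_ ?_
  · have h : IntegrableOn (fun y : ℝ => y ^ (1 - 2 * s)) (Set.Ioc 0 1) := by
      rw [← intervalIntegrable_iff_integrableOn_Ioc_of_le zero_le_one]
      exact intervalIntegral.intervalIntegrable_rpow' (by linarith)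
    refine h.congr_fun (fun y hy => ?_) measurableSet_Ioc
    have hy0 : 0 < y := hy.1
    simp only
    rw [min_eq_right (by nlinarith [hy.1, hy.2]), ← Real.rpow_natCast, hcast, ← Real.rpow_natCast,
      ← Real.rpow_neg hy0.le, ← Real.rpow_add hy0, ← Real.rpow_add hy0]
    congr 1; push_cast; ring
  · have h : IntegrableOn (fun y : ℝ => y ^ (-1 - 2 * s)) (Set.Ioi 1) :=
      integrableOn_Ioi_rpow_of_lt (by linarith) one_pos
    refine h.congr_fun (fun y (hy : 1 < y) => ?_) measurableSet_Ioi
    have hy0 : 0 < y := by linarith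
    simp only
    rw [min_eq_left (by nlinarith), ← Real.rpow_natCast, hcast, one_mul,
      ← Real.rpow_neg hy0.le, ← Real.rpow_add hy0]
    congr 1; ring

/-- The localized energy of a function that varies by at most one, on the length scale `R`, is of
order `R^{-2s}`. -/
lemma exists_lintegral_sq_mul_kern_le (hN0 : 0 < N) {s : ℝ} (hs0 : 0 < s) (hs1 : s < 1) :
    ∃ C : ℝ, 0 ≤ C ∧ ∀ R : ℝ, 0 < R → ∀ ζ : 𝔼 → ℝ,
      (∀ x y, |ζ x - ζ y| ≤ min 1 (‖x - y‖ / R)) → ∀ x,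
      ∫⁻ y, ENNReal.ofReal ((ζ x - ζ y) ^ 2 * kern s x y) ≤
        ENNReal.ofReal (C * R ^ (-(2 * s))) := by
  set h : 𝔼 → ℝ := fun z => min 1 (‖z‖ ^ 2) * (‖z‖ ^ ((N : ℝ) + 2 * s))⁻¹ with hh
  have hint : Integrable h := integrable_min_mul_kernel hN0 hs0 hs1
  have hnn : ∀ z, 0 ≤ h z := fun z => by positivity
  refine ⟨∫ z, h z, integral_nonneg hnn, fun R hR ζ hζ x => ?_⟩
  have hR' : R⁻¹ ≠ 0 := by positivity
  have h1 : ∀ y, (ζ x - ζ y) ^ 2 * kern s x y ≤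
      R ^ (-((N : ℝ) + 2 * s)) * h (R⁻¹ • (x - y)) := fun y => by
    have e : h (R⁻¹ • (x - y)) =
        min 1 ((‖x - y‖ / R) ^ 2) * (kern s x y * R ^ ((N : ℝ) + 2 * s)) := by
      simp only [hh, kern, norm_smul, norm_inv, Real.norm_eq_abs, abs_of_pos hR]
      rw [Real.mul_rpow (by positivity) (by positivity), Real.inv_rpow hR.le, mul_inv, inv_inv,
        ← div_eq_inv_mul, mul_comm (R ^ _)]
    rw [e, Real.rpow_neg hR.le]
    have hp : 0 < R ^ ((N : ℝ) + 2 * s) := by positivity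
    have : (ζ x - ζ y) ^ 2 ≤ min 1 ((‖x - y‖ / R) ^ 2) := by
      have h2 := hζ x y
      rw [← sq_abs, le_min_iff]
      rw [le_min_iff] at h2
      exact ⟨by nlinarith [abs_nonneg (ζ x - ζ y)],
        pow_le_pow_left₀ (abs_nonneg _) h2.2 2⟩
    calc (ζ x - ζ y) ^ 2 * kern s x y ≤ min 1 ((‖x - y‖ / R) ^ 2) * kern s x y :=
          mul_le_mul_of_nonneg_right this (kern_nonneg _ _ _)
      _ = _ := by field_simp
  have hint2 : Integrable fun y : 𝔼 => R ^ (-((N : ℝ) + 2 * s)) * h (R⁻¹ • (x - y)) := by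
    refine Integrable.const_mul ?_ _
    exact ((integrable_comp_smul_iff volume h hR').2 hint).comp_sub_left x
  calc ∫⁻ y, ENNReal.ofReal ((ζ x - ζ y) ^ 2 * kern s x y)
      ≤ ∫⁻ y, ENNReal.ofReal (R ^ (-((N : ℝ) + 2 * s)) * h (R⁻¹ • (x - y))) :=
        lintegral_mono fun y => ENNReal.ofReal_le_ofReal (h1 y)
    _ = ENNReal.ofReal (∫ y, R ^ (-((N : ℝ) + 2 * s)) * h (R⁻¹ • (x - y))) :=
        (ofReal_integral_eq_lintegral_ofReal hint2
          (.of_forall fun y => mul_nonneg (by positivity) (hnn _))).symm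
    _ ≤ _ := by
        refine ENNReal.ofReal_le_ofReal (le_of_eq ?_)
        rw [integral_const_mul, integral_sub_left_eq_self (fun y => h (R⁻¹ • y)) volume x,
          Measure.integral_comp_smul]
        simp only [finrank_euclideanSpace, Fintype.card_fin, smul_eq_mul, inv_pow, inv_inv]
        rw [abs_of_pos (by positivity), Real.rpow_neg hR.le, Real.rpow_neg hR.le,
          Real.rpow_add hR, Real.rpow_natCast]
        field_simp

/-- The Lipschitz cutoff equal to `1` on the ball of radius `R` and to `0` off the ball of
radius `2R`. -/
noncomputable def cutoff (R : ℝ) (x : 𝔼) : ℝ := max 0 (min 1 (2 - ‖x‖ / R))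

@[fun_prop]
lemma measurable_cutoff (R : ℝ) : Measurable (cutoff R : 𝔼 → ℝ) := by
  unfold cutoff; fun_prop

lemma cutoff_nonneg (R : ℝ) (x : 𝔼) : 0 ≤ cutoff R x := le_max_left _ _

lemma cutoff_le_one (R : ℝ) (x : 𝔼) : cutoff R x ≤ 1 := max_le zero_le_one (min_le_left _ _)

lemma cutoff_eq_zero {R : ℝ} (hR : 0 < R) {x : 𝔼} (hx : 2 * R ≤ ‖x‖) : cutoff R x = 0 := by
  unfold cutoff
  refine max_eq_left ((min_le_right _ _).trans ?_)
  rw [sub_nonpos, le_div_iff₀ hR]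
  exact hx

lemma cutoff_eq_one {R : ℝ} (hR : 0 < R) {x : 𝔼} (hx : ‖x‖ ≤ R) : cutoff R x = 1 := by
  unfold cutoff
  have : ‖x‖ / R ≤ 1 := by rwa [div_le_one hR]
  rw [min_eq_left (by linarith), max_eq_right zero_le_one]

lemma abs_cutoff_sub_le {R : ℝ} (hR : 0 < R) (x y : 𝔼) :
    |cutoff R x - cutoff R y| ≤ min 1 (‖x - y‖ / R) := by
  refine le_min ?_ ?_
  · rw [abs_le]
    constructor <;> linarith [cutoff_nonneg R x, cutoff_nonneg R y, cutoff_le_one R x,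
      cutoff_le_one R y]
  · unfold cutoff
    refine (abs_max_sub_max_le_max _ _ _ _).trans (max_le (by simp; positivity) ?_)
    refine (abs_min_sub_min_le_max _ _ _ _).trans (max_le (by simp; positivity) ?_)
    rw [show 2 - ‖x‖ / R - (2 - ‖y‖ / R) = (‖y‖ - ‖x‖) / R by ring, abs_div, abs_of_pos hR]
    gcongr
    rw [norm_sub_rev]
    exact abs_norm_sub_norm_le _ _

/-- The localized energy of the cutoffs is controlled, uniformly in the radius, by the Hardy
weight. -/
lemma exists_lintegral_cutoff_le (hN0 : 0 < N) {s : ℝ} (hs0 : 0 < s) (hs1 : s < 1) :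
    ∃ C : ℝ, 0 ≤ C ∧ ∀ R : ℝ, 1 ≤ R → ∀ x : 𝔼,
      ∫⁻ y, ENNReal.ofReal ((cutoff R x - cutoff R y) ^ 2 * kern s x y) ≤
        ENNReal.ofReal (C * (1 + ‖x‖) ^ (-(2 * s))) := by
  obtain ⟨C, hC, h⟩ := exists_lintegral_sq_mul_kern_le hN0 hs0 hs1
  have : Nonempty (Fin N) := ⟨⟨0, hN0⟩⟩
  set ω : ℝ := volume.real (Metric.ball (0 : 𝔼) 1) with hω
  have hω0 : 0 ≤ ω := measureReal_nonneg
  refine ⟨C * 5 ^ (2 * s) + ω * 4 ^ (2 * s), by positivity, fun R hR x => ?_⟩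
  have hR0 : 0 < R := by linarith
  have hx0 : 0 ≤ ‖x‖ := norm_nonneg x
  have hw : 0 < 1 + ‖x‖ := by positivity
  rcases lt_or_ge ‖x‖ (4 * R) with hx | hx
  -- near the ball the bound `R^{-2s}` suffices; far away `|x - y|` is comparable to `|x|` for every
  -- `y` in the support
  · refine (h R hR0 _ (abs_cutoff_sub_le hR0) x).trans (ENNReal.ofReal_le_ofReal ?_)
    have h1 : R ^ (-(2 * s)) ≤ 5 ^ (2 * s) * (1 + ‖x‖) ^ (-(2 * s)) := by
      rw [Real.rpow_neg hR0.le, Real.rpow_neg hw.le, ← div_eq_mul_inv, inv_eq_one_div,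
        div_le_div_iff₀ (by positivity) (by positivity), one_mul,
        ← Real.mul_rpow (by norm_num) hR0.le]
      exact Real.rpow_le_rpow hw.le (by linarith) (by linarith)
    calc C * R ^ (-(2 * s)) ≤ C * (5 ^ (2 * s) * (1 + ‖x‖) ^ (-(2 * s))) := by gcongr
      _ ≤ _ := by
        rw [add_mul, mul_assoc C]
        exact le_add_of_nonneg_right (by positivity)
  · have hx' : 0 < ‖x‖ := by linarith
    have hcx : cutoff R x = 0 := cutoff_eq_zero hR0 (by linarith)
    have h1 : ∀ y : 𝔼, ENNReal.ofReal ((cutoff R x - cutoff R y) ^ 2 * kern s x y) ≤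
        (Metric.ball (0 : 𝔼) (2 * R)).indicator
          (fun _ => ENNReal.ofReal ((‖x‖ / 2) ^ (-((N : ℝ) + 2 * s)))) y := fun y => by
      by_cases hy : y ∈ Metric.ball (0 : 𝔼) (2 * R)
      · rw [Set.indicator_of_mem hy]
        rw [mem_ball_zero_iff] at hy
        refine ENNReal.ofReal_le_ofReal ?_
        have hxy : ‖x‖ / 2 ≤ ‖x - y‖ := by
          have := norm_sub_norm_le x y
          linarith
        have hk : kern s x y ≤ (‖x‖ / 2) ^ (-((N : ℝ) + 2 * s)) := by
          unfold kern
          rw [Real.rpow_neg (by positivity)]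
          gcongr
        have hc : (cutoff R x - cutoff R y) ^ 2 ≤ 1 := by
          rw [hcx]
          nlinarith [cutoff_nonneg R y, cutoff_le_one R y]
        calc _ ≤ 1 * kern s x y := mul_le_mul_of_nonneg_right hc (kern_nonneg _ _ _)
          _ ≤ _ := by rwa [one_mul]
      · rw [Set.indicator_of_notMem hy, hcx, cutoff_eq_zero hR0]
        · simp
        · simpa using hy
    refine (lintegral_mono h1).trans ?_
    rw [lintegral_indicator measurableSet_ball, setLIntegral_const,
      Measure.addHaar_ball_of_pos _ _ (by positivity), ← ofReal_measureReal measure_ball_lt_top.ne,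
      ← hω, ← ENNReal.ofReal_mul (by positivity), ← ENNReal.ofReal_mul (by positivity)]
    refine ENNReal.ofReal_le_ofReal ?_
    simp only [finrank_euclideanSpace, Fintype.card_fin]
    have e1 : (2 * R) ^ N ≤ (‖x‖ / 2) ^ (N : ℝ) := by
      rw [Real.rpow_natCast]
      gcongr
      linarith
    have e2 : (‖x‖ / 2) ^ (-(2 * s)) ≤ 4 ^ (2 * s) * (1 + ‖x‖) ^ (-(2 * s)) := by
      rw [Real.rpow_neg (by positivity), Real.rpow_neg hw.le, ← div_eq_mul_inv, inv_eq_one_div,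
        div_le_div_iff₀ (by positivity) (by positivity), one_mul,
        ← Real.mul_rpow (by norm_num) (by positivity)]
      exact Real.rpow_le_rpow hw.le (by linarith) (by linarith)
    calc (‖x‖ / 2) ^ (-((N : ℝ) + 2 * s)) * ((2 * R) ^ N * ω)
        ≤ (‖x‖ / 2) ^ (-((N : ℝ) + 2 * s)) * ((‖x‖ / 2) ^ (N : ℝ) * ω) := by gcongr
      _ = ω * (‖x‖ / 2) ^ (-(2 * s)) := by
        rw [← mul_assoc, ← Real.rpow_add (by positivity)]
        ring_nf
      _ ≤ ω * (4 ^ (2 * s) * (1 + ‖x‖) ^ (-(2 * s))) := by gcongr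
      _ ≤ _ := by
        rw [add_mul, mul_assoc ω]
        exact le_add_of_nonneg_left (by positivity)

/-- The squared `L²` norm of a difference quotient of `ζ`, weighted by a function of the first
variable, in terms of the localized energy of `ζ`. -/
lemma lintegral_sq_mul_quot_sq {s : ℝ} {u ζ : 𝔼 → ℝ} (hu : Measurable u) (hζ : Measurable ζ) :
    ∫⁻ z : 𝔼 × 𝔼, ENNReal.ofReal ((u z.1 * quot s ζ z) ^ 2) =
      ∫⁻ x, ENNReal.ofReal (u x ^ 2) *
        ∫⁻ y, ENNReal.ofReal ((ζ x - ζ y) ^ 2 * kern s x y) := by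
  have hq := measurable_quot (s := s) hζ
  rw [Measure.volume_eq_prod, lintegral_prod _ (by fun_prop)]
  refine lintegral_congr fun x => ?_
  rw [← lintegral_const_mul _ (by unfold kern; fun_prop)]
  refine lintegral_congr fun y => ?_
  rw [mul_pow, quot_sq, ENNReal.ofReal_mul (sq_nonneg _)]

lemma gagliardoEnergy_lt_top_of_lipschitz (hN0 : 0 < N) {s : ℝ} (hs0 : 0 < s) (hs1 : s < 1)
    {R ρ : ℝ} (hR : 0 < R) {ζ : 𝔼 → ℝ} (hζm : Measurable ζ)
    (hζ : ∀ x y, |ζ x - ζ y| ≤ min 1 (‖x - y‖ / R)) (h0 : ∀ x, ρ ≤ ‖x‖ → ζ x = 0) :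
    gagliardoEnergy s ζ < ⊤ := by
  obtain ⟨C, hC, h⟩ := exists_lintegral_sq_mul_kern_le hN0 hs0 hs1
  let b : 𝔼 → ℝ := (Metric.ball (0 : 𝔼) ρ).indicator 1
  have hb : Measurable b := measurable_one.indicator measurableSet_ball
  have hfin : ∫⁻ z : 𝔼 × 𝔼, ENNReal.ofReal ((b z.1 * quot s ζ z) ^ 2) < ⊤ := by
    rw [lintegral_sq_mul_quot_sq hb hζm]
    refine lt_of_le_of_lt (lintegral_mono fun x => mul_le_mul_right (h R hR ζ hζ x) _) ?_
    rw [lintegral_mul_const _ (by fun_prop)]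
    refine ENNReal.mul_lt_top ?_ ENNReal.ofReal_lt_top
    have : ∀ x, ENNReal.ofReal (b x ^ 2) = (Metric.ball (0 : 𝔼) ρ).indicator 1 x := fun x => by
      by_cases hx : x ∈ Metric.ball (0 : 𝔼) ρ <;> simp [b, hx]
    simp only [this]
    rw [lintegral_indicator_one measurableSet_ball]
    exact measure_ball_lt_top
  have hswap : ∫⁻ z : 𝔼 × 𝔼, ENNReal.ofReal ((b z.2 * quot s ζ z) ^ 2) < ⊤ := by
    have := (Measure.measurePreserving_swap (μ := (volume : Measure 𝔼))
      (ν := (volume : Measure 𝔼))).lintegral_comp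
      (f := fun z => ENNReal.ofReal ((b z.1 * quot s ζ z) ^ 2))
      (by have := measurable_quot (s := s) hζm; fun_prop)
    rw [← Measure.volume_eq_prod] at this
    rw [← this] at hfin
    refine lt_of_le_of_lt (le_of_eq (lintegral_congr fun z => ?_)) hfin
    simp only [quot, Prod.fst_swap, Prod.snd_swap]
    rw [kern_symm]
    congr 1
    ring
  rw [gagliardoEnergy_eq]
  refine lt_of_le_of_lt (lintegral_mono (g := fun z =>
    ENNReal.ofReal ((b z.1 * quot s ζ z) ^ 2) + ENNReal.ofReal ((b z.2 * quot s ζ z) ^ 2))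
    fun z => ?_) ?_
  · beta_reduce
    rw [← ENNReal.ofReal_add (sq_nonneg _) (sq_nonneg _)]
    refine ENNReal.ofReal_le_ofReal ?_
    by_cases h1 : z.1 ∈ Metric.ball (0 : 𝔼) ρ
    · simp only [b, Set.indicator_of_mem h1, Pi.one_apply, one_mul]
      exact le_add_of_nonneg_right (sq_nonneg _)
    by_cases h2 : z.2 ∈ Metric.ball (0 : 𝔼) ρ
    · simp only [b, Set.indicator_of_mem h2, Pi.one_apply, one_mul]
      exact le_add_of_nonneg_left (sq_nonneg _)
    have e1 : ζ z.1 = 0 := h0 _ (by simpa using h1)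
    have e2 : ζ z.2 = 0 := h0 _ (by simpa using h2)
    simp only [quot, e1, e2]
    simp
  · rw [lintegral_add_left]
    · exact ENNReal.add_lt_top.2 ⟨hfin, hswap⟩
    · have := measurable_quot (s := s) hζm
      fun_prop

/-! ### The homogeneous energy space with Hardy weight -/

/-- Measurable functions of finite Gagliardo energy that are square integrable against the Hardy
weight `(1 + |x|)^{-2s}`. The weight is what makes cutoffs converge in energy, and it plays the
role of the assumption `u ∈ L²`, which is not available here. -/
structure HardySobolev (s : ℝ) (u : 𝔼 → ℝ) : Prop where
  measurable : Measurable u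
  memLp_quot : MemLp (quot s u) 2 volume
  hardy : ∫⁻ x, ENNReal.ofReal (u x ^ 2 * (1 + ‖x‖) ^ (-(2 * s))) < ⊤

/-- Strong convergence passes to pairings. -/
lemma tendsto_integral_mul_of_eLpNorm {α ι : Type*} [MeasurableSpace α] {μ : Measure α}
    {l : Filter ι} {p q : ℝ≥0∞} [ENNReal.HolderTriple p q 1] {f g : α → ℝ} {G : ι → α → ℝ}
    (hf : MemLp f p μ) (hg : MemLp g q μ) (hG : ∀ i, MemLp (G i) q μ)
    (h : Tendsto (fun i => eLpNorm (G i - g) q μ) l (𝓝 0)) :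
    Tendsto (fun i => ∫ x, f x * G i x ∂μ) l (𝓝 (∫ x, f x * g x ∂μ)) := by
  have : ENNReal.HolderTriple q p 1 := ENNReal.HolderTriple.symm
  refine tendsto_integral_of_L1' (fun x => f x * g x) ?_ (.of_forall fun i => ?_) ?_
  · exact (memLp_one_iff_integrable.1 (hg.mul hf)).1
  · exact memLp_one_iff_integrable.1 ((hG i).mul hf)
  · refine tendsto_of_tendsto_of_tendsto_of_le_of_le tendsto_const_nhds
      (h := fun i => eLpNorm f p μ * eLpNorm (G i - g) q μ) ?_ (fun _ => zero_le) fun i => ?_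
    · have := ENNReal.Tendsto.const_mul h (a := eLpNorm f p μ) (Or.inr hf.2.ne)
      simpa using this
    · have e : ((fun x => f x * G i x) - fun x => f x * g x) = f • (G i - g) := by
        ext x; simp [mul_sub]
      change eLpNorm ((fun x => f x * G i x) - fun x => f x * g x) 1 μ ≤ _
      rw [e]
      exact eLpNorm_smul_le_mul_eLpNorm ((hG i).sub hg).1 hf.1

namespace HardySobolev

variable {s : ℝ} {u : EuclideanSpace ℝ (Fin N) → ℝ}

lemma energy_lt_top (hu : HardySobolev s u) : gagliardoEnergy s u < ⊤ :=
  (memLp_quot_iff hu.measurable).1 hu.memLp_quot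

/-- The commutator of a cutoff with the difference quotient is square integrable. -/
lemma memLp_mul_quot_cutoff (hu : HardySobolev s u) (hN0 : 0 < N) (hs0 : 0 < s) (hs1 : s < 1)
    {R : ℝ} (hR : 1 ≤ R) :
    MemLp (fun z : 𝔼 × 𝔼 => u z.1 * quot s (cutoff R) z) 2 volume := by
  obtain ⟨C, hC, h⟩ := exists_lintegral_cutoff_le hN0 hs0 hs1
  have hm := hu.measurable
  have hq := measurable_quot (s := s) (measurable_cutoff (N := N) R)
  refine ⟨by fun_prop, ?_⟩
  have : eLpNorm (fun z : 𝔼 × 𝔼 => u z.1 * quot s (cutoff R) z) 2 volume ^ 2 < ⊤ := by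
    rw [eLpNorm_two_sq, lintegral_sq_mul_quot_sq hm (measurable_cutoff R)]
    refine lt_of_le_of_lt (lintegral_mono (g := fun x => ENNReal.ofReal C *
      ENNReal.ofReal (u x ^ 2 * (1 + ‖x‖) ^ (-(2 * s)))) fun x => ?_) ?_
    · beta_reduce
      refine (mul_le_mul_right (h R hR x) _).trans_eq ?_
      rw [← ENNReal.ofReal_mul (sq_nonneg _), ← ENNReal.ofReal_mul hC]
      ring_nf
    · rw [lintegral_const_mul _ (by fun_prop)]
      exact ENNReal.mul_lt_top ENNReal.ofReal_lt_top hu.hardy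
  simpa using this

lemma quot_cutoff_mul (s R : ℝ) (u : 𝔼 → ℝ) (z : 𝔼 × 𝔼) :
    quot s (fun x => cutoff R x * u x) z =
      cutoff R z.2 * quot s u z + u z.1 * quot s (cutoff R) z := by
  unfold quot; ring

lemma cutoff_mul (hu : HardySobolev s u) (hN0 : 0 < N) (hs0 : 0 < s) (hs1 : s < 1)
    {R : ℝ} (hR : 1 ≤ R) : HardySobolev s (fun x => cutoff R x * u x) where
  measurable := (measurable_cutoff R).mul hu.measurable
  memLp_quot := by
    have e : quot s (fun x => cutoff R x * u x) = (fun z : 𝔼 × 𝔼 => cutoff R z.2 * quot s u z) +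
        fun z : 𝔼 × 𝔼 => u z.1 * quot s (cutoff R) z := by
      ext z; exact quot_cutoff_mul s R u z
    rw [e]
    refine MemLp.add ?_ (hu.memLp_mul_quot_cutoff hN0 hs0 hs1 hR)
    have hq := measurable_quot (s := s) hu.measurable
    refine hu.memLp_quot.mono (by fun_prop) (.of_forall fun z => ?_)
    rw [norm_mul, Real.norm_of_nonneg (cutoff_nonneg _ _)]
    exact mul_le_of_le_one_left (norm_nonneg _) (cutoff_le_one _ _)
  hardy := by
    refine lt_of_le_of_lt (lintegral_mono fun x => ENNReal.ofReal_le_ofReal ?_) hu.hardy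
    rw [mul_pow]
    have h1 : cutoff R x ^ 2 ≤ 1 := pow_le_one₀ (cutoff_nonneg _ _) (cutoff_le_one _ _)
    have h2 : 0 ≤ u x ^ 2 * (1 + ‖x‖) ^ (-(2 * s)) := by positivity
    nlinarith

lemma memLp_two_cutoff_mul (hu : HardySobolev s u) (hs0 : 0 < s) {R : ℝ} (hR : 0 < R) :
    MemLp (fun x => cutoff R x * u x) 2 volume := by
  have hm := hu.measurable
  refine ⟨by fun_prop, ?_⟩
  have : eLpNorm (fun x => cutoff R x * u x) 2 volume ^ 2 < ⊤ := by
    rw [eLpNorm_two_sq]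
    refine lt_of_le_of_lt (lintegral_mono (g := fun x => ENNReal.ofReal ((1 + 2 * R) ^ (2 * s)) *
      ENNReal.ofReal (u x ^ 2 * (1 + ‖x‖) ^ (-(2 * s)))) fun x => ?_) ?_
    · beta_reduce
      rw [← ENNReal.ofReal_mul (by positivity)]
      refine ENNReal.ofReal_le_ofReal ?_
      have hw : 0 < 1 + ‖x‖ := by positivity
      rcases le_or_gt (2 * R) ‖x‖ with hx | hx
      · rw [cutoff_eq_zero hR hx, zero_mul, zero_pow two_ne_zero]
        positivity
      · have h1 : cutoff R x ^ 2 ≤ 1 := pow_le_one₀ (cutoff_nonneg _ _) (cutoff_le_one _ _)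
        have h2 : 1 ≤ (1 + 2 * R) ^ (2 * s) * (1 + ‖x‖) ^ (-(2 * s)) := by
          rw [Real.rpow_neg hw.le, ← div_eq_mul_inv, one_le_div (by positivity)]
          exact Real.rpow_le_rpow hw.le (by linarith) (by linarith)
        rw [mul_pow]
        nlinarith [mul_le_mul_of_nonneg_right h1 (sq_nonneg (u x)),
          mul_le_mul_of_nonneg_left h2 (sq_nonneg (u x))]
    · rw [lintegral_const_mul _ (by fun_prop)]
      exact ENNReal.mul_lt_top ENNReal.ofReal_lt_top hu.hardy
  simpa using this

/-- Cutoffs converge in energy. Of the two terms of the Leibniz rule one converges by dominated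
convergence, and the commutator vanishes in the limit: its localized energy is dominated by the
Hardy weight and tends to zero pointwise like `n^{-2s}`. -/
lemma tendsto_eLpNorm_quot_cutoff (hu : HardySobolev s u) (hN0 : 0 < N) (hs0 : 0 < s)
    (hs1 : s < 1) :
    Tendsto (fun n : ℕ => eLpNorm (quot s (fun x => cutoff (n + 1) x * u x) - quot s u) 2 volume)
      atTop (𝓝 0) := by
  have hm := hu.measurable
  have hq := measurable_quot (s := s) hm
  have hA : Tendsto (fun n : ℕ => ∫⁻ z : 𝔼 × 𝔼,
      ENNReal.ofReal (((cutoff ((n : ℝ) + 1) z.2 - 1) * quot s u z) ^ 2)) atTop (𝓝 0) := by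
    have := tendsto_lintegral_of_dominated_convergence (μ := (volume : Measure (𝔼 × 𝔼)))
      (F := fun (n : ℕ) z => ENNReal.ofReal (((cutoff ((n : ℝ) + 1) z.2 - 1) * quot s u z) ^ 2))
      (f := fun _ => 0) (fun z => ENNReal.ofReal (quot s u z ^ 2)) (fun n => by fun_prop)
      (fun n => .of_forall fun z => ENNReal.ofReal_le_ofReal ?_) ?_ (.of_forall fun z => ?_)
    · simpa using this
    · rw [mul_pow]
      refine mul_le_of_le_one_left (sq_nonneg _) ?_
      nlinarith [cutoff_nonneg ((n : ℝ) + 1) z.2, cutoff_le_one ((n : ℝ) + 1) z.2]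
    · rw [← gagliardoEnergy_eq]; exact hu.energy_lt_top.ne
    · refine tendsto_const_nhds.congr' ?_
      filter_upwards [eventually_ge_atTop ⌈‖z.2‖⌉₊] with n hn
      rw [cutoff_eq_one (by positivity) ((Nat.ceil_le.1 hn).trans (by linarith))]
      simp
  have hB : Tendsto (fun n : ℕ => ∫⁻ z : 𝔼 × 𝔼,
      ENNReal.ofReal ((u z.1 * quot s (cutoff ((n : ℝ) + 1)) z) ^ 2)) atTop (𝓝 0) := by
    obtain ⟨C, hC, h⟩ := exists_lintegral_cutoff_le hN0 hs0 hs1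
    obtain ⟨C', hC', h'⟩ := exists_lintegral_sq_mul_kern_le hN0 hs0 hs1
    simp only [lintegral_sq_mul_quot_sq hm (measurable_cutoff _)]
    have := tendsto_lintegral_of_dominated_convergence (μ := (volume : Measure 𝔼))
      (F := fun (n : ℕ) x => ENNReal.ofReal (u x ^ 2) * ∫⁻ y, ENNReal.ofReal
        ((cutoff ((n : ℝ) + 1) x - cutoff ((n : ℝ) + 1) y) ^ 2 * kern s x y))
      (f := fun _ => 0) (fun x => ENNReal.ofReal C *
        ENNReal.ofReal (u x ^ 2 * (1 + ‖x‖) ^ (-(2 * s)))) (fun n => ?_)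
      (fun n => .of_forall fun x => ?_) ?_ (.of_forall fun x => ?_)
    · simpa using this
    · refine Measurable.mul (by fun_prop) ?_
      have := measurable_kern (N := N) s
      exact Measurable.lintegral_prod_right' (f := fun z : 𝔼 × 𝔼 => ENNReal.ofReal
        ((cutoff ((n : ℝ) + 1) z.1 - cutoff ((n : ℝ) + 1) z.2) ^ 2 * kern s z.1 z.2))
        (by fun_prop)
    · refine (mul_le_mul_right (h ((n : ℝ) + 1) (by simp) x) _).trans_eq ?_
      beta_reduce
      rw [← ENNReal.ofReal_mul (sq_nonneg _), ← ENNReal.ofReal_mul hC]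
      ring_nf
    · rw [lintegral_const_mul _ (by fun_prop)]
      exact (ENNReal.mul_lt_top ENNReal.ofReal_lt_top hu.hardy).ne
    · have hlim : Tendsto (fun n : ℕ => ENNReal.ofReal (u x ^ 2) *
          ENNReal.ofReal (C' * ((n : ℝ) + 1) ^ (-(2 * s)))) atTop (𝓝 0) := by
        have h1 : Tendsto (fun n : ℕ => C' * ((n : ℝ) + 1) ^ (-(2 * s))) atTop (𝓝 (C' * 0)) := by
          refine Tendsto.const_mul _ ?_
          exact (tendsto_rpow_neg_atTop (by linarith : 0 < 2 * s)).comp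
            (tendsto_atTop_add_const_right _ _ tendsto_natCast_atTop_atTop)
        have h2 := ENNReal.Tendsto.const_mul (a := ENNReal.ofReal (u x ^ 2))
          (ENNReal.tendsto_ofReal h1) (Or.inr ENNReal.ofReal_ne_top)
        simpa using h2
      refine tendsto_of_tendsto_of_tendsto_of_le_of_le tendsto_const_nhds hlim
        (fun _ => zero_le) fun n => ?_
      exact mul_le_mul_right
        (h' ((n : ℝ) + 1) (by positivity) _ (abs_cutoff_sub_le (by positivity)) x) _
  have hsq : Tendsto (fun n : ℕ =>
      eLpNorm (quot s (fun x => cutoff ((n : ℝ) + 1) x * u x) - quot s u) 2 volume ^ 2)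
      atTop (𝓝 0) := by
    have hAB := (ENNReal.Tendsto.const_mul hA (a := 2) (Or.inr (by simp))).add
      (ENNReal.Tendsto.const_mul hB (a := 2) (Or.inr (by simp)))
    simp only [mul_zero, add_zero] at hAB
    refine tendsto_of_tendsto_of_tendsto_of_le_of_le tendsto_const_nhds hAB
      (fun _ => zero_le) fun n => ?_
    have hqc := measurable_quot (s := s) (measurable_cutoff (N := N) ((n : ℝ) + 1))
    beta_reduce
    rw [eLpNorm_two_sq, ← lintegral_const_mul _ (by fun_prop),
      ← lintegral_const_mul _ (by fun_prop), ← lintegral_add_left (by fun_prop)]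
    refine lintegral_mono fun z => ?_
    rw [show (2 : ℝ≥0∞) = ENNReal.ofReal 2 by simp, ← ENNReal.ofReal_mul (by positivity),
      ← ENNReal.ofReal_mul (by positivity), ← ENNReal.ofReal_add (by positivity) (by positivity)]
    refine ENNReal.ofReal_le_ofReal ?_
    rw [Pi.sub_apply, quot_cutoff_mul]
    nlinarith [sq_nonneg ((cutoff ((n : ℝ) + 1) z.2 - 1) * quot s u z -
      u z.1 * quot s (cutoff ((n : ℝ) + 1)) z)]
  have := ((ENNReal.continuous_rpow_const (y := (1 / 2 : ℝ))).tendsto 0).comp hsq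
  rw [ENNReal.zero_rpow_of_pos (by norm_num)] at this
  refine this.congr fun n => ?_
  simp only [Function.comp_apply]
  rw [← ENNReal.rpow_natCast, ← ENNReal.rpow_mul]
  norm_num

lemma tendsto_integral_quot_cutoff (hu : HardySobolev s u) (hN0 : 0 < N) (hs0 : 0 < s)
    (hs1 : s < 1) {w : 𝔼 → ℝ} (hw : HardySobolev s w) :
    Tendsto (fun n : ℕ => ∫ z, quot s w z * quot s (fun x => cutoff ((n : ℝ) + 1) x * u x) z)
      atTop (𝓝 (∫ z, quot s w z * quot s u z)) :=
  tendsto_integral_mul_of_eLpNorm (p := 2) (q := 2) hw.memLp_quot hu.memLp_quot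
    (fun n => (hu.cutoff_mul hN0 hs0 hs1 (R := (n : ℝ) + 1) (by simp)).memLp_quot)
    (hu.tendsto_eLpNorm_quot_cutoff hN0 hs0 hs1)

/-- The fractional Sobolev inequality, for functions that need not be square integrable. -/
lemma exists_sobolev (hN0 : 0 < N) {s : ℝ} (hs0 : 0 < s) (hs1 : s < 1) {r θ : ℝ} (hθ1 : θ < 1)
    (hθ : (N : ℝ) * θ = 2 * s) (hr : r = 2 / (1 - θ)) :
    ∃ C : ℝ≥0∞, C ≠ ⊤ ∧ ∀ u : 𝔼 → ℝ, HardySobolev s u →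
      (∫⁻ y, ‖u y‖ₑ ^ r) ^ (2 / r) ≤ C * gagliardoEnergy s u := by
  obtain ⟨C, hC, h⟩ := sobolev_of_memLp_two hN0 hs0 hθ1 hθ hr
  have h1θ : 0 < 1 - θ := by linarith
  have hr0 : 0 < r := by rw [hr]; positivity
  refine ⟨C, hC, fun u hu => ?_⟩
  have hm := hu.measurable
  let T : ℕ → 𝔼 → ℝ := fun n x => cutoff ((n : ℝ) + 1) x * u x
  have hpt : ∀ y, Tendsto (fun n => ‖T n y‖ₑ ^ r) atTop (𝓝 (‖u y‖ₑ ^ r)) := fun y => by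
    refine tendsto_const_nhds.congr' ?_
    filter_upwards [eventually_ge_atTop ⌈‖y‖⌉₊] with n hn
    simp only [T]
    rw [cutoff_eq_one (by positivity) ((Nat.ceil_le.1 hn).trans (by linarith)), one_mul]
  have hF : ∫⁻ y, ‖u y‖ₑ ^ r ≤ liminf (fun n => ∫⁻ y, ‖T n y‖ₑ ^ r) atTop := by
    refine le_trans (le_of_eq ?_) (lintegral_liminf_le fun n => by fun_prop)
    exact lintegral_congr fun y => ((hpt y).liminf_eq).symm
  have hbound : ∀ n, ∫⁻ y, ‖T n y‖ₑ ^ r ≤ (C * (eLpNorm (quot s (T n) - quot s u) 2 volume +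
      eLpNorm (quot s u) 2 volume) ^ 2) ^ (r / 2) := fun n => by
    have hTn : HardySobolev s (T n) :=
      hu.cutoff_mul hN0 hs0 hs1 (R := (n : ℝ) + 1) (by simp)
    have h1 := h (T n) hTn.measurable (hu.memLp_two_cutoff_mul hs0 (by positivity))
    have h2 := ENNReal.rpow_le_rpow h1 (by positivity : 0 ≤ r / 2)
    rw [← ENNReal.rpow_mul, show 2 / r * (r / 2) = 1 by field_simp, ENNReal.rpow_one] at h2
    refine h2.trans ?_
    rw [gagliardoEnergy_eq_eLpNorm]
    gcongr
    have := eLpNorm_add_le (p := 2) (hTn.memLp_quot.1.sub hu.memLp_quot.1) hu.memLp_quot.1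
      (by norm_num)
    simpa using this
  have hlim : Tendsto (fun n => (C * (eLpNorm (quot s (T n) - quot s u) 2 volume +
      eLpNorm (quot s u) 2 volume) ^ 2) ^ (r / 2)) atTop
      (𝓝 ((C * gagliardoEnergy s u) ^ (r / 2))) := by
    refine (ENNReal.continuous_rpow_const.tendsto _).comp ?_
    refine ENNReal.Tendsto.const_mul ?_ (Or.inr hC)
    rw [gagliardoEnergy_eq_eLpNorm]
    refine ((ENNReal.continuous_pow 2).tendsto _).comp ?_
    have := (hu.tendsto_eLpNorm_quot_cutoff hN0 hs0 hs1).add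
      (tendsto_const_nhds (x := eLpNorm (quot s u) 2 volume))
    rw [zero_add] at this
    exact this
  have h3 : ∫⁻ y, ‖u y‖ₑ ^ r ≤ (C * gagliardoEnergy s u) ^ (r / 2) :=
    (hF.trans (liminf_le_liminf (.of_forall hbound))).trans_eq hlim.liminf_eq
  have h4 := ENNReal.rpow_le_rpow h3 (by positivity : 0 ≤ 2 / r)
  rwa [← ENNReal.rpow_mul, show r / 2 * (2 / r) = 1 by field_simp, ENNReal.rpow_one] at h4

lemma lintegral_rpow_lt_top (hu : HardySobolev s u) (hN0 : 0 < N) (hs0 : 0 < s) (hs1 : s < 1)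
    {r θ : ℝ} (hθ1 : θ < 1) (hθ : (N : ℝ) * θ = 2 * s) (hr : r = 2 / (1 - θ)) :
    ∫⁻ y, ‖u y‖ₑ ^ r < ⊤ := by
  obtain ⟨C, hC, h⟩ := exists_sobolev hN0 hs0 hs1 hθ1 hθ hr
  have h1θ : 0 < 1 - θ := by linarith
  have hr0 : 0 < r := by rw [hr]; positivity
  have h1 := (h u hu).trans_lt (ENNReal.mul_lt_top hC.lt_top hu.energy_lt_top)
  exact (ENNReal.rpow_lt_top_iff_of_pos (by positivity)).1 h1

end HardySobolev

/-! ### Enlarging the class of test functions -/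

/-- Composition with a continuous family of measure preserving maps is continuous in `L^p`. -/
lemma tendsto_eLpNorm_comp_sub {X T : Type*} [TopologicalSpace X] [R1Space X]
    [MeasurableSpace X] [BorelSpace X] [TopologicalSpace T] {μ : Measure X}
    [IsLocallyFiniteMeasure μ] [μ.InnerRegularCompactLTTop] {p : ℝ≥0∞} (hp1 : 1 ≤ p) (hp : p ≠ ⊤)
    {G : T → X → X} (hG : Continuous (Function.uncurry G)) (hm : ∀ t, MeasurePreserving (G t) μ μ)
    {f : X → ℝ} (hf : MemLp f p μ) (t₀ : T) :
    Tendsto (fun t => eLpNorm ((fun x => f (G t x)) - fun x => f (G t₀ x)) p μ) (𝓝 t₀) (𝓝 0) := by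
  have : Fact (1 ≤ p) := ⟨hp1⟩
  let g : C(T, C(X, X)) := (ContinuousMap.mk (Function.uncurry G) hG).curry
  have h := (continuous_const (y := hf.toLp f)).compMeasurePreservingLp g.continuous
    (fun t => hm t) hp
  have h1 : Tendsto (fun t => Lp.compMeasurePreserving (G t) (hm t) (hf.toLp f)) (𝓝 t₀)
      (𝓝 (Lp.compMeasurePreserving (G t₀) (hm t₀) (hf.toLp f))) := h.tendsto t₀
  simp only [Lp.toLp_compMeasurePreserving] at h1
  exact (Lp.tendsto_Lp_iff_tendsto_eLpNorm'' _ (fun t => hf.comp_measurePreserving (hm t)) _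
    (hf.comp_measurePreserving (hm t₀))).1 h1

lemma continuous_integral_mul_comp {X T : Type*} [TopologicalSpace X] [R1Space X]
    [MeasurableSpace X] [BorelSpace X] [TopologicalSpace T] {μ : Measure X}
    [IsLocallyFiniteMeasure μ] [μ.InnerRegularCompactLTTop] {p q : ℝ≥0∞}
    [ENNReal.HolderTriple p q 1] (hq1 : 1 ≤ q) (hq : q ≠ ⊤)
    {G : T → X → X} (hG : Continuous (Function.uncurry G)) (hm : ∀ t, MeasurePreserving (G t) μ μ)
    {f h : X → ℝ} (hf : MemLp f p μ) (hh : MemLp h q μ) :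
    Continuous fun t => ∫ x, f x * h (G t x) ∂μ := by
  rw [continuous_iff_continuousAt]
  intro t₀
  exact tendsto_integral_mul_of_eLpNorm hf (hh.comp_measurePreserving (hm t₀))
    (fun t => hh.comp_measurePreserving (hm t)) (tendsto_eLpNorm_comp_sub hq1 hq hG hm hh t₀)

/-- Averaging over a family of measure preserving maps commutes with an `L^p`-`L^q` pairing. -/
lemma integral_mul_integral_comp {X T : Type*} [MeasurableSpace X] [MeasurableSpace T]
    {μ : Measure X} {ν : Measure T} [SFinite μ] [SFinite ν] {p q : ℝ≥0∞}
    [ENNReal.HolderTriple p q 1]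
    {G : T → X → X} (hG : Measurable (Function.uncurry G)) (hm : ∀ t, MeasurePreserving (G t) μ μ)
    {f h : X → ℝ} {η : T → ℝ} (hfm : Measurable f) (hhm : Measurable h) (hηm : Measurable η)
    (hf : MemLp f p μ) (hh : MemLp h q μ) (hη : Integrable η ν) :
    ∫ x, f x * ∫ t, η t * h (G t x) ∂ν ∂μ = ∫ t, η t * ∫ x, f x * h (G t x) ∂μ ∂ν := by
  have : ENNReal.HolderTriple q p 1 := ENNReal.HolderTriple.symm
  simp only [← integral_const_mul]
  rw [← integral_integral_swap]
  · refine integral_congr_ae (.of_forall fun t => integral_congr_ae (.of_forall fun x => ?_))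
    beta_reduce
    ring
  · have hmeas : Measurable fun z : T × X => f z.2 * (η z.1 * h (G z.1 z.2)) := by
      have : Measurable fun z : T × X => h (G z.1 z.2) := hhm.comp hG
      fun_prop
    have hint : ∀ t, Integrable (fun x => f x * (η t * h (G t x))) μ := fun t => by
      have h1 : Integrable (fun x => f x * h (G t x)) μ :=
        memLp_one_iff_integrable.1 ((hh.comp_measurePreserving (hm t)).mul hf)
      refine (h1.const_mul (η t)).congr (.of_forall fun x => ?_)
      beta_reduce; ring
    refine (integrable_prod_iff hmeas.aestronglyMeasurable).2 ⟨.of_forall fun t => hint t, ?_⟩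
    refine (hη.norm.mul_const (eLpNorm f p μ * eLpNorm h q μ).toReal).mono'
      hmeas.aestronglyMeasurable.norm.integral_prod_right' (.of_forall fun t => ?_)
    rw [Real.norm_of_nonneg (integral_nonneg fun x => norm_nonneg _)]
    have e : ∀ x, ‖Function.uncurry (fun t x => f x * (η t * h (G t x))) (t, x)‖ =
        ‖η t‖ * ‖f x * h (G t x)‖ := fun x => by
      simp only [Function.uncurry, norm_mul]; ring
    change ∫ x, ‖f x * (η t * h (G t x))‖ ∂μ ≤ _
    simp only [Function.uncurry] at e
    simp only [e]
    rw [integral_const_mul]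
    refine mul_le_mul_of_nonneg_left ?_ (norm_nonneg _)
    have h1 : MemLp (fun x => h (G t x)) q μ := hh.comp_measurePreserving (hm t)
    rw [integral_norm_eq_lintegral_enorm
      (h1.1.mul hf.1 |>.congr (.of_forall fun x => mul_comm _ _))]
    refine ENNReal.toReal_mono (ENNReal.mul_ne_top hf.2.ne hh.2.ne) ?_
    rw [← eLpNorm_one_eq_lintegral_enorm]
    have h2 := eLpNorm_smul_le_mul_eLpNorm (p := p) (q := q) (r := 1) h1.1 hf.1
    have h3 : eLpNorm (fun x => h (G t x)) q μ = eLpNorm h q μ :=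
      eLpNorm_comp_measurePreserving hh.1 (hm t)
    rw [h3] at h2
    exact h2

lemma quot_comp_sub (s : ℝ) (φ : 𝔼 → ℝ) (t : 𝔼) (z : 𝔼 × 𝔼) :
    quot s φ (z - (t, t)) = (φ (z.1 - t) - φ (z.2 - t)) * √(kern s z.1 z.2) := by
  simp [quot, kern]

/-- A weak equation that holds for smooth test functions of compact support also holds for
compactly supported test functions of finite energy: the pairing with the translate of the
test function by `t` depends continuously on `t`, and its averages against smooth bumps vanish. -/
lemma weak_eq_of_hasCompactSupport {s ρ : ℝ} {p q : ℝ≥0∞} [ENNReal.HolderTriple p q 1]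
    (hq1 : 1 ≤ q) (hq : q ≠ ⊤) {v g φ : 𝔼 → ℝ} (hv : HardySobolev s v) (hgm : Measurable g)
    (hg : ∀ R : ℝ, MemLp ((Metric.ball 0 R).indicator g) p volume)
    (hweak : ∀ ψ : 𝔼 → ℝ, ContDiff ℝ (⊤ : ℕ∞) ψ → HasCompactSupport ψ →
      ∫ z, quot s v z * quot s ψ z = ∫ x, g x * ψ x)
    (hφm : Measurable φ) (hφE : MemLp (quot s φ) 2 volume) (hφq : MemLp φ q volume)
    (hφ0 : ∀ x, ρ ≤ ‖x‖ → φ x = 0) :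
    ∫ z, quot s v z * quot s φ z = ∫ x, g x * φ x := by
  set g' : 𝔼 → ℝ := (Metric.ball 0 (ρ + 1)).indicator g with hg'
  have hg'm : Measurable g' := hgm.indicator measurableSet_ball
  have hvm := hv.measurable
  have hGE : Continuous (Function.uncurry fun (t : 𝔼) (x : 𝔼) => x - t) := by
    unfold Function.uncurry; fun_prop
  have hGP : Continuous (Function.uncurry fun (t : 𝔼) (z : 𝔼 × 𝔼) => z - (t, t)) := by
    unfold Function.uncurry; fun_prop
  have hmE : ∀ t : 𝔼, MeasurePreserving (fun x : 𝔼 => x - t) volume volume :=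
    fun t => measurePreserving_sub_right volume t
  have hmP : ∀ t : 𝔼, MeasurePreserving (fun z : 𝔼 × 𝔼 => z - (t, t)) volume volume :=
    fun t => (hmE t).prod (hmE t)
  have hφint : Integrable φ volume := by
    refine memLp_one_iff_integrable.1
      (hφq.mono_exponent_of_measure_support_ne_top (s := Metric.ball 0 ρ) (fun x hx => hφ0 x ?_)
        measure_ball_lt_top.ne hq1)
    simpa using hx
  -- the defect of the equation for the translate of `φ` by `t`
  let F : 𝔼 → ℝ := fun t => (∫ z, quot s v z * quot s φ (z - (t, t))) - ∫ x, g' x * φ (x - t)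
  have hFc : Continuous F := by
    refine Continuous.sub ?_ ?_
    · exact continuous_integral_mul_comp (p := 2) (q := 2) (by norm_num) (by norm_num) hGP hmP
        hv.memLp_quot hφE
    · exact continuous_integral_mul_comp hq1 hq hGE hmE (hg _) hφq
  have hF0 : ∀ η : 𝔼 → ℝ, ContDiff ℝ (⊤ : ℕ∞) η → HasCompactSupport η →
      tsupport η ⊆ Metric.ball 0 1 → ∫ t, η t • F t = 0 := by
    intro η hη hηc hηs
    have hηm : Measurable η := hη.continuous.measurable
    have hηi : Integrable η volume := hη.continuous.integrable_of_hasCompactSupport hηc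
    have hex : ∀ x : 𝔼, Integrable (fun t => η t * φ (x - t)) volume := fun x =>
      hηc.convolutionExists_left (ContinuousLinearMap.mul ℝ ℝ) hη.continuous
        hφint.locallyIntegrable x
    -- the average of the translates is a mollification of `φ`, an admissible test function
    let ψ : 𝔼 → ℝ := fun x => ∫ t, η t * φ (x - t)
    have hψeq : ψ = convolution η φ (ContinuousLinearMap.mul ℝ ℝ) volume := by
      ext x; simp [ψ, convolution_def]
    have hψ0 : ∀ x : 𝔼, ρ + 1 ≤ ‖x‖ → ψ x = 0 := by
      intro x hx
      refine integral_eq_zero_of_ae (.of_forall fun t => ?_)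
      by_cases ht : t ∈ tsupport η
      · have ht1 : ‖t‖ < 1 := by simpa using hηs ht
        have : ρ ≤ ‖x - t‖ := by linarith [norm_sub_norm_le x t]
        simp [hφ0 _ this]
      · simp [image_eq_zero_of_notMem_tsupport ht]
    have hψs : ContDiff ℝ (⊤ : ℕ∞) ψ := by
      rw [hψeq]
      exact hηc.contDiff_convolution_left _ hη hφint.locallyIntegrable
    have hψc : HasCompactSupport ψ := by
      refine HasCompactSupport.of_support_subset_isCompact (isCompact_closedBall (0 : 𝔼) (ρ + 1))
        fun x hx => ?_
      by_contra h
      refine hx (hψ0 x ?_)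
      rw [mem_closedBall_zero_iff, not_le] at h
      exact h.le
    have hquot : ∀ z, quot s ψ z = ∫ t, η t * quot s φ (z - (t, t)) := fun z => by
      simp only [quot_comp_sub]
      rw [quot, ← integral_sub (hex z.1) (hex z.2), ← integral_mul_const]
      refine integral_congr_ae (.of_forall fun t => ?_)
      beta_reduce; ring
    have h1 := hweak ψ hψs hψc
    have h2 : ∫ x, g x * ψ x = ∫ x, g' x * ψ x := by
      refine integral_congr_ae (.of_forall fun x => ?_)
      beta_reduce
      by_cases hx : x ∈ Metric.ball (0 : 𝔼) (ρ + 1)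
      · rw [hg', Set.indicator_of_mem hx]
      · rw [hψ0 x (by simpa using hx)]; simp
    rw [h2] at h1
    simp only [hquot] at h1
    rw [integral_mul_integral_comp (p := 2) (q := 2) hGP.measurable hmP (measurable_quot hvm)
      (measurable_quot hφm) hηm hv.memLp_quot hφE hηi,
      integral_mul_integral_comp (G := fun t x => x - t) hGE.measurable hmE hg'm hφm hηm (hg _)
        hφq hηi] at h1
    have hc1 : Continuous fun t : 𝔼 => ∫ z, quot s v z * quot s φ (z - (t, t)) :=
      continuous_integral_mul_comp (p := 2) (q := 2) (by norm_num) (by norm_num) hGP hmP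
        hv.memLp_quot hφE
    have hc2 : Continuous fun t : 𝔼 => ∫ x, g' x * φ (x - t) :=
      continuous_integral_mul_comp hq1 hq hGE hmE (hg _) hφq
    simp only [F, smul_eq_mul, mul_sub]
    rw [integral_sub, h1, sub_self]
    · exact (hη.continuous.mul hc1).integrable_of_hasCompactSupport hηc.mul_right
    · exact (hη.continuous.mul hc2).integrable_of_hasCompactSupport hηc.mul_right
  have hae := Metric.isOpen_ball.ae_eq_zero_of_integral_contDiff_smul_eq_zero
    (hFc.locallyIntegrable.locallyIntegrableOn (Metric.ball (0 : 𝔼) 1)) hF0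
  have hzero : F 0 = 0 := by
    have h1 : F =ᵐ[volume.restrict (Metric.ball (0 : 𝔼) 1)] fun _ => 0 :=
      (ae_restrict_iff' measurableSet_ball).2 hae
    exact Measure.eqOn_open_of_ae_eq h1 Metric.isOpen_ball hFc.continuousOn
      continuousOn_const (Metric.mem_ball_self one_pos)
  simp only [F, sub_zero, show ((0 : 𝔼), (0 : 𝔼)) = 0 from rfl] at hzero
  rw [sub_eq_zero.1 hzero]
  refine integral_congr_ae (.of_forall fun x => ?_)
  beta_reduce
  by_cases hx : x ∈ Metric.ball (0 : 𝔼) (ρ + 1)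
  · rw [hg', Set.indicator_of_mem hx]
  · have hx' : ρ + 1 ≤ ‖x‖ := by simpa using hx
    rw [hφ0 x (by linarith)]; simp

/-! ### The weighted space of the theorem -/

/-- Finite Gagliardo energy implies local square integrability: for almost every `y` the localized
energy at `y` is finite, and one such `y` serves as a reference point. -/
lemma setLIntegral_ball_sq_lt_top (hN : 0 < N) {s : ℝ} (hs : 0 < s) {u : 𝔼 → ℝ}
    (hu : Measurable u) (hE : gagliardoEnergy s u < ⊤) (R : ℝ) :
    ∫⁻ x in Metric.ball 0 R, ENNReal.ofReal (u x ^ 2) < ⊤ := by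
  have hk := measurable_kern (N := N) s
  have h1 : ∫⁻ y, ∫⁻ x, ENNReal.ofReal ((u y - u x) ^ 2 * kern s y x) < ⊤ := by
    refine lt_of_le_of_lt (le_of_eq ?_) hE
    rw [gagliardoEnergy_eq]
    simp only [quot_sq]
    rw [Measure.volume_eq_prod, lintegral_prod _ (by fun_prop)]
  have h2 := ae_lt_top (Measurable.lintegral_prod_right' (f := fun z : 𝔼 × 𝔼 =>
    ENNReal.ofReal ((u z.1 - u z.2) ^ 2 * kern s z.1 z.2)) (by fun_prop)) h1.ne
  have : Nonempty (Fin N) := ⟨⟨0, hN⟩⟩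
  obtain ⟨y, hy⟩ := h2.exists
  have hym : Measurable fun x => ENNReal.ofReal ((u y - u x) ^ 2 * kern s y x) := by
    unfold kern; fun_prop
  set D : ℝ := ‖y‖ + max R 0 with hD
  have hD0 : 0 ≤ D := by positivity
  calc ∫⁻ x in Metric.ball 0 R, ENNReal.ofReal (u x ^ 2)
      ≤ ∫⁻ x in Metric.ball 0 R, (ENNReal.ofReal (2 * D ^ ((N : ℝ) + 2 * s)) *
          ENNReal.ofReal ((u y - u x) ^ 2 * kern s y x) + ENNReal.ofReal (2 * u y ^ 2)) := by
        refine setLIntegral_mono' measurableSet_ball fun x hx => ?_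
        rw [mem_ball_zero_iff] at hx
        rw [← ENNReal.ofReal_mul (by positivity),
          ← ENNReal.ofReal_add (mul_nonneg (by positivity)
            (mul_nonneg (sq_nonneg _) (kern_nonneg _ _ _))) (by positivity)]
        refine ENNReal.ofReal_le_ofReal ?_
        have h3 : (u y - u x) ^ 2 ≤ D ^ ((N : ℝ) + 2 * s) * ((u y - u x) ^ 2 * kern s y x) := by
          rcases eq_or_ne y x with rfl | hxy
          · simp
          have hp : 0 < ‖y - x‖ := norm_pos_iff.2 (sub_ne_zero.2 hxy)
          have hle : ‖y - x‖ ≤ D := by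
            have := norm_sub_le y x
            have := le_max_left R 0
            linarith
          have h4 : 1 ≤ D ^ ((N : ℝ) + 2 * s) * kern s y x := by
            unfold kern
            rw [← div_eq_mul_inv, one_le_div (by positivity)]
            exact Real.rpow_le_rpow hp.le hle (by positivity)
          nlinarith [mul_le_mul_of_nonneg_left h4 (sq_nonneg (u y - u x))]
        nlinarith [sq_nonneg (2 * u y - u x)]
    _ < ⊤ := by
        rw [lintegral_add_left (by fun_prop), lintegral_const_mul _ hym, setLIntegral_const]
        refine ENNReal.add_lt_top.2 ⟨ENNReal.mul_lt_top ENNReal.ofReal_lt_top ?_,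
          ENNReal.mul_lt_top ENNReal.ofReal_lt_top measure_ball_lt_top⟩
        exact (setLIntegral_le_lintegral _ _).trans_lt hy

/-- The decay assumption on the potential embeds the weighted space in the homogeneous one with
Hardy weight: far away `V` dominates the weight, and on balls finite energy is enough. -/
lemma hardySobolev_of_memWeightedSobolev (hN : 0 < N) {s ε : ℝ} (hs : 0 < s) (hε : 0 < ε)
    {V v : 𝔼 → ℝ} (hVm : Measurable V) (hV0 : ∀ x, 0 ≤ V x)
    (hVdecay : 0 < liminf (fun x => ENNReal.ofReal (V x * ‖x‖ ^ (2 * s))) (cocompact 𝔼))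
    (hvm : Measurable v) (hv : weightedNormSq s ε V v < ⊤) : HardySobolev s v := by
  have hE : gagliardoEnergy s v < ⊤ := by
    have h1 := (ENNReal.add_lt_top.1 hv).1
    refine lt_top_iff_ne_top.2 fun h => ?_
    rw [h, ENNReal.mul_top] at h1
    · exact lt_irrefl _ h1
    · simp only [ne_eq, ENNReal.ofReal_eq_zero, not_le]; positivity
  have hVv := (ENNReal.add_lt_top.1 hv).2
  refine ⟨hvm, (memLp_quot_iff hvm).2 hE, ?_⟩
  obtain ⟨b, hb0, hb⟩ := exists_between hVdecay
  have hev := eventually_lt_of_lt_liminf hb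
  have hbT : b ≠ ⊤ := (hb.trans_le le_top).ne
  obtain ⟨K, hK, hKV⟩ := mem_cocompact.1 hev
  obtain ⟨R, hR⟩ := hK.isBounded.subset_ball (0 : 𝔼)
  set a := b.toReal with ha
  have ha0 : 0 < a := ENNReal.toReal_pos hb0.ne' hbT
  set R' := max R 1 with hR'
  rw [← lintegral_add_compl _ (measurableSet_ball (x := (0 : 𝔼)) (ε := R'))]
  refine ENNReal.add_lt_top.2 ⟨?_, ?_⟩
  · refine lt_of_le_of_lt (setLIntegral_mono' measurableSet_ball fun x _ =>
      ENNReal.ofReal_le_ofReal ?_) (setLIntegral_ball_sq_lt_top hN hs hvm hE R')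
    refine mul_le_of_le_one_right (sq_nonneg _) ?_
    exact Real.rpow_le_one_of_one_le_of_nonpos (by linarith [norm_nonneg x]) (by linarith)
  · refine lt_of_le_of_lt (setLIntegral_mono' measurableSet_ball.compl
      (g := fun x => ENNReal.ofReal a⁻¹ * ENNReal.ofReal (V x * v x ^ 2)) fun x hx => ?_) ?_
    · rw [← ENNReal.ofReal_mul (by positivity)]
      refine ENNReal.ofReal_le_ofReal ?_
      have hx' : R' ≤ ‖x‖ := by simpa using hx
      have hx1 : 0 < ‖x‖ := by linarith [le_max_right R 1]
      have hxK : x ∈ Kᶜ := fun h => by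
        have := hR h
        rw [mem_ball_zero_iff] at this
        linarith [le_max_left R 1]
      have h1 : b < ENNReal.ofReal (V x * ‖x‖ ^ (2 * s)) := hKV hxK
      have h2 : a ≤ V x * ‖x‖ ^ (2 * s) :=
        ENNReal.toReal_le_of_le_ofReal (mul_nonneg (hV0 x) (by positivity)) h1.le
      have h3 : (1 + ‖x‖) ^ (-(2 * s)) ≤ ‖x‖ ^ (-(2 * s)) :=
        Real.rpow_le_rpow_of_nonpos hx1 (by linarith) (by linarith)
      have h4 : ‖x‖ ^ (-(2 * s)) ≤ a⁻¹ * V x := by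
        rw [Real.rpow_neg hx1.le, inv_eq_one_div, inv_mul_eq_div,
          div_le_div_iff₀ (by positivity) ha0]
        linarith
      calc v x ^ 2 * (1 + ‖x‖) ^ (-(2 * s)) ≤ v x ^ 2 * (a⁻¹ * V x) :=
            mul_le_mul_of_nonneg_left (h3.trans h4) (sq_nonneg _)
        _ = _ := by ring
    · rw [lintegral_const_mul _ (by fun_prop)]
      exact ENNReal.mul_lt_top ENNReal.ofReal_lt_top
        ((setLIntegral_le_lintegral _ _).trans_lt hVv)

/-! ### The nonlinearity -/

/-- The right-hand side `χ_H v^{p-1} - lam v` of the equation, solved for `(-Δ)^s v`. -/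
noncomputable def rhs (lam p : ℝ) (H : Set 𝔼) (v : 𝔼 → ℝ) (x : 𝔼) : ℝ :=
  H.indicator (fun x => v x ^ (p - 1)) x - lam * v x

lemma measurable_rhs {lam p : ℝ} {H : Set 𝔼} {v : 𝔼 → ℝ} (hH : MeasurableSet H)
    (hv : Measurable v) : Measurable (rhs lam p H v) := by
  unfold rhs
  exact ((hv.pow_const _).indicator hH).sub (hv.const_mul _)

lemma memLp_of_lintegral_rpow {α : Type*} [MeasurableSpace α] {μ : Measure α} {f : α → ℝ} {r : ℝ}
    (hr : 0 < r) (hf : AEStronglyMeasurable f μ) (h : ∫⁻ x, ‖f x‖ₑ ^ r ∂μ < ⊤) :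
    MemLp f (ENNReal.ofReal r) μ := by
  refine ⟨hf, ?_⟩
  rw [eLpNorm_lt_top_iff_lintegral_rpow_enorm_lt_top (by simpa) ENNReal.ofReal_ne_top,
    ENNReal.toReal_ofReal hr.le]
  exact h

/-- Critical growth places the right-hand side locally in the dual of the critical space. -/
lemma memLp_indicator_rhs {lam p r : ℝ} (hlam : 0 ≤ lam) (hp : 1 ≤ p) (hpr : p ≤ r) (hr : 2 ≤ r)
    {H : Set 𝔼} {v : 𝔼 → ℝ} (hH : MeasurableSet H) (hvm : Measurable v) (hv0 : ∀ x, 0 ≤ v x)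
    (hv : MemLp v (ENNReal.ofReal r) volume) (R : ℝ) :
    MemLp ((Metric.ball 0 R).indicator (rhs lam p H v)) (ENNReal.ofReal (r / (r - 1))) volume := by
  have h1 : MemLp (fun x => ‖v x‖ ^ (r - 1)) (ENNReal.ofReal (r / (r - 1))) volume := by
    have := hv.norm_rpow_div (ENNReal.ofReal (r - 1))
    rwa [ENNReal.toReal_ofReal (by linarith), ← ENNReal.ofReal_div_of_pos (by linarith)] at this
  have h2 : MemLp ((Metric.ball (0 : 𝔼) R).indicator fun _ => (1 : ℝ))
      (ENNReal.ofReal (r / (r - 1))) volume :=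
    memLp_indicator_const _ measurableSet_ball _ (Or.inr measure_ball_lt_top.ne)
  refine ((h2.add h1).const_mul (1 + lam)).mono'
    ((measurable_rhs hH hvm).indicator measurableSet_ball).aestronglyMeasurable
    (.of_forall fun x => ?_)
  simp only [Pi.add_apply]
  by_cases hx : x ∈ Metric.ball (0 : 𝔼) R
  · rw [Set.indicator_of_mem hx, Set.indicator_of_mem hx, Real.norm_of_nonneg (hv0 x)]
    have hgrow : ∀ q : ℝ, 0 ≤ q → q ≤ r - 1 → v x ^ q ≤ 1 + v x ^ (r - 1) := fun q hq0 hq => by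
      rcases le_total (v x) 1 with h | h
      · have := Real.rpow_le_one (hv0 x) h hq0
        have := Real.rpow_nonneg (hv0 x) (r - 1)
        linarith
      · have := Real.rpow_le_rpow_of_exponent_le h hq
        linarith
    have g1 := hgrow (p - 1) (by linarith) (by linarith)
    have g2 := hgrow 1 (by linarith) (by linarith)
    rw [Real.rpow_one] at g2
    have g3 : |H.indicator (fun x => v x ^ (p - 1)) x| ≤ v x ^ (p - 1) := by
      have hnn := Real.rpow_nonneg (hv0 x) (p - 1)
      by_cases hxH : x ∈ H
      · rw [Set.indicator_of_mem hxH, abs_of_nonneg hnn]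
      · rw [Set.indicator_of_notMem hxH, abs_zero]; exact hnn
    unfold rhs
    rw [Real.norm_eq_abs]
    refine (abs_sub _ _).trans ?_
    rw [abs_mul, abs_of_nonneg hlam, abs_of_nonneg (hv0 x)]
    nlinarith
  · rw [Set.indicator_of_notMem hx, Set.indicator_of_notMem hx, norm_zero]
    positivity

/-! ### Reflections and symmetrization -/

/-- The reflection in the hyperplane `⟪e, x⟫ = μ`, for a unit vector `e`. -/
noncomputable def refl (e : 𝔼) (μ : ℝ) (x : 𝔼) : 𝔼 := x - (2 * (⟪e, x⟫ - μ)) • e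

lemma inner_refl {e : 𝔼} (he : ‖e‖ = 1) (μ : ℝ) (x : 𝔼) : ⟪e, refl e μ x⟫ = 2 * μ - ⟪e, x⟫ := by
  simp only [refl, inner_sub_right, inner_smul_right, real_inner_self_eq_norm_sq, he]
  ring

lemma refl_refl {e : 𝔼} (he : ‖e‖ = 1) (μ : ℝ) (x : 𝔼) : refl e μ (refl e μ x) = x := by
  have h := inner_refl he μ x
  rw [refl, h]
  simp only [refl]
  rw [sub_sub, ← add_smul]
  ring_nf
  simp

lemma norm_refl_sub_refl {e : 𝔼} (he : ‖e‖ = 1) (μ : ℝ) (x y : 𝔼) :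
    ‖refl e μ x - refl e μ y‖ = ‖x - y‖ := by
  have h : refl e μ x - refl e μ y = (x - y) - (2 * ⟪e, x - y⟫) • e := by
    simp only [refl, inner_sub_right]
    module
  rw [h, ← sq_eq_sq₀ (norm_nonneg _) (norm_nonneg _), norm_sub_sq_real, norm_smul, he,
    inner_smul_right, real_inner_comm, Real.norm_eq_abs, mul_one, sq_abs]
  ring

lemma norm_le_norm_refl_add {e : 𝔼} (he : ‖e‖ = 1) (μ : ℝ) (x : 𝔼) :
    ‖x‖ ≤ ‖refl e μ x‖ + 2 * |μ| := by
  have h4 : ‖refl e μ x - refl e μ 0‖ = ‖x‖ := by rw [norm_refl_sub_refl he, sub_zero]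
  have h5 : ‖refl e μ 0‖ = 2 * |μ| := by
    simp [refl, norm_smul, he]
  have h6 := norm_sub_le (refl e μ x) (refl e μ 0)
  linarith

lemma norm_sub_refl_sq {e : 𝔼} (he : ‖e‖ = 1) (μ : ℝ) (x y : 𝔼) :
    ‖x - refl e μ y‖ ^ 2 = ‖x - y‖ ^ 2 + 4 * (μ - ⟪e, x⟫) * (μ - ⟪e, y⟫) := by
  have h : x - refl e μ y = (x - y) + (2 * (⟪e, y⟫ - μ)) • e := by
    simp only [refl]
    module
  rw [h, norm_add_sq_real, norm_smul, he, inner_smul_right, real_inner_comm e (x - y),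
    Real.norm_eq_abs, mul_one, sq_abs, inner_sub_right]
  ring

lemma kern_refl_refl {e : 𝔼} (he : ‖e‖ = 1) (μ : ℝ) (s : ℝ) (x y : 𝔼) :
    kern s (refl e μ x) (refl e μ y) = kern s x y := by
  unfold kern; rw [norm_refl_sub_refl he]

lemma kern_refl_left {e : 𝔼} (he : ‖e‖ = 1) (μ : ℝ) (s : ℝ) (x y : 𝔼) :
    kern s (refl e μ x) y = kern s x (refl e μ y) := by
  rw [← kern_refl_refl he μ s x, refl_refl he]

/-- Points on the same side of the hyperplane interact more strongly than a point and the mirror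
image of the other. -/
lemma kern_refl_le {e : 𝔼} (he : ‖e‖ = 1) (μ : ℝ) {s : ℝ} (hs : 0 < s) {x y : 𝔼}
    (hx : ⟪e, x⟫ ≤ μ) (hy : ⟪e, y⟫ ≤ μ) (hxy : x ≠ y) : kern s x (refl e μ y) ≤ kern s x y := by
  have h0 : 0 < ‖x - y‖ := norm_pos_iff.2 (sub_ne_zero.2 hxy)
  have h1 : ‖x - y‖ ≤ ‖x - refl e μ y‖ := by
    rw [← sq_le_sq₀ (norm_nonneg _) (norm_nonneg _), norm_sub_refl_sq he]
    nlinarith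
  unfold kern
  gcongr

lemma measurePreserving_refl {e : 𝔼} (he : ‖e‖ = 1) (μ : ℝ) :
    MeasurePreserving (refl e μ) volume volume := by
  have h1 := ((ℝ ∙ e).reflection.trans (LinearIsometryEquiv.neg ℝ)).measurePreserving
  have h2 := (measurePreserving_add_right (volume : Measure 𝔼) ((2 * μ) • e)).comp h1
  convert! h2 using 1
  ext1 x
  simp only [refl, Function.comp_apply, LinearIsometryEquiv.coe_trans,
    LinearIsometryEquiv.coe_neg, Submodule.reflection_singleton_apply, he]
  simp
  module

lemma continuous_refl (e : 𝔼) :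
    Continuous (Function.uncurry fun (μ : ℝ) (x : 𝔼) => refl e μ x) := by
  unfold Function.uncurry refl; fun_prop

lemma refl_eq_self {e : 𝔼} {μ : ℝ} {x : 𝔼} (hx : ⟪e, x⟫ = μ) : refl e μ x = x := by
  simp [refl, hx]

/-- The sum of a function of two points over the four pairs obtained by reflecting either of
them. It allows integrals over `ℝ^N × ℝ^N` to be compared pointwise on one side of the
hyperplane. -/
noncomputable def symm4 (e : 𝔼) (μ : ℝ) (F : 𝔼 × 𝔼 → ℝ) (z : 𝔼 × 𝔼) : ℝ :=
  F z + F (z.1, refl e μ z.2) + F (refl e μ z.1, z.2) + F (refl e μ z.1, refl e μ z.2)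

lemma measurePreserving_refl_snd {e : 𝔼} (he : ‖e‖ = 1) (μ : ℝ) :
    MeasurePreserving (fun z : 𝔼 × 𝔼 => (z.1, refl e μ z.2)) volume volume :=
  (MeasurePreserving.id _).prod (measurePreserving_refl he μ)

lemma measurePreserving_refl_fst {e : 𝔼} (he : ‖e‖ = 1) (μ : ℝ) :
    MeasurePreserving (fun z : 𝔼 × 𝔼 => (refl e μ z.1, z.2)) volume volume :=
  (measurePreserving_refl he μ).prod (MeasurePreserving.id _)

lemma measurePreserving_refl_prod {e : 𝔼} (he : ‖e‖ = 1) (μ : ℝ) :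
    MeasurePreserving (fun z : 𝔼 × 𝔼 => (refl e μ z.1, refl e μ z.2)) volume volume :=
  (measurePreserving_refl he μ).prod (measurePreserving_refl he μ)

lemma measurable_refl (e : 𝔼) (μ : ℝ) : Measurable (refl e μ) := by
  unfold refl; fun_prop

lemma measurable_symm4 (e : 𝔼) (μ : ℝ) {F : 𝔼 × 𝔼 → ℝ} (hF : Measurable F) :
    Measurable (symm4 e μ F) := by
  have h := measurable_refl e μ
  unfold symm4
  fun_prop

lemma integral_comp_measurePreserving {α : Type*} [MeasurableSpace α] {μ : Measure α}
    {T : α → α} (hT : MeasurePreserving T μ μ) {F : α → ℝ} (hF : AEStronglyMeasurable F μ) :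
    ∫ x, F (T x) ∂μ = ∫ x, F x ∂μ := by
  have h := integral_map hT.measurable.aemeasurable (f := F) (by rwa [hT.map_eq])
  rw [hT.map_eq] at h
  exact h.symm

lemma integrable_symm4 {e : 𝔼} (he : ‖e‖ = 1) (μ : ℝ) {F : 𝔼 × 𝔼 → ℝ} (hF : Integrable F) :
    Integrable (symm4 e μ F) :=
  ((hF.add ((measurePreserving_refl_snd he μ).integrable_comp_of_integrable hF)).add
    ((measurePreserving_refl_fst he μ).integrable_comp_of_integrable hF)).add
    ((measurePreserving_refl_prod he μ).integrable_comp_of_integrable hF)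

lemma integral_symm4 {e : 𝔼} (he : ‖e‖ = 1) (μ : ℝ) {F : 𝔼 × 𝔼 → ℝ} (hF : Integrable F) :
    ∫ z, symm4 e μ F z = 4 * ∫ z, F z := by
  have h1 := (measurePreserving_refl_snd he μ).integrable_comp_of_integrable hF
  have h2 := (measurePreserving_refl_fst he μ).integrable_comp_of_integrable hF
  have h3 := (measurePreserving_refl_prod he μ).integrable_comp_of_integrable hF
  have i1 := integral_comp_measurePreserving (measurePreserving_refl_snd he μ) hF.1
  have i2 := integral_comp_measurePreserving (measurePreserving_refl_fst he μ) hF.1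
  have i3 := integral_comp_measurePreserving (measurePreserving_refl_prod he μ) hF.1
  simp only [Function.comp_def] at h1 h2 h3
  unfold symm4
  have hA : Integrable fun z : 𝔼 × 𝔼 => F z + F (z.1, refl e μ z.2) := hF.add h1
  have hB : Integrable fun z : 𝔼 × 𝔼 => F z + F (z.1, refl e μ z.2) + F (refl e μ z.1, z.2) :=
    hA.add h2
  rw [integral_add hB h3, integral_add hA h2, integral_add hF h1, i1, i2, i3]
  ring

lemma lintegral_symm4 {e : 𝔼} (he : ‖e‖ = 1) (μ : ℝ) {F : 𝔼 × 𝔼 → ℝ} (hF : Measurable F)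
    (h0 : ∀ z, 0 ≤ F z) :
    ∫⁻ z, ENNReal.ofReal (symm4 e μ F z) = 4 * ∫⁻ z, ENNReal.ofReal (F z) := by
  have h := measurable_refl e μ
  have i1 := (measurePreserving_refl_snd he μ).lintegral_comp hF.ennreal_ofReal
  have i2 := (measurePreserving_refl_fst he μ).lintegral_comp hF.ennreal_ofReal
  have i3 := (measurePreserving_refl_prod he μ).lintegral_comp hF.ennreal_ofReal
  have e1 : ∀ z, ENNReal.ofReal (symm4 e μ F z) = ENNReal.ofReal (F z) +
      ENNReal.ofReal (F (z.1, refl e μ z.2)) + ENNReal.ofReal (F (refl e μ z.1, z.2)) +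
      ENNReal.ofReal (F (refl e μ z.1, refl e μ z.2)) := fun z => by
    unfold symm4
    rw [ENNReal.ofReal_add (add_nonneg (add_nonneg (h0 _) (h0 _)) (h0 _)) (h0 _),
      ENNReal.ofReal_add (add_nonneg (h0 _) (h0 _)) (h0 _), ENNReal.ofReal_add (h0 _) (h0 _)]
  simp only [e1]
  rw [lintegral_add_left (by fun_prop), lintegral_add_left (by fun_prop),
    lintegral_add_left (by fun_prop), i1, i2, i3]
  ring

/-- A property of the symmetrization has to be checked on one side of the hyperplane only. The
predicate `A` restricts attention to a set of points that is invariant under the reflection. -/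
lemma forall_symm4 {e : 𝔼} (he : ‖e‖ = 1) (μ : ℝ) {ι : Type*} {F : ι → 𝔼 × 𝔼 → ℝ}
    {P : (ι → ℝ) → Prop} {A : 𝔼 → Prop} (hA : ∀ x, A x → A (refl e μ x))
    (h : ∀ x y, ⟪e, x⟫ ≤ μ → ⟪e, y⟫ ≤ μ → A x → A y → P fun i => symm4 e μ (F i) (x, y))
    {z : 𝔼 × 𝔼} (h1 : A z.1) (h2 : A z.2) :
    P fun i => symm4 e μ (F i) z := by
  obtain ⟨x, y⟩ := z
  have hx : ∀ i x y, symm4 e μ (F i) (refl e μ x, y) = symm4 e μ (F i) (x, y) := fun i x y => by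
    simp only [symm4, refl_refl he]; ring
  have hy : ∀ i x y, symm4 e μ (F i) (x, refl e μ y) = symm4 e μ (F i) (x, y) := fun i x y => by
    simp only [symm4, refl_refl he]; ring
  have hside : ∀ x, ¬ ⟪e, x⟫ ≤ μ → ⟪e, refl e μ x⟫ ≤ μ := fun x hx => by
    rw [inner_refl he]; linarith
  by_cases hx' : ⟪e, x⟫ ≤ μ <;> by_cases hy' : ⟪e, y⟫ ≤ μ
  · exact h x y hx' hy' h1 h2
  · simpa only [hy] using h x _ hx' (hside y hy') h1 (hA y h2)
  · simpa only [hx] using h _ y (hside x hx') hy' (hA x h1) h2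
  · simpa only [hx, hy] using h _ _ (hside x hx') (hside y hy') (hA x h1) (hA y h2)

lemma symm4_mul_kern {e : 𝔼} (he : ‖e‖ = 1) (μ s : ℝ) (f : 𝔼 × 𝔼 → ℝ) (x y : 𝔼) :
    symm4 e μ (fun z => f z * kern s z.1 z.2) (x, y) =
      (f (x, y) + f (refl e μ x, refl e μ y)) * kern s x y +
      (f (x, refl e μ y) + f (refl e μ x, y)) * kern s x (refl e μ y) := by
  simp only [symm4, kern_refl_refl he, kern_refl_left he]
  ring

lemma symm4_quot_mul_quot {e : 𝔼} (he : ‖e‖ = 1) (μ s : ℝ) (u w : 𝔼 → ℝ) (x y : 𝔼) :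
    symm4 e μ (fun z => quot s u z * quot s w z) (x, y) =
      ((u x - u y) * (w x - w y) +
        (u (refl e μ x) - u (refl e μ y)) * (w (refl e μ x) - w (refl e μ y))) * kern s x y +
      ((u x - u (refl e μ y)) * (w x - w (refl e μ y)) +
        (u (refl e μ x) - u y) * (w (refl e μ x) - w y)) * kern s x (refl e μ y) := by
  simp only [quot_mul_quot]
  rw [symm4_mul_kern he]

namespace HardySobolev

lemma sub {s : ℝ} {u w : 𝔼 → ℝ} (hu : HardySobolev s u) (hw : HardySobolev s w) :
    HardySobolev s (fun x => u x - w x) where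
  measurable := hu.measurable.sub hw.measurable
  memLp_quot := by
    have e : quot s (fun x => u x - w x) = quot s u - quot s w := by
      ext z; simp only [quot, Pi.sub_apply]; ring
    rw [e]
    exact hu.memLp_quot.sub hw.memLp_quot
  hardy := by
    have h1 := hu.measurable
    have h2 := hw.measurable
    refine lt_of_le_of_lt (lintegral_mono (g := fun x =>
      ENNReal.ofReal 2 * ENNReal.ofReal (u x ^ 2 * (1 + ‖x‖) ^ (-(2 * s))) +
      ENNReal.ofReal 2 * ENNReal.ofReal (w x ^ 2 * (1 + ‖x‖) ^ (-(2 * s)))) fun x => ?_) ?_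
    · beta_reduce
      have hp : 0 ≤ (1 + ‖x‖) ^ (-(2 * s)) := by positivity
      rw [← ENNReal.ofReal_mul (by positivity), ← ENNReal.ofReal_mul (by positivity),
        ← ENNReal.ofReal_add (by positivity) (by positivity)]
      refine ENNReal.ofReal_le_ofReal ?_
      nlinarith [mul_nonneg (sq_nonneg (u x + w x)) hp]
    · rw [lintegral_add_left (by fun_prop), lintegral_const_mul _ (by fun_prop),
        lintegral_const_mul _ (by fun_prop)]
      exact ENNReal.add_lt_top.2 ⟨ENNReal.mul_lt_top (by simp) hu.hardy,
        ENNReal.mul_lt_top (by simp) hw.hardy⟩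

lemma comp_refl {s : ℝ} (hs : 0 < s) {u : 𝔼 → ℝ} (hu : HardySobolev s u) {e : 𝔼} (he : ‖e‖ = 1)
    (μ : ℝ) : HardySobolev s (fun x => u (refl e μ x)) where
  measurable := hu.measurable.comp (measurable_refl e μ)
  memLp_quot := by
    have h : quot s (fun x => u (refl e μ x)) =
        quot s u ∘ fun z : 𝔼 × 𝔼 => (refl e μ z.1, refl e μ z.2) := by
      ext z; simp [quot, kern_refl_refl he]
    rw [h]
    exact hu.memLp_quot.comp_measurePreserving (measurePreserving_refl_prod he μ)
  hardy := by
    have h1 := hu.measurable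
    have h2 := (measurePreserving_refl he μ).lintegral_comp (f := fun x =>
      ENNReal.ofReal (u x ^ 2 * (1 + ‖x‖) ^ (-(2 * s)))) (by fun_prop)
    have h3 := hu.hardy
    rw [← h2] at h3
    have hw : ∀ x : 𝔼, 1 + ‖refl e μ x‖ ≤ (1 + 2 * |μ|) * (1 + ‖x‖) := fun x => by
      have h4 := norm_le_norm_refl_add he μ (refl e μ x)
      rw [refl_refl he] at h4
      nlinarith [norm_nonneg x, abs_nonneg μ, mul_nonneg (abs_nonneg μ) (norm_nonneg x)]
    refine lt_of_le_of_lt (lintegral_mono (g := fun x => ENNReal.ofReal ((1 + 2 * |μ|) ^ (2 * s)) *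
      ENNReal.ofReal (u (refl e μ x) ^ 2 * (1 + ‖refl e μ x‖) ^ (-(2 * s)))) fun x => ?_) ?_
    · beta_reduce
      rw [← ENNReal.ofReal_mul (by positivity)]
      refine ENNReal.ofReal_le_ofReal ?_
      have hx : 0 < 1 + ‖x‖ := by positivity
      have hσ : 0 < 1 + ‖refl e μ x‖ := by positivity
      have h7 : (1 + ‖x‖) ^ (-(2 * s)) ≤
          (1 + 2 * |μ|) ^ (2 * s) * (1 + ‖refl e μ x‖) ^ (-(2 * s)) := by
        rw [Real.rpow_neg hx.le, Real.rpow_neg hσ.le, ← div_eq_mul_inv, inv_eq_one_div,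
          div_le_div_iff₀ (by positivity) (by positivity), one_mul,
          ← Real.mul_rpow (by positivity) hx.le]
        exact Real.rpow_le_rpow hσ.le (hw x) (by linarith)
      calc _ ≤ u (refl e μ x) ^ 2 *
            ((1 + 2 * |μ|) ^ (2 * s) * (1 + ‖refl e μ x‖) ^ (-(2 * s))) := by gcongr
        _ = _ := by ring
    · rw [lintegral_const_mul']
      · exact ENNReal.mul_lt_top ENNReal.ofReal_lt_top h3
      · exact ENNReal.ofReal_ne_top

end HardySobolev

/-- The positive part of `d` on the side `⟪e, x⟫ ≤ μ` of a hyperplane, extended by zero. -/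
noncomputable def sidePos (e : 𝔼) (μ : ℝ) (d : 𝔼 → ℝ) : 𝔼 → ℝ :=
  {x | ⟪e, x⟫ ≤ μ}.indicator fun x => max (d x) 0

lemma measurableSet_side (e : 𝔼) (μ : ℝ) : MeasurableSet {x : 𝔼 | ⟪e, x⟫ ≤ μ} :=
  measurableSet_le (by fun_prop) measurable_const

lemma sidePos_nonneg (e : 𝔼) (μ : ℝ) (d : 𝔼 → ℝ) (x : 𝔼) : 0 ≤ sidePos e μ d x :=
  Set.indicator_nonneg (fun _ _ => le_max_right _ _) _

lemma sidePos_of_le {e : 𝔼} {μ : ℝ} {d : 𝔼 → ℝ} {x : 𝔼} (hx : ⟪e, x⟫ ≤ μ) :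
    sidePos e μ d x = max (d x) 0 := Set.indicator_of_mem (s := {x | ⟪e, x⟫ ≤ μ}) hx _

lemma sidePos_of_lt {e : 𝔼} {μ : ℝ} {d : 𝔼 → ℝ} {x : 𝔼} (hx : μ < ⟪e, x⟫) :
    sidePos e μ d x = 0 :=
  Set.indicator_of_notMem (s := {x | ⟪e, x⟫ ≤ μ}) (by simpa using hx) _

/-- For antisymmetric `d` the function `sidePos e μ d` vanishes at mirror images of points of the
side, including those of the hyperplane itself. -/
lemma sidePos_refl {e : 𝔼} (he : ‖e‖ = 1) {μ : ℝ} {d : 𝔼 → ℝ} (hd : ∀ x, d (refl e μ x) = -d x)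
    {x : 𝔼} (hx : ⟪e, x⟫ ≤ μ) : sidePos e μ d (refl e μ x) = 0 := by
  rcases hx.lt_or_eq with h | h
  · exact sidePos_of_lt (by rw [inner_refl he]; linarith)
  · have h1 := hd x
    rw [refl_eq_self h] at h1 ⊢
    rw [sidePos_of_le hx, show d x = 0 by linarith, max_self]

lemma HardySobolev.sidePos {s : ℝ} (hs : 0 < s) {e : 𝔼} (he : ‖e‖ = 1) {μ : ℝ} {d : 𝔼 → ℝ}
    (hdX : HardySobolev s d) (hd : ∀ x, d (refl e μ x) = -d x) :
    HardySobolev s (sidePos e μ d) := by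
  have hm : Measurable (FracHalfSpace.sidePos e μ d) :=
    (hdX.measurable.max measurable_const).indicator (measurableSet_side e μ)
  have hqd := measurable_quot (s := s) hdX.measurable
  have hqφ := measurable_quot (s := s) hm
  refine ⟨hm, (memLp_quot_iff hm).2 ?_, ?_⟩
  · have h1 := lintegral_symm4 he μ (F := fun z => quot s (FracHalfSpace.sidePos e μ d) z *
      quot s (FracHalfSpace.sidePos e μ d) z) (by fun_prop) (fun z => mul_self_nonneg _)
    have h2 := lintegral_symm4 he μ (F := fun z => quot s d z * quot s d z) (by fun_prop)
      (fun z => mul_self_nonneg _)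
    simp only [← sq] at h1 h2
    rw [← gagliardoEnergy_eq] at h1 h2
    have h3 : 4 * gagliardoEnergy s (FracHalfSpace.sidePos e μ d) ≤
        4 * gagliardoEnergy s d := by
      rw [← h1, ← h2]
      refine lintegral_mono fun z => ENNReal.ofReal_le_ofReal ?_
      refine forall_symm4 he μ (F := fun (i : Bool) z => bif i then
        quot s (FracHalfSpace.sidePos e μ d) z ^ 2 else quot s d z ^ 2)
        (P := fun f => f true ≤ f false) (A := fun _ => True) (fun _ _ => trivial)
          (fun x y hx hy _ _ => ?_) trivial trivial
      simp only [cond_true, cond_false]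
      simp only [sq (quot _ _ _)]
      rw [symm4_quot_mul_quot he, symm4_quot_mul_quot he, sidePos_refl he hd hx,
        sidePos_refl he hd hy, sidePos_of_le hx, sidePos_of_le hy, hd, hd]
      have hk1 := kern_nonneg s x y
      have hk2 := kern_nonneg s x (refl e μ y)
      rcases eq_or_ne x y with rfl | hxy
      · have : max (d x) 0 ^ 2 ≤ d x ^ 2 := by
          rcases le_total (d x) 0 with h | h <;> simp [h, sq_nonneg]
        nlinarith [mul_nonneg (sq_nonneg (d x)) hk2, mul_le_mul_of_nonneg_right this hk2]
      have hk := kern_refl_le he μ hs hx hy hxy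
      generalize kern s x y = k₁ at *
      generalize kern s x (refl e μ y) = k₂ at *
      have m1 : (max (d x) 0 - max (d y) 0) ^ 2 ≤ (d x - d y) ^ 2 := by
        rw [sq_le_sq]
        simpa using abs_max_sub_max_le_max (d x) 0 (d y) 0
      have m2 : max (d x) 0 ^ 2 + max (d y) 0 ^ 2 ≤ d x ^ 2 + d y ^ 2 := by
        rcases le_total (d x) 0 with h | h <;> rcases le_total (d y) 0 with h' | h' <;>
          simp [h, h', sq_nonneg] <;> positivity
      nlinarith [mul_le_mul_of_nonneg_right m1 hk1, mul_le_mul_of_nonneg_right m2 hk2,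
        mul_le_mul_of_nonneg_left hk (sq_nonneg (d x - d y)),
        mul_nonneg (sq_nonneg (d x + d y)) hk2]
    refine lt_top_iff_ne_top.2 fun h => ?_
    rw [h, ENNReal.mul_top (by norm_num), top_le_iff] at h3
    exact ENNReal.mul_ne_top (by norm_num) hdX.energy_lt_top.ne h3
  · refine lt_of_le_of_lt (lintegral_mono fun x => ENNReal.ofReal_le_ofReal ?_) hdX.hardy
    refine mul_le_mul_of_nonneg_right ?_ (by positivity)
    rcases le_or_gt ⟪e, x⟫ μ with hx | hx
    · rw [sidePos_of_le hx]
      rcases le_total (d x) 0 with h | h <;> simp [h, sq_nonneg]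
    · rw [sidePos_of_lt hx, zero_pow two_ne_zero]; exact sq_nonneg _

/-- Testing an antisymmetric function against its positive part on one side of the hyperplane
controls the energy of that positive part, because the kernel decreases under reflection. -/
lemma integral_quot_sidePos_sq_le {s : ℝ} (hs : 0 < s) {e : 𝔼} (he : ‖e‖ = 1) {μ : ℝ} {d : 𝔼 → ℝ}
    (hdX : HardySobolev s d) (hd : ∀ x, d (refl e μ x) = -d x) :
    ∫ z, quot s (sidePos e μ d) z * quot s (sidePos e μ d) z ≤
      ∫ z, quot s d z * quot s (sidePos e μ d) z := by
  have hφ := hdX.sidePos hs he hd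
  have i1 : Integrable fun z => quot s (sidePos e μ d) z * quot s (sidePos e μ d) z :=
    hφ.memLp_quot.integrable_mul hφ.memLp_quot
  have i2 : Integrable fun z => quot s d z * quot s (sidePos e μ d) z :=
    hdX.memLp_quot.integrable_mul hφ.memLp_quot
  have h1 := integral_symm4 he μ i1
  have h2 := integral_symm4 he μ i2
  have h3 : ∫ z, symm4 e μ (fun z => quot s (sidePos e μ d) z * quot s (sidePos e μ d) z) z ≤
      ∫ z, symm4 e μ (fun z => quot s d z * quot s (sidePos e μ d) z) z := by
    refine integral_mono (integrable_symm4 he μ i1) (integrable_symm4 he μ i2) fun z => ?_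
    refine forall_symm4 he μ (F := fun (i : Bool) z => bif i then
      quot s (sidePos e μ d) z * quot s (sidePos e μ d) z
      else quot s d z * quot s (sidePos e μ d) z)
      (P := fun f => f true ≤ f false) (A := fun _ => True) (fun _ _ => trivial)
          (fun x y hx hy _ _ => ?_) trivial trivial
    simp only [cond_true, cond_false]
    rw [symm4_quot_mul_quot he, symm4_quot_mul_quot he, sidePos_refl he hd hx,
      sidePos_refl he hd hy, sidePos_of_le hx, sidePos_of_le hy, hd, hd]
    have hk1 := kern_nonneg s x y
    have hk2 := kern_nonneg s x (refl e μ y)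
    have p1 : d x * max (d x) 0 = max (d x) 0 ^ 2 := by
      rcases le_total (d x) 0 with h | h <;> simp [h, sq]
    have p2 : d y * max (d y) 0 = max (d y) 0 ^ 2 := by
      rcases le_total (d y) 0 with h | h <;> simp [h, sq]
    have q1 : 0 ≤ (max (d x) 0 - d x) * max (d y) 0 :=
      mul_nonneg (sub_nonneg.2 (le_max_left _ _)) (le_max_right _ _)
    have q2 : 0 ≤ (max (d y) 0 - d y) * max (d x) 0 :=
      mul_nonneg (sub_nonneg.2 (le_max_left _ _)) (le_max_right _ _)
    have q3 : 0 ≤ max (d x) 0 * max (d y) 0 := mul_nonneg (le_max_right _ _) (le_max_right _ _)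
    rcases eq_or_ne x y with rfl | hxy
    · nlinarith [mul_nonneg q3 hk2]
    have hk := kern_refl_le he μ hs hx hy hxy
    generalize kern s x y = k₁ at *
    generalize kern s x (refl e μ y) = k₂ at *
    generalize max (d x) 0 = α at *
    generalize max (d y) 0 = β at *
    nlinarith [mul_nonneg (add_nonneg q1 q2) (sub_nonneg.2 hk), mul_nonneg q3 hk2]
  linarith

/-! ### The moving plane inequality -/

/-- Nonnegative weak solutions in the space with Hardy weight, with the equation tested against
all compactly supported functions of that space. -/
structure IsEnergySolution (s lam p : ℝ) (H : Set 𝔼) (v : 𝔼 → ℝ) : Prop where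
  hardySobolev : HardySobolev s v
  nonneg : ∀ x, 0 ≤ v x
  integrable : ∀ (φ : 𝔼 → ℝ) (ρ : ℝ), HardySobolev s φ → (∀ x, ρ ≤ ‖x‖ → φ x = 0) →
    Integrable fun x => rhs lam p H v x * φ x
  weak : ∀ (φ : 𝔼 → ℝ) (ρ : ℝ), HardySobolev s φ → (∀ x, ρ ≤ ‖x‖ → φ x = 0) →
    ∫ z, quot s v z * quot s φ z = ∫ x, rhs lam p H v x * φ x

/-- The difference between a function and its reflection. -/
noncomputable def reflDiff (e : 𝔼) (μ : ℝ) (v : 𝔼 → ℝ) (x : 𝔼) : ℝ := v x - v (refl e μ x)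

lemma reflDiff_refl {e : 𝔼} (he : ‖e‖ = 1) (μ : ℝ) (v : 𝔼 → ℝ) (x : 𝔼) :
    reflDiff e μ v (refl e μ x) = -reflDiff e μ v x := by
  simp [reflDiff, refl_refl he]

lemma HardySobolev.reflDiff {s : ℝ} (hs : 0 < s) {v : 𝔼 → ℝ} (hv : HardySobolev s v) {e : 𝔼}
    (he : ‖e‖ = 1) (μ : ℝ) : HardySobolev s (reflDiff e μ v) :=
  hv.sub (hv.comp_refl hs he μ)

/-- The equation for the difference between a solution and its reflection. -/
lemma IsEnergySolution.reflDiff_weak {s lam p : ℝ} (hs : 0 < s) {H : Set 𝔼} {v : 𝔼 → ℝ}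
    (hv : IsEnergySolution s lam p H v) {e : 𝔼} (he : ‖e‖ = 1) (μ : ℝ) {φ : 𝔼 → ℝ} {ρ : ℝ}
    (hφ : HardySobolev s φ) (hφ0 : ∀ x, ρ ≤ ‖x‖ → φ x = 0) :
    Integrable (fun x => (rhs lam p H v x - rhs lam p H v (refl e μ x)) * φ x) ∧
    ∫ z, quot s (reflDiff e μ v) z * quot s φ z =
      ∫ x, (rhs lam p H v x - rhs lam p H v (refl e μ x)) * φ x := by
  have hψ : HardySobolev s (fun x => φ (refl e μ x)) := hφ.comp_refl hs he μ
  have hψ0 : ∀ x, ρ + 2 * |μ| ≤ ‖x‖ → φ (refl e μ x) = 0 := fun x hx =>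
    hφ0 _ (by linarith [norm_le_norm_refl_add he μ x])
  have i1 := hv.integrable φ ρ hφ hφ0
  have i2 := hv.integrable _ _ hψ hψ0
  have w1 := hv.weak φ ρ hφ hφ0
  have w2 := hv.weak _ _ hψ hψ0
  have hσ := measurePreserving_refl he μ
  have i3 := hσ.integrable_comp_of_integrable i2
  have e3 := integral_comp_measurePreserving hσ i2.1
  simp only [Function.comp_def, refl_refl he] at i3 e3
  have hvσ := hv.hardySobolev.comp_refl hs he μ
  have j1 : Integrable fun z => quot s v z * quot s φ z :=
    hv.hardySobolev.memLp_quot.integrable_mul hφ.memLp_quot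
  have j2 : Integrable fun z => quot s v z * quot s (fun x => φ (refl e μ x)) z :=
    hv.hardySobolev.memLp_quot.integrable_mul hψ.memLp_quot
  have j3 : Integrable fun z => quot s (fun x => v (refl e μ x)) z * quot s φ z :=
    hvσ.memLp_quot.integrable_mul hφ.memLp_quot
  have e4 := integral_comp_measurePreserving (measurePreserving_refl_prod he μ) j2.1
  have e5 : ∀ z : 𝔼 × 𝔼, quot s v (refl e μ z.1, refl e μ z.2) *
      quot s (fun x => φ (refl e μ x)) (refl e μ z.1, refl e μ z.2) =
      quot s (fun x => v (refl e μ x)) z * quot s φ z := fun z => by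
    simp [quot, refl_refl he, kern_refl_refl he]
  simp only [e5] at e4
  refine ⟨(i1.sub i3).congr (.of_forall fun x => ?_), ?_⟩
  · simp only [Pi.sub_apply]; ring
  · have e6 : ∀ z, quot s (reflDiff e μ v) z * quot s φ z = quot s v z * quot s φ z -
        quot s (fun x => v (refl e μ x)) z * quot s φ z := fun z => by
      simp only [quot, reflDiff]; ring
    simp only [e6, sub_mul]
    rw [integral_sub j1 j3, integral_sub i1 i3, w1, e4, w2, e3]

/-- Bernoulli's inequality in the form of a mean value estimate. -/
lemma rpow_sub_rpow_le {a b q : ℝ} (hb : 0 ≤ b) (hab : b ≤ a) (hq : 1 ≤ q) :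
    a ^ q - b ^ q ≤ q * a ^ (q - 1) * (a - b) := by
  rcases (hb.trans hab).eq_or_lt with h | ha
  · have : b = 0 := by linarith
    subst this
    simp [← h]
  have h1 := one_add_mul_self_le_rpow_one_add (s := b / a - 1) (p := q)
    (by have : 0 ≤ b / a := by positivity
        linarith) hq
  rw [add_sub_cancel, Real.div_rpow hb ha.le, le_div_iff₀ (by positivity)] at h1
  rw [Real.rpow_sub_one ha.ne']
  have e : q * (a ^ q / a) * (a - b) = -(q * (b / a - 1)) * a ^ q := by
    field_simp; ring
  rw [e]
  linarith

/-- The linear term absorbs the nonlinearity at small heights; at large heights the nonlinearity is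
dominated by the critical power. -/
lemma exists_growth_bound {lam p r : ℝ} (hlam : 0 < lam) (hp : 2 < p) (hpr : p ≤ r) :
    ∃ C : ℝ, 0 ≤ C ∧ ∀ t : ℝ, 0 ≤ t → (p - 1) * t ^ (p - 2) ≤ lam + C * t ^ (r - 2) := by
  -- `m` is the height at which the left-hand side equals `lam`
  set m : ℝ := (lam / (p - 1)) ^ (1 / (p - 2)) with hm
  have hp1 : 0 < p - 1 := by linarith
  have hp2 : 0 < p - 2 := by linarith
  have hm0 : 0 < m := by positivity
  refine ⟨(p - 1) * m ^ (p - r), by positivity, fun t ht => ?_⟩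
  rcases le_or_gt t m with h | h
  · have h1 : t ^ (p - 2) ≤ lam / (p - 1) := by
      refine (Real.rpow_le_rpow ht h hp2.le).trans_eq ?_
      rw [hm, ← Real.rpow_mul (by positivity), one_div_mul_cancel hp2.ne', Real.rpow_one]
    rw [le_div_iff₀ hp1] at h1
    have h2 : 0 ≤ (p - 1) * m ^ (p - r) * t ^ (r - 2) := by positivity
    linarith
  · have ht0 : 0 < t := hm0.trans h
    have h1 : t ^ (p - r) ≤ m ^ (p - r) :=
      Real.rpow_le_rpow_of_nonpos hm0 h.le (by linarith)
    have h2 : t ^ (p - 2) = t ^ (p - r) * t ^ (r - 2) := by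
      rw [← Real.rpow_add ht0]; congr 1; ring
    rw [h2]
    have h3 : t ^ (p - r) * t ^ (r - 2) ≤ m ^ (p - r) * t ^ (r - 2) := by gcongr
    nlinarith

/-- Where the solution exceeds its reflection, the difference of the right-hand sides is controlled
by the part of the solution in the half-space. -/
lemma rhs_sub_rhs_mul_sidePos_le {lam p r C : ℝ} (hlam : 0 < lam) (hp : 2 < p)
    (hC : ∀ t : ℝ, 0 ≤ t → (p - 1) * t ^ (p - 2) ≤ lam + C * t ^ (r - 2))
    {H : Set 𝔼} {e : 𝔼} (he : ‖e‖ = 1)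
    (hH : ∀ x y : 𝔼, x ∈ H → ⟪e, x⟫ ≤ ⟪e, y⟫ → y ∈ H) {v : 𝔼 → ℝ} (hv : ∀ x, 0 ≤ v x)
    (μ : ℝ) (x : 𝔼) :
    (rhs lam p H v x - rhs lam p H v (refl e μ x)) * sidePos e μ (reflDiff e μ v) x ≤
      C * (H ∩ {x | 0 < sidePos e μ (reflDiff e μ v) x}).indicator
        (fun x => v x ^ (r - 2) * sidePos e μ (reflDiff e μ v) x ^ 2) x := by
  set φ := sidePos e μ (reflDiff e μ v) with hφ
  rcases (sidePos_nonneg e μ (reflDiff e μ v) x).eq_or_lt with h0 | h0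
  · rw [← hφ] at h0
    rw [Set.indicator_of_notMem (by simp [← h0]), ← h0]; simp
  rw [← hφ] at h0
  have hx : ⟪e, x⟫ ≤ μ := by
    by_contra h
    rw [hφ, sidePos_of_lt (not_le.1 h)] at h0
    exact lt_irrefl _ h0
  have hφx : φ x = v x - v (refl e μ x) := by
    rw [hφ, sidePos_of_le hx] at h0 ⊢
    rcases le_total (reflDiff e μ v x) 0 with h | h
    · rw [max_eq_right h] at h0; exact absurd h0 (lt_irrefl _)
    · rw [max_eq_left h]; rfl
  have hvx := hv x
  have hvσ := hv (refl e μ x)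
  have hσ0 : 0 ≤ v (refl e μ x) ^ (p - 1) := Real.rpow_nonneg hvσ _
  by_cases hxH : x ∈ H
  · have hσH : refl e μ x ∈ H := hH x _ hxH (by rw [inner_refl he]; linarith)
    rw [Set.indicator_of_mem (show x ∈ H ∩ {x | 0 < φ x} from ⟨hxH, h0⟩)]
    have h1 := rpow_sub_rpow_le (q := p - 1) hvσ (by linarith : v (refl e μ x) ≤ v x) (by linarith)
    have h2 := hC (v x) hvx
    rw [show p - 1 - 1 = p - 2 by ring, ← hφx] at h1
    simp only [rhs, Set.indicator_of_mem hxH, Set.indicator_of_mem hσH]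
    have h3 : v x ^ (p - 1) - lam * v x - (v (refl e μ x) ^ (p - 1) - lam * v (refl e μ x)) ≤
        C * v x ^ (r - 2) * φ x := by
      have := mul_le_mul_of_nonneg_right h2 h0.le
      have e1 : lam * v x - lam * v (refl e μ x) = lam * φ x := by rw [hφx]; ring
      linarith
    calc _ ≤ C * v x ^ (r - 2) * φ x * φ x := mul_le_mul_of_nonneg_right h3 h0.le
      _ = _ := by ring
  · rw [Set.indicator_of_notMem (fun h => hxH h.1), mul_zero]
    refine mul_nonpos_of_nonpos_of_nonneg ?_ h0.le
    simp only [rhs, Set.indicator_of_notMem hxH]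
    have h1 : 0 ≤ H.indicator (fun x => v x ^ (p - 1)) (refl e μ x) :=
      Set.indicator_nonneg (fun y _ => Real.rpow_nonneg (hv y) _) _
    have h2 : lam * v (refl e μ x) ≤ lam * v x := by
      refine mul_le_mul_of_nonneg_left ?_ hlam.le
      linarith
    linarith

lemma lintegral_rpow_mul_sq_le {α : Type*} [MeasurableSpace α] {μ : Measure α} {r : ℝ}
    (hr : 2 < r) {v φ : α → ℝ} (hv : Measurable v) (hφ : Measurable φ) (hv0 : ∀ x, 0 ≤ v x) :
    ∫⁻ x, ENNReal.ofReal (v x ^ (r - 2) * φ x ^ 2) ∂μ ≤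
      (∫⁻ x, ‖v x‖ₑ ^ r ∂μ) ^ ((r - 2) / r) * (∫⁻ x, ‖φ x‖ₑ ^ r ∂μ) ^ (2 / r) := by
  have hpq : (r / (r - 2)).HolderConjugate (r / 2) := by
    have : 0 < r - 2 := by linarith
    have hr0 : 0 < r := by linarith
    rw [Real.holderConjugate_iff]
    refine ⟨?_, by field_simp; ring⟩
    rw [one_lt_div this]; linarith
  have h := ENNReal.lintegral_mul_le_Lp_mul_Lq μ hpq (f := fun x => ‖v x‖ₑ ^ (r - 2))
    (g := fun x => ‖φ x‖ₑ ^ (2 : ℝ)) (by fun_prop) (by fun_prop)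
  simp only [← ENNReal.rpow_mul, Pi.mul_apply] at h
  rw [show (r - 2) * (r / (r - 2)) = r by field_simp [(by linarith : r - 2 ≠ 0)],
    show (2 : ℝ) * (r / 2) = r by ring, one_div_div, one_div_div] at h
  refine le_trans (le_of_eq (lintegral_congr fun x => ?_)) h
  rw [ENNReal.ofReal_mul (Real.rpow_nonneg (hv0 x) _), ofReal_sq_eq_enorm, ENNReal.rpow_two,
    Real.enorm_of_nonneg (hv0 x), ENNReal.ofReal_rpow_of_nonneg (hv0 x) (by linarith)]

/-- If the part of the half-space where the solution exceeds its reflection carries little critical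
mass, then the solution nowhere exceeds its reflection. -/
lemma IsEnergySolution.exists_small_mass (hN0 : 0 < N) {s lam p r θ : ℝ} (hs0 : 0 < s) (hs1 : s < 1)
    (hθ1 : θ < 1) (hθ : (N : ℝ) * θ = 2 * s) (hr : r = 2 / (1 - θ)) (hlam : 0 < lam) (hp : 2 < p)
    (hpr : p ≤ r) {H : Set 𝔼} (hHm : MeasurableSet H) {e : 𝔼} (he : ‖e‖ = 1)
    (hH : ∀ x y : 𝔼, x ∈ H → ⟪e, x⟫ ≤ ⟪e, y⟫ → y ∈ H) {v : 𝔼 → ℝ}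
    (hv : IsEnergySolution s lam p H v) :
    ∃ δ : ℝ≥0∞, 0 < δ ∧ ∀ μ : ℝ,
      ∫⁻ x in H ∩ {x | 0 < sidePos e μ (reflDiff e μ v) x}, ‖v x‖ₑ ^ r < δ →
        ∀ᵐ x, sidePos e μ (reflDiff e μ v) x = 0 := by
  obtain ⟨C₀, hC₀, hgrow⟩ := exists_growth_bound (r := r) hlam hp hpr
  obtain ⟨CS, hCS, hsob⟩ := HardySobolev.exists_sobolev hN0 hs0 hs1 hθ1 hθ hr
  have hr2 : 2 < r := by linarith
  have hκ : 0 < (r - 2) / r := div_pos (by linarith) (by linarith)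
  -- the energy estimate below has the factor `K * mass ^ ((r - 2) / r)`, to be made less than one
  set K : ℝ≥0∞ := ENNReal.ofReal C₀ * CS with hK
  have hKT : K ≠ ⊤ := ENNReal.mul_ne_top ENNReal.ofReal_ne_top hCS
  have hvm := hv.hardySobolev.measurable
  refine ⟨((K + 1)⁻¹) ^ (1 / ((r - 2) / r)), ?_, fun μ hμ => ?_⟩
  · refine ENNReal.rpow_pos ?_ ?_
    · simp [hKT]
    · simp
  set φ := sidePos e μ (reflDiff e μ v) with hφ
  set B := H ∩ {x | 0 < φ x} with hB
  have hdX := hv.hardySobolev.reflDiff hs0 he μ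
  have hφX : HardySobolev s φ := hdX.sidePos hs0 he (reflDiff_refl he μ v)
  have hφm := hφX.measurable
  have hBm : MeasurableSet B := hHm.inter (measurableSet_lt measurable_const hφm)
  have hφr := hφX.lintegral_rpow_lt_top hN0 hs0 hs1 hθ1 hθ hr
  set h : 𝔼 → ℝ := B.indicator fun x => v x ^ (r - 2) * φ x ^ 2 with hh
  have hh0 : ∀ x, 0 ≤ h x := Set.indicator_nonneg fun x _ =>
    mul_nonneg (Real.rpow_nonneg (hv.nonneg x) _) (sq_nonneg _)
  have hhm : Measurable h := ((hvm.pow_const _).mul (hφm.pow_const _)).indicator hBm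
  have hhle : ∫⁻ x, ENNReal.ofReal (h x) ≤
      (∫⁻ x in B, ‖v x‖ₑ ^ r) ^ ((r - 2) / r) * (∫⁻ x, ‖φ x‖ₑ ^ r) ^ (2 / r) := by
    have e1 : ∀ x, ENNReal.ofReal (h x) =
        B.indicator (fun x => ENNReal.ofReal (v x ^ (r - 2) * φ x ^ 2)) x := fun x => by
      by_cases hx : x ∈ B <;> simp [hh, hx]
    simp only [e1]
    rw [lintegral_indicator hBm]
    refine (lintegral_rpow_mul_sq_le hr2 hvm hφm hv.nonneg).trans ?_
    gcongr
    exact Measure.restrict_le_self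
  have hsmall : K * (∫⁻ x in B, ‖v x‖ₑ ^ r) ^ ((r - 2) / r) < 1 := by
    have h1 := ENNReal.rpow_lt_rpow hμ hκ
    rw [← ENNReal.rpow_mul, one_div_mul_cancel hκ.ne', ENNReal.rpow_one] at h1
    calc K * (∫⁻ x in B, ‖v x‖ₑ ^ r) ^ ((r - 2) / r) ≤ K * (K + 1)⁻¹ := by gcongr
      _ < 1 := by
        rw [← div_eq_mul_inv]
        exact (ENNReal.div_lt_iff (Or.inl (by simp)) (Or.inl (by simp [hKT]))).2
          (by rw [one_mul]; exact ENNReal.lt_add_right hKT one_ne_zero)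
  have hmassT : (∫⁻ x in B, ‖v x‖ₑ ^ r) ^ ((r - 2) / r) ≠ ⊤ :=
    ENNReal.rpow_ne_top_of_nonneg hκ.le (hμ.trans_le le_top).ne
  have hr0 : 0 < r := by linarith
  have hhi : Integrable h := by
    refine ⟨hhm.aestronglyMeasurable, ?_⟩
    rw [hasFiniteIntegral_iff_ofReal (.of_forall hh0)]
    refine hhle.trans_lt (ENNReal.mul_lt_top hmassT.lt_top ?_)
    exact ENNReal.rpow_lt_top_of_nonneg (by positivity) hφr.ne
  -- `φ` itself has no compact support; the cutoffs are removed in the limit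
  have htest : ∀ n : ℕ, ∫ z, quot s (reflDiff e μ v) z *
      quot s (fun x => cutoff ((n : ℝ) + 1) x * φ x) z ≤ C₀ * ∫ x, h x := fun n => by
    have hcut := hφX.cutoff_mul hN0 hs0 hs1 (R := (n : ℝ) + 1) (by simp)
    have hw := hv.reflDiff_weak hs0 he μ hcut (ρ := 2 * ((n : ℝ) + 1)) (fun x hx => by
      rw [cutoff_eq_zero (by positivity) hx, zero_mul])
    rw [hw.2, ← integral_const_mul]
    refine integral_mono hw.1 (hhi.const_mul C₀) fun x => ?_
    have h1 := rhs_sub_rhs_mul_sidePos_le hlam hp hgrow he hH hv.nonneg μ x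
    have h2 := cutoff_nonneg ((n : ℝ) + 1) x
    have h3 := cutoff_le_one ((n : ℝ) + 1) x
    have h4 : 0 ≤ C₀ * h x := mul_nonneg hC₀ (hh0 x)
    calc (rhs lam p H v x - rhs lam p H v (refl e μ x)) * (cutoff ((n : ℝ) + 1) x * φ x)
        = cutoff ((n : ℝ) + 1) x * ((rhs lam p H v x - rhs lam p H v (refl e μ x)) * φ x) := by ring
      _ ≤ cutoff ((n : ℝ) + 1) x * (C₀ * h x) := mul_le_mul_of_nonneg_left h1 h2
      _ ≤ C₀ * h x := mul_le_of_le_one_left h4 h3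
  have hlim := le_of_tendsto' (hφX.tendsto_integral_quot_cutoff hN0 hs0 hs1 hdX) htest
  have hE : gagliardoEnergy s φ ≤
      K * (∫⁻ x in B, ‖v x‖ₑ ^ r) ^ ((r - 2) / r) * gagliardoEnergy s φ := by
    have h1 := (integral_quot_sidePos_sq_le hs0 he hdX (reflDiff_refl he μ v)).trans hlim
    have h2 : gagliardoEnergy s φ = ENNReal.ofReal (∫ z, quot s φ z * quot s φ z) := by
      have hi : Integrable fun z => quot s φ z * quot s φ z :=
        hφX.memLp_quot.integrable_mul hφX.memLp_quot
      rw [gagliardoEnergy_eq, ofReal_integral_eq_lintegral_ofReal hi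
        (.of_forall fun z => mul_self_nonneg _)]
      simp only [sq]
    calc gagliardoEnergy s φ ≤ ENNReal.ofReal (C₀ * ∫ x, h x) := by
          rw [h2]; exact ENNReal.ofReal_le_ofReal h1
      _ = ENNReal.ofReal C₀ * ∫⁻ x, ENNReal.ofReal (h x) := by
          rw [ENNReal.ofReal_mul hC₀, ofReal_integral_eq_lintegral_ofReal hhi (.of_forall hh0)]
      _ ≤ ENNReal.ofReal C₀ * ((∫⁻ x in B, ‖v x‖ₑ ^ r) ^ ((r - 2) / r) *
            (CS * gagliardoEnergy s φ)) := by
          gcongr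
          exact hhle.trans (by gcongr; exact hsob φ hφX)
      _ = _ := by rw [hK]; ring
  have hE0 : gagliardoEnergy s φ = 0 := by
    by_contra h0
    have h1 : K * (∫⁻ x in B, ‖v x‖ₑ ^ r) ^ ((r - 2) / r) * gagliardoEnergy s φ <
        1 * gagliardoEnergy s φ :=
      (ENNReal.mul_lt_mul_iff_left h0 hφX.energy_lt_top.ne).2 hsmall
    rw [one_mul] at h1
    exact absurd hE (not_le.2 h1)
  have h5 := hsob φ hφX
  rw [hE0, mul_zero, nonpos_iff_eq_zero, ENNReal.rpow_eq_zero_iff_of_pos (by positivity),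
    lintegral_eq_zero_iff (by fun_prop)] at h5
  filter_upwards [h5] with x hx
  simpa [ENNReal.rpow_eq_zero_iff_of_pos hr0] using hx

/-! ### The strong maximum principle for antisymmetric functions -/

/-- The piecewise linear function that increases from `0` to `1` on `[0, 1]`. -/
noncomputable def ramp (t : ℝ) : ℝ := max 0 (min 1 t)

lemma ramp_nonneg (t : ℝ) : 0 ≤ ramp t := le_max_left _ _

lemma ramp_le_one (t : ℝ) : ramp t ≤ 1 := max_le zero_le_one (min_le_left _ _)

lemma ramp_mono : Monotone ramp := fun _ _ h => max_le_max le_rfl (min_le_min le_rfl h)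

lemma ramp_of_nonpos {t : ℝ} (h : t ≤ 0) : ramp t = 0 := max_eq_left ((min_le_right _ _).trans h)

lemma ramp_of_one_le {t : ℝ} (h : 1 ≤ t) : ramp t = 1 := by
  unfold ramp; rw [min_eq_left h, max_eq_right zero_le_one]

lemma ramp_pos {t : ℝ} (h : 0 < t) : 0 < ramp t :=
  lt_max_of_lt_right (lt_min one_pos h)

lemma abs_ramp_sub_le (t t' : ℝ) : |ramp t - ramp t'| ≤ |t - t'| := by
  unfold ramp
  refine (abs_max_sub_max_le_max _ _ _ _).trans (max_le (by simp) ?_)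
  exact (abs_min_sub_min_le_max _ _ _ _).trans (max_le (by simp) le_rfl)

@[fun_prop]
lemma measurable_ramp : Measurable ramp := by
  unfold ramp; fun_prop

lemma mul_ramp_le {a δ : ℝ} (hδ : 0 < δ) : a * ramp (1 - a / δ) ≤ δ := by
  rcases le_total a 0 with h | h
  · have := mul_nonpos_of_nonpos_of_nonneg h (ramp_nonneg (1 - a / δ))
    linarith
  rcases le_total δ a with h' | h'
  · rw [ramp_of_nonpos, mul_zero]
    · exact hδ.le
    · rw [sub_nonpos, one_le_div hδ]; exact h'
  · exact (mul_le_of_le_one_right h (ramp_le_one _)).trans h'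

lemma tendsto_ramp_one_sub (a : ℝ) :
    Tendsto (fun k : ℕ => ramp (1 - a / (1 / ((k : ℝ) + 1)))) atTop
      (𝓝 (if a ≤ 0 then 1 else 0)) := by
  refine tendsto_const_nhds.congr' ?_
  filter_upwards [eventually_ge_atTop ⌈1 / a⌉₊] with k hk
  have hk0 : (0 : ℝ) < (k : ℝ) + 1 := by positivity
  split_ifs with h
  · rw [ramp_of_one_le]
    have : a / (1 / ((k : ℝ) + 1)) ≤ 0 := div_nonpos_of_nonpos_of_nonneg h (by positivity)
    linarith
  · have ha : 0 < a := not_le.1 h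
    rw [ramp_of_nonpos]
    have h1 : 1 / a ≤ k := Nat.ceil_le.1 hk
    rw [div_le_iff₀ ha] at h1
    rw [div_div_eq_mul_div, div_one, sub_nonpos]
    nlinarith

/-- A function with values in `[0, 1]` may be multiplied by a Lipschitz truncation of another
function of the class. -/
lemma HardySobolev.mul_ramp {s : ℝ} {ζ w : 𝔼 → ℝ} (hζ : HardySobolev s ζ) (hζ0 : ∀ x, 0 ≤ ζ x)
    (hζ1 : ∀ x, ζ x ≤ 1) (hw : HardySobolev s w) {δ : ℝ} (hδ : 0 < δ) :
    HardySobolev s (fun x => ζ x * ramp (1 - w x / δ)) where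
  measurable := by
    have h1 := hζ.measurable
    have h2 := hw.measurable
    fun_prop
  memLp_quot := by
    have h1 := hζ.measurable
    have h2 := hw.measurable
    have h3 := measurable_quot (s := s) (u := fun x => ζ x * ramp (1 - w x / δ)) (by fun_prop)
    refine (hζ.memLp_quot.norm.add (hw.memLp_quot.norm.const_mul δ⁻¹)).mono'
      h3.aestronglyMeasurable (.of_forall fun z => ?_)
    simp only [quot, Pi.add_apply, norm_mul, Real.norm_eq_abs]
    rw [← mul_assoc, ← add_mul]
    refine mul_le_mul_of_nonneg_right ?_ (abs_nonneg _)
    have e1 : ζ z.1 * ramp (1 - w z.1 / δ) - ζ z.2 * ramp (1 - w z.2 / δ) =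
        (ζ z.1 - ζ z.2) * ramp (1 - w z.1 / δ) +
          ζ z.2 * (ramp (1 - w z.1 / δ) - ramp (1 - w z.2 / δ)) := by ring
    rw [e1]
    refine (abs_add_le _ _).trans ?_
    rw [abs_mul, abs_mul, abs_of_nonneg (ramp_nonneg _), abs_of_nonneg (hζ0 _)]
    refine add_le_add (mul_le_of_le_one_right (abs_nonneg _) (ramp_le_one _)) ?_
    refine (mul_le_of_le_one_left (abs_nonneg _) (hζ1 _)).trans ?_
    refine (abs_ramp_sub_le _ _).trans (le_of_eq ?_)
    rw [show 1 - w z.1 / δ - (1 - w z.2 / δ) = δ⁻¹ * -(w z.1 - w z.2) by field_simp; ring, abs_mul,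
      abs_neg, abs_of_pos (inv_pos.2 hδ)]
  hardy := by
    refine lt_of_le_of_lt (lintegral_mono fun x => ENNReal.ofReal_le_ofReal ?_) hζ.hardy
    refine mul_le_mul_of_nonneg_right ?_ (by positivity)
    exact pow_le_pow_left₀ (mul_nonneg (hζ0 x) (ramp_nonneg _))
      (mul_le_of_le_one_right (hζ0 x) (ramp_le_one _)) 2

/-- The right-hand side is ordered where the solution lies below its reflection. -/
lemma rhs_sub_rhs_le {lam p : ℝ} (hp : 1 ≤ p) {H : Set 𝔼} {e : 𝔼} (he : ‖e‖ = 1)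
    (hH : ∀ x y : 𝔼, x ∈ H → ⟪e, x⟫ ≤ ⟪e, y⟫ → y ∈ H) {v : 𝔼 → ℝ} (hv : ∀ x, 0 ≤ v x)
    {μ : ℝ} {x : 𝔼} (hx : ⟪e, x⟫ ≤ μ) (hle : reflDiff e μ v x ≤ 0) :
    rhs lam p H v x - rhs lam p H v (refl e μ x) ≤ lam * -reflDiff e μ v x := by
  have hvx : v x ≤ v (refl e μ x) := by unfold reflDiff at hle; linarith
  have h1 : H.indicator (fun x => v x ^ (p - 1)) x ≤
      H.indicator (fun x => v x ^ (p - 1)) (refl e μ x) := by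
    by_cases hxH : x ∈ H
    · have hσH : refl e μ x ∈ H := hH x _ hxH (by rw [inner_refl he]; linarith)
      rw [Set.indicator_of_mem hxH, Set.indicator_of_mem hσH]
      exact Real.rpow_le_rpow (hv x) hvx (by linarith)
    · rw [Set.indicator_of_notMem hxH]
      exact Set.indicator_nonneg (fun y _ => Real.rpow_nonneg (hv y) _) _
  simp only [rhs, reflDiff]
  linarith

/-- If the solution lies below its reflection on one side of a hyperplane, and touches it at points
of positive density, then it coincides with its reflection. The test functions
`ζ * ramp (1 - w / δ)`, where `w` is the reflection minus the solution, concentrate on the contact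
set as `δ → 0`, and only the nonlocal interaction of that set with `{w > 0}` survives in the
limit. -/
lemma IsEnergySolution.ae_contact {s lam p : ℝ} (hs : 0 < s) (hlam : 0 < lam) (hp : 1 ≤ p)
    {H : Set 𝔼} {e : 𝔼} (he : ‖e‖ = 1)
    (hH : ∀ x y : 𝔼, x ∈ H → ⟪e, x⟫ ≤ ⟪e, y⟫ → y ∈ H) {v : 𝔼 → ℝ}
    (hv : IsEnergySolution s lam p H v) {μ : ℝ}
    (hle : ∀ᵐ x, ⟪e, x⟫ ≤ μ → reflDiff e μ v x ≤ 0)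
    {ζ : 𝔼 → ℝ} {ρ : ℝ} (hζ : HardySobolev s ζ) (hζ0 : ∀ x, 0 ≤ ζ x) (hζ1 : ∀ x, ζ x ≤ 1)
    (hζc : ∀ x, ρ ≤ ‖x‖ → ζ x = 0) (hζs : ∀ x, μ ≤ ⟪e, x⟫ → ζ x = 0) :
    ∀ᵐ z : 𝔼 × 𝔼, ⟪e, z.1⟫ < μ → ⟪e, z.2⟫ < μ → 0 < ζ z.1 → 0 ≤ reflDiff e μ v z.1 →
      reflDiff e μ v z.2 = 0 := by
  set d := reflDiff e μ v with hd
  have hdX : HardySobolev s d := hv.hardySobolev.reflDiff hs he μ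
  have hdσ : ∀ x, d (refl e μ x) = -d x := reflDiff_refl he μ v
  have hwX : HardySobolev s (fun x => -d x) := by
    have h := hdX.comp_refl hs he μ
    simpa only [hdσ] using h
  have hζm := hζ.measurable
  have hdm := hdX.measurable
  let θ : ℕ → 𝔼 → ℝ := fun k x => ramp (1 - -d x / (1 / ((k : ℝ) + 1)))
  let φ : ℕ → 𝔼 → ℝ := fun k x => ζ x * θ k x
  let φ' : 𝔼 → ℝ := fun x => ζ x * (if -d x ≤ 0 then 1 else 0)
  have hδ : ∀ k : ℕ, (0 : ℝ) < 1 / ((k : ℝ) + 1) := fun k => by positivity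
  have hφX : ∀ k, HardySobolev s (φ k) := fun k => hζ.mul_ramp hζ0 hζ1 hwX (hδ k)
  have hφc : ∀ k x, ρ ≤ ‖x‖ → φ k x = 0 := fun k x hx => by simp only [φ, hζc x hx, zero_mul]
  have hζσ : ∀ x, ⟪e, x⟫ ≤ μ → ζ (refl e μ x) = 0 := fun x hx =>
    hζs _ (by rw [inner_refl he]; linarith)
  -- the symmetrized integrands, their limit, and an integrable `G` with `-G ≤ S k`
  let S : ℕ → 𝔼 × 𝔼 → ℝ := fun k => symm4 e μ fun z => quot s d z * quot s (φ k) z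
  let S' : 𝔼 × 𝔼 → ℝ := symm4 e μ fun z => quot s d z * quot s φ' z
  let G : 𝔼 × 𝔼 → ℝ := symm4 e μ fun z =>
    |d z.1 - d z.2| * |ζ z.1 - ζ z.2| * kern s z.1 z.2
  have hφ'm : Measurable φ' := by
    refine hζm.mul (Measurable.ite ?_ measurable_const measurable_const)
    exact measurableSet_le (by fun_prop) measurable_const
  have hqd := measurable_quot (s := s) hdm
  have hqφ := fun k => measurable_quot (s := s) (hφX k).measurable
  have hqφ' := measurable_quot (s := s) hφ'm
  have hSm : ∀ k, Measurable (S k) := fun k =>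
    measurable_symm4 e μ (hqd.mul (hqφ k))
  have hS'm : Measurable S' := measurable_symm4 e μ (hqd.mul hqφ')
  have hGi0 : Integrable fun z : 𝔼 × 𝔼 => |d z.1 - d z.2| * |ζ z.1 - ζ z.2| * kern s z.1 z.2 := by
    have h1 : Integrable (fun z => quot s d z * quot s ζ z) :=
      hdX.memLp_quot.integrable_mul hζ.memLp_quot
    refine h1.norm.congr (.of_forall fun z => ?_)
    beta_reduce
    rw [quot_mul_quot, norm_mul, norm_mul, Real.norm_of_nonneg (kern_nonneg _ _ _)]
    rfl
  have hGi : Integrable G := integrable_symm4 he μ hGi0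
  have hG0 : ∀ z, 0 ≤ G z := fun z => by
    have h : ∀ z : 𝔼 × 𝔼, 0 ≤ |d z.1 - d z.2| * |ζ z.1 - ζ z.2| * kern s z.1 z.2 := fun z =>
      mul_nonneg (by positivity) (kern_nonneg _ _ _)
    exact add_nonneg (add_nonneg (add_nonneg (h _) (h _)) (h _)) (h _)
  have hSi0 : ∀ k, Integrable fun z => quot s d z * quot s (φ k) z := fun k =>
    hdX.memLp_quot.integrable_mul (hφX k).memLp_quot
  have hSi : ∀ k, Integrable (S k) := fun k => integrable_symm4 he μ (hSi0 k)
  have hlower : ∀ k z, -S k z ≤ G z := fun k z => by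
    refine forall_symm4 he μ (F := fun (i : Bool) z => bif i then
      quot s d z * quot s (φ k) z
      else |d z.1 - d z.2| * |ζ z.1 - ζ z.2| * kern s z.1 z.2)
      (P := fun f => -f true ≤ f false) (A := fun _ => True) (fun _ _ => trivial)
      (fun x y hx hy _ _ => ?_) trivial trivial
    simp only [cond_true, cond_false]
    rw [symm4_quot_mul_quot he, symm4_mul_kern he (f := fun z => |d z.1 - d z.2| * |ζ z.1 - ζ z.2|)]
    simp only [φ, hζσ x hx, hζσ y hy, hdσ, zero_mul, sub_zero, zero_sub, sub_self, mul_zero,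
      add_zero, abs_zero, abs_neg, mul_neg]
    have hk1 := kern_nonneg s x y
    have hk2 := kern_nonneg s x (refl e μ y)
    have hx0 := hζ0 x
    have hy0 := hζ0 y
    have tx0 : 0 ≤ θ k x := ramp_nonneg _
    have ty0 : 0 ≤ θ k y := ramp_nonneg _
    have tx1 : θ k x ≤ 1 := ramp_le_one _
    have ty1 : θ k y ≤ 1 := ramp_le_one _
    -- the truncation decreases in `w = -d`, so its own contribution to the integrand has a sign
    have hmon : 0 ≤ (d x - d y) * (θ k x - θ k y) := by
      rcases le_total (d x) (d y) with h | h
      · have : θ k x ≤ θ k y := ramp_mono (by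
          have := div_le_div_of_nonneg_right (neg_le_neg h) (hδ k).le
          linarith)
        nlinarith
      · have : θ k y ≤ θ k x := ramp_mono (by
          have := div_le_div_of_nonneg_right (neg_le_neg h) (hδ k).le
          linarith)
        nlinarith
    have m1 : -((d x - d y) * (ζ x * θ k x - ζ y * θ k y)) ≤ |d x - d y| * |ζ x - ζ y| := by
      have e1 : (d x - d y) * (ζ x * θ k x - ζ y * θ k y) =
          ζ x * ((d x - d y) * (θ k x - θ k y)) + (d x - d y) * (ζ x - ζ y) * θ k y := by ring
      have e2 : -((d x - d y) * (ζ x - ζ y) * θ k y) ≤ |d x - d y| * |ζ x - ζ y| := by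
        rw [← abs_mul]
        refine (neg_le_abs _).trans ?_
        rw [abs_mul, abs_of_nonneg ty0]
        exact mul_le_of_le_one_right (abs_nonneg _) ty1
      have := mul_nonneg hx0 hmon
      linarith
    have m2 : ∀ (t : ℝ) {c τ : ℝ}, 0 ≤ c → 0 ≤ τ → τ ≤ 1 → -(t * (c * τ)) ≤ |t| * |c| :=
      fun t c τ hc hτ hτ1 => by
        refine (neg_le_abs _).trans ?_
        rw [abs_mul, abs_mul, abs_of_nonneg hτ]
        exact mul_le_mul_of_nonneg_left (mul_le_of_le_one_right (abs_nonneg _) hτ1) (abs_nonneg _)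
    have m3 := m2 (d x - -d y) hx0 tx0 tx1
    have m4 := m2 (d y - -d x) hy0 ty0 ty1
    have e3 : |-d x - d y| = |d y - -d x| := by rw [← abs_neg]; congr 1; ring
    rw [e3]
    have := mul_le_mul_of_nonneg_right m1 hk1
    have := mul_le_mul_of_nonneg_right (add_le_add m3 m4) hk2
    linarith
  have hlimS : ∀ z, Tendsto (fun k => S k z) atTop (𝓝 (S' z)) := fun z => by
    have h1 : ∀ x, Tendsto (fun k => φ k x) atTop (𝓝 (φ' x)) := fun x =>
      (tendsto_ramp_one_sub (-d x)).const_mul _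
    have h2 : ∀ z, Tendsto (fun k => quot s d z * quot s (φ k) z) atTop
        (𝓝 (quot s d z * quot s φ' z)) := fun z =>
      (((h1 z.1).sub (h1 z.2)).mul_const _).const_mul _
    exact (((h2 _).add (h2 _)).add (h2 _)).add (h2 _)
  -- since `w * ramp (1 - w / δ) ≤ δ`, the equation tested with `φ k` has a right-hand side bounded
  -- by a null sequence
  have hζint : Integrable ζ := by
    refine (integrable_indicator_iff measurableSet_ball).2
      (integrableOn_const (C := (1 : ℝ)) (measure_ball_lt_top (x := (0 : 𝔼)) (r := ρ)).ne) |>.mono'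
      hζm.aestronglyMeasurable (.of_forall fun x => ?_)
    rw [Real.norm_of_nonneg (hζ0 x)]
    by_cases hx : x ∈ Metric.ball (0 : 𝔼) ρ
    · rw [Set.indicator_of_mem hx]; exact hζ1 x
    · rw [Set.indicator_of_notMem hx, hζc x (by simpa using hx)]
  have htest : ∀ k, ∫ z, S k z ≤ 4 * (lam * (1 / ((k : ℝ) + 1)) * ∫ x, ζ x) := fun k => by
    have hw := hv.reflDiff_weak hs he μ (hφX k) (hφc k)
    have h1 := integral_symm4 he μ (hSi0 k)
    rw [hw.2] at h1
    change ∫ z, S k z = _ at h1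
    rw [h1]
    refine mul_le_mul_of_nonneg_left ?_ (by norm_num : (0 : ℝ) ≤ 4)
    rw [← integral_const_mul]
    refine integral_mono_ae hw.1 (hζint.const_mul _) ?_
    filter_upwards [hle] with x hx
    rcases le_or_gt ⟪e, x⟫ μ with hxμ | hxμ
    · have h2 := rhs_sub_rhs_le (lam := lam) hp he hH hv.nonneg hxμ (hx hxμ)
      have h3 := mul_ramp_le (a := -d x) (hδ k)
      have hφ0 : 0 ≤ φ k x := mul_nonneg (hζ0 x) (ramp_nonneg _)
      calc _ ≤ lam * -d x * φ k x := mul_le_mul_of_nonneg_right h2 hφ0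
        _ = lam * ((-d x * θ k x) * ζ x) := by simp only [φ]; ring
        _ ≤ lam * (1 / ((k : ℝ) + 1) * ζ x) := by
          refine mul_le_mul_of_nonneg_left ?_ hlam.le
          exact mul_le_mul_of_nonneg_right h3 (hζ0 x)
        _ = _ := by ring
    · have hz : ζ x = 0 := hζs x hxμ.le
      simp only [φ, hz, zero_mul, mul_zero, le_refl]
  -- the function `φ'` lives on the contact set, where `d = 0`, so that only the products of `d` and
  -- `φ'` at different points survive in `S'`
  have hgood : ∀ᵐ x : 𝔼, (⟪e, x⟫ ≤ μ → d x ≤ 0) ∧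
      (⟪e, refl e μ x⟫ ≤ μ → d (refl e μ x) ≤ 0) :=
    hle.and ((measurePreserving_refl he μ).quasiMeasurePreserving.ae hle)
  have hgoodσ : ∀ x : 𝔼, ((⟪e, x⟫ ≤ μ → d x ≤ 0) ∧
      (⟪e, refl e μ x⟫ ≤ μ → d (refl e μ x) ≤ 0)) → ((⟪e, refl e μ x⟫ ≤ μ → d (refl e μ x) ≤ 0) ∧
      (⟪e, refl e μ (refl e μ x)⟫ ≤ μ → d (refl e μ (refl e μ x)) ≤ 0)) := fun x hx => by
    rw [refl_refl he]; exact ⟨hx.2, hx.1⟩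
  have hgood1 : ∀ᵐ z : 𝔼 × 𝔼, (⟪e, z.1⟫ ≤ μ → d z.1 ≤ 0) ∧
      (⟪e, refl e μ z.1⟫ ≤ μ → d (refl e μ z.1) ≤ 0) :=
    Measure.quasiMeasurePreserving_fst.ae hgood
  have hgood2 : ∀ᵐ z : 𝔼 × 𝔼, (⟪e, z.2⟫ ≤ μ → d z.2 ≤ 0) ∧
      (⟪e, refl e μ z.2⟫ ≤ μ → d (refl e μ z.2) ≤ 0) :=
    Measure.quasiMeasurePreserving_snd.ae hgood
  have hS'eq : ∀ x y, ⟪e, x⟫ ≤ μ → ⟪e, y⟫ ≤ μ → d x ≤ 0 → d y ≤ 0 →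
      S' (x, y) = (-d x * φ' y + -d y * φ' x) * (kern s x y - kern s x (refl e μ y)) := by
    intro x y hx hy hdx hdy
    have e1 : ∀ x, d x ≤ 0 → d x * φ' x = 0 := fun x hx => by
      simp only [φ']
      split_ifs with h
      · have : d x = 0 := by linarith
        simp [this]
      · simp
    have e2 := e1 x hdx
    have e3 := e1 y hdy
    have e4 : φ' (refl e μ x) = 0 := by simp only [φ', hζσ x hx, zero_mul]
    have e5 : φ' (refl e μ y) = 0 := by simp only [φ', hζσ y hy, zero_mul]
    simp only [S']
    rw [symm4_quot_mul_quot he, e4, e5, hdσ, hdσ]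
    linear_combination (e2 + e3) * (kern s x y + kern s x (refl e μ y))
  have hφ'0 : ∀ x, 0 ≤ φ' x := fun x => by
    simp only [φ']
    split_ifs <;> simp [hζ0 x]
  have hS'0 : ∀ᵐ z, 0 ≤ S' z := by
    filter_upwards [hgood1, hgood2] with z h1 h2
    refine forall_symm4 he μ (F := fun (_ : Unit) z => quot s d z * quot s φ' z)
      (P := fun f => 0 ≤ f ()) hgoodσ (fun x y hx hy hAx hAy => ?_) h1 h2
    have h3 := hS'eq x y hx hy (hAx.1 hx) (hAy.1 hy)
    change 0 ≤ S' (x, y)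
    rw [h3]
    have q1 := hAx.1 hx
    have q2 := hAy.1 hy
    have q3 := hφ'0 x
    have q4 := hφ'0 y
    rcases eq_or_ne x y with rfl | hxy
    · have : -d x * φ' x + -d x * φ' x = 0 := by
        simp only [φ']
        split_ifs with h
        · have : d x = 0 := by linarith
          simp [this]
        · simp
      rw [this, zero_mul]
    · have := kern_refl_le he μ hs hx hy hxy
      refine mul_nonneg (add_nonneg (mul_nonneg ?_ q4) (mul_nonneg ?_ q3)) ?_ <;> linarith
  -- Fatou's lemma for `S k + G ≥ 0`, while the integrals of `S k` have nonpositive upper limit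
  have hfatou : ∫⁻ z, ENNReal.ofReal (S' z + G z) ≤ ENNReal.ofReal (∫ z, G z) := by
    have h1 : ∫⁻ z, ENNReal.ofReal (S' z + G z) ≤
        liminf (fun k => ∫⁻ z, ENNReal.ofReal (S k z + G z)) atTop := by
      have hGm : Measurable G := measurable_symm4 e μ (by
        have := measurable_kern (N := N) s
        fun_prop)
      refine le_trans (le_of_eq ?_) (lintegral_liminf_le fun k => ((hSm k).add hGm).ennreal_ofReal)
      refine lintegral_congr fun z => ?_
      exact ((ENNReal.tendsto_ofReal ((hlimS z).add_const (G z))).liminf_eq).symm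
    refine h1.trans ?_
    have h2 : ∀ k : ℕ, ∫⁻ z, ENNReal.ofReal (S k z + G z) ≤
        ENNReal.ofReal (4 * (lam * (1 / ((k : ℝ) + 1)) * ∫ x, ζ x) + ∫ z, G z) := fun k => by
      have hi : Integrable (fun z => S k z + G z) := (hSi k).add hGi
      rw [← ofReal_integral_eq_lintegral_ofReal hi
        (.of_forall fun z => by have := hlower k z; simp only [Pi.zero_apply]; linarith)]
      refine ENNReal.ofReal_le_ofReal ?_
      have := htest k
      rw [integral_add (hSi k) hGi]
      linarith
    have h3 : Tendsto (fun k : ℕ => ENNReal.ofReal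
        (4 * (lam * (1 / ((k : ℝ) + 1)) * ∫ x, ζ x) + ∫ z, G z)) atTop
        (𝓝 (ENNReal.ofReal (4 * (lam * 0 * ∫ x, ζ x) + ∫ z, G z))) := by
      refine ENNReal.tendsto_ofReal (Tendsto.add_const _ (Tendsto.const_mul _ ?_))
      exact (tendsto_one_div_add_atTop_nhds_zero_nat.const_mul lam).mul_const _
    refine (liminf_le_liminf (.of_forall h2)).trans (le_of_eq ?_)
    rw [h3.liminf_eq]
    simp
  have hzero : ∀ᵐ z, S' z = 0 := by
    have hGm : Measurable G := measurable_symm4 e μ (by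
      have := measurable_kern (N := N) s
      fun_prop)
    rw [ofReal_integral_eq_lintegral_ofReal hGi (.of_forall hG0)] at hfatou
    have h1 : ∫⁻ z, ENNReal.ofReal (S' z + G z) =
        (∫⁻ z, ENNReal.ofReal (S' z)) + ∫⁻ z, ENNReal.ofReal (G z) := by
      rw [← lintegral_add_left hS'm.ennreal_ofReal]
      refine lintegral_congr_ae ?_
      filter_upwards [hS'0] with z hz
      exact ENNReal.ofReal_add hz (hG0 z)
    have hGT : ∫⁻ z, ENNReal.ofReal (G z) ≠ ⊤ := by
      have := hGi.2
      rw [hasFiniteIntegral_iff_ofReal (.of_forall hG0)] at this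
      exact this.ne
    rw [h1] at hfatou
    have h2 : ∫⁻ z, ENNReal.ofReal (S' z) = 0 := by
      by_contra h0
      exact absurd hfatou (not_le.2 (by
        rw [add_comm]; exact ENNReal.lt_add_right hGT h0))
    rw [lintegral_eq_zero_iff hS'm.ennreal_ofReal] at h2
    filter_upwards [h2, hS'0] with z h3 h4
    exact le_antisymm (ENNReal.ofReal_eq_zero.1 h3) h4
  filter_upwards [hzero, hgood1, hgood2] with z hz h1 h2 hx hy hζx hdx
  obtain ⟨x, y⟩ := z
  simp only at *
  have qx := h1.1 hx.le
  have qy := h2.1 hy.le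
  rw [hS'eq x y hx.le hy.le qx qy] at hz
  rcases eq_or_ne x y with rfl | hxy
  · linarith
  have hk : kern s x (refl e μ y) < kern s x y := by
    have h0 : 0 < ‖x - y‖ := norm_pos_iff.2 (sub_ne_zero.2 hxy)
    have h1 : ‖x - y‖ < ‖x - refl e μ y‖ := by
      rw [← sq_lt_sq₀ (norm_nonneg _) (norm_nonneg _), norm_sub_refl_sq he]
      nlinarith [mul_pos (sub_pos.2 hx) (sub_pos.2 hy)]
    unfold kern
    gcongr
  have hφx : φ' x = ζ x := by
    simp only [φ']
    rw [if_pos (by linarith), mul_one]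
  have h3 := (mul_eq_zero.1 hz).resolve_right (by linarith)
  rw [hφx] at h3
  have h4 : 0 ≤ -d x * φ' y := mul_nonneg (by linarith) (hφ'0 y)
  have h5 : 0 ≤ -d y * ζ x := mul_nonneg (by linarith) hζx.le
  have h6 : -d y * ζ x = 0 := by linarith
  have := (mul_eq_zero.1 h6).resolve_right hζx.ne'
  linarith

/-- A test function supported in a ball and strictly positive on one side of a hyperplane. -/
noncomputable def sideBump (e : 𝔼) (μ R : ℝ) (x : 𝔼) : ℝ := cutoff R x * ramp (μ - ⟪e, x⟫)

lemma sideBump_nonneg (e : 𝔼) (μ R : ℝ) (x : 𝔼) : 0 ≤ sideBump e μ R x :=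
  mul_nonneg (cutoff_nonneg _ _) (ramp_nonneg _)

lemma sideBump_le_one (e : 𝔼) (μ R : ℝ) (x : 𝔼) : sideBump e μ R x ≤ 1 :=
  mul_le_one₀ (cutoff_le_one _ _) (ramp_nonneg _) (ramp_le_one _)

lemma sideBump_eq_zero_of_norm (e : 𝔼) (μ : ℝ) {R : ℝ} (hR : 0 < R) {x : 𝔼} (hx : 2 * R ≤ ‖x‖) :
    sideBump e μ R x = 0 := by rw [sideBump, cutoff_eq_zero hR hx, zero_mul]

lemma sideBump_eq_zero_of_side {e : 𝔼} {μ : ℝ} (R : ℝ) {x : 𝔼} (hx : μ ≤ ⟪e, x⟫) :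
    sideBump e μ R x = 0 := by rw [sideBump, ramp_of_nonpos (by linarith), mul_zero]

lemma sideBump_pos {e : 𝔼} {μ R : ℝ} (hR : 0 < R) {x : 𝔼} (hx : ⟪e, x⟫ < μ) (hxR : ‖x‖ ≤ R) :
    0 < sideBump e μ R x := by
  rw [sideBump, cutoff_eq_one hR hxR, one_mul]
  exact ramp_pos (by linarith)

lemma hardySobolev_sideBump (hN0 : 0 < N) {s : ℝ} (hs0 : 0 < s) (hs1 : s < 1) {e : 𝔼}
    (he : ‖e‖ = 1) (μ : ℝ) {R : ℝ} (hR : 1 ≤ R) : HardySobolev s (sideBump e μ R) := by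
  have hR0 : 0 < R := by linarith
  have hm : Measurable (sideBump e μ R) := by
    have := measurable_cutoff (N := N) R
    unfold sideBump; fun_prop
  refine ⟨hm, (memLp_quot_iff hm).2 ?_, ?_⟩
  · refine gagliardoEnergy_lt_top_of_lipschitz hN0 hs0 hs1 (R := 1 / 2) (ρ := 2 * R) (by norm_num)
      hm (fun x y => le_min ?_ ?_) fun x hx => sideBump_eq_zero_of_norm e μ hR0 hx
    · rw [abs_le]
      constructor <;> linarith [sideBump_nonneg e μ R x, sideBump_nonneg e μ R y,
        sideBump_le_one e μ R x, sideBump_le_one e μ R y]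
    · have e1 : sideBump e μ R x - sideBump e μ R y =
          (cutoff R x - cutoff R y) * ramp (μ - ⟪e, x⟫) +
            cutoff R y * (ramp (μ - ⟪e, x⟫) - ramp (μ - ⟪e, y⟫)) := by
        unfold sideBump; ring
      rw [e1]
      refine (abs_add_le _ _).trans ?_
      rw [abs_mul, abs_mul, abs_of_nonneg (ramp_nonneg _), abs_of_nonneg (cutoff_nonneg _ _)]
      have h1 : |cutoff R x - cutoff R y| ≤ ‖x - y‖ :=
        ((abs_cutoff_sub_le hR0 x y).trans (min_le_right _ _)).trans
          (div_le_self (norm_nonneg _) hR)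
      have h2 : |ramp (μ - ⟪e, x⟫) - ramp (μ - ⟪e, y⟫)| ≤ ‖x - y‖ := by
        refine (abs_ramp_sub_le _ _).trans ?_
        rw [show μ - ⟪e, x⟫ - (μ - ⟪e, y⟫) = ⟪e, y - x⟫ by rw [inner_sub_right]; ring]
        refine (abs_real_inner_le_norm _ _).trans ?_
        rw [he, one_mul, norm_sub_rev]
      refine (add_le_add
        ((mul_le_of_le_one_right (abs_nonneg _) (ramp_le_one _)).trans h1)
        ((mul_le_of_le_one_left (abs_nonneg _) (cutoff_le_one _ _)).trans h2)).trans (le_of_eq ?_)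
      ring
  · refine lt_of_le_of_lt (lintegral_mono (g := (Metric.ball (0 : 𝔼) (2 * R)).indicator 1)
      fun x => ?_) ?_
    · by_cases hx : x ∈ Metric.ball (0 : 𝔼) (2 * R)
      · rw [Set.indicator_of_mem hx, Pi.one_apply, ← ENNReal.ofReal_one]
        refine ENNReal.ofReal_le_ofReal (mul_le_one₀ ?_ (by positivity) ?_)
        · exact pow_le_one₀ (sideBump_nonneg _ _ _ _) (sideBump_le_one _ _ _ _)
        · exact Real.rpow_le_one_of_one_le_of_nonpos (by linarith [norm_nonneg x]) (by linarith)
      · rw [sideBump_eq_zero_of_norm e μ hR0 (by simpa using hx)]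
        simp
    · rw [lintegral_indicator_one measurableSet_ball]
      exact measure_ball_lt_top

lemma ae_inner_ne {e : 𝔼} (he : ‖e‖ = 1) (μ : ℝ) : ∀ᵐ x : 𝔼, ⟪e, x⟫ ≠ μ := by
  have h1 : volume ((LinearMap.ker (innerSL ℝ e).toLinearMap : Submodule ℝ 𝔼) : Set 𝔼) = 0 := by
    refine Measure.addHaar_submodule _ _ fun h => ?_
    have : e ∈ LinearMap.ker (innerSL ℝ e).toLinearMap := h ▸ Submodule.mem_top
    simp only [LinearMap.mem_ker, ContinuousLinearMap.coe_coe, innerSL_apply_apply,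
      real_inner_self_eq_norm_sq, he] at this
    norm_num at this
  have h2 := (measurePreserving_sub_right (volume : Measure 𝔼) (μ • e)).quasiMeasurePreserving
    |>.preimage_null h1
  refine measure_mono_null (fun x hx => ?_) h2
  simp only [ne_eq, Set.mem_compl_iff, Set.mem_ofPred_eq, not_not] at hx
  simp [inner_sub_right, inner_smul_right, he, hx]

/-- Strong maximum principle: a solution lying below its reflection on one side of a hyperplane
lies strictly below it, or is symmetric. -/
lemma IsEnergySolution.ae_lt_or_ae_eq (hN0 : 0 < N) {s lam p : ℝ} (hs0 : 0 < s) (hs1 : s < 1)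
    (hlam : 0 < lam) (hp : 1 ≤ p) {H : Set 𝔼} {e : 𝔼} (he : ‖e‖ = 1)
    (hH : ∀ x y : 𝔼, x ∈ H → ⟪e, x⟫ ≤ ⟪e, y⟫ → y ∈ H) {v : 𝔼 → ℝ}
    (hv : IsEnergySolution s lam p H v) {μ : ℝ}
    (hle : ∀ᵐ x, ⟪e, x⟫ ≤ μ → v x ≤ v (refl e μ x)) :
    (∀ᵐ x, ⟪e, x⟫ < μ → v x < v (refl e μ x)) ∨ (∀ᵐ x, ⟪e, x⟫ < μ → v (refl e μ x) = v x) := by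
  have hle' : ∀ᵐ x, ⟪e, x⟫ ≤ μ → reflDiff e μ v x ≤ 0 := by
    filter_upwards [hle] with x hx h
    exact sub_nonpos.2 (hx h)
  have h1 : ∀ᵐ z : 𝔼 × 𝔼, ∀ n : ℕ, ⟪e, z.1⟫ < μ → ⟪e, z.2⟫ < μ →
      0 < sideBump e μ ((n : ℝ) + 1) z.1 → 0 ≤ reflDiff e μ v z.1 → reflDiff e μ v z.2 = 0 :=
    ae_all_iff.2 fun n => hv.ae_contact hs0 hlam hp he hH hle'
      (hardySobolev_sideBump hN0 hs0 hs1 he μ (by simp)) (sideBump_nonneg _ _ _)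
      (sideBump_le_one _ _ _) (fun x => sideBump_eq_zero_of_norm e μ (by positivity))
      (fun x => sideBump_eq_zero_of_side _)
  have h2 : ∀ᵐ x : 𝔼, ∀ᵐ y : 𝔼, ⟪e, x⟫ < μ → ⟪e, y⟫ < μ → 0 ≤ reflDiff e μ v x →
      reflDiff e μ v y = 0 := by
    filter_upwards [Measure.ae_ae_of_ae_prod h1] with x hx
    filter_upwards [hx] with y hy hxμ hyμ hdx
    refine hy ⌈‖x‖⌉₊ hxμ hyμ (sideBump_pos (by positivity) hxμ ?_) hdx
    exact (Nat.le_ceil _).trans (by simp)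
  by_cases h : ∀ᵐ x, ⟪e, x⟫ < μ → v x < v (refl e μ x)
  · exact Or.inl h
  · right
    obtain ⟨x, hx, hx2⟩ := ((not_eventually.1 h).and_eventually h2).exists
    push Not at hx
    filter_upwards [hx2] with y hy hyμ
    have := hy hx.1 hyμ (sub_nonneg.2 hx.2)
    unfold reflDiff at this
    linarith

/-! ### Moving the hyperplane -/

lemma lt_of_sidePos_pos {e : 𝔼} {μ : ℝ} {v : 𝔼 → ℝ} {x : 𝔼}
    (h : 0 < sidePos e μ (reflDiff e μ v) x) : ⟪e, x⟫ < μ ∧ v (refl e μ x) < v x := by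
  rcases lt_or_ge μ ⟪e, x⟫ with hx | hx
  · rw [sidePos_of_lt hx] at h
    exact absurd h (lt_irrefl _)
  rw [sidePos_of_le hx, lt_max_iff, or_iff_left (lt_irrefl _), reflDiff, sub_pos] at h
  refine ⟨lt_of_le_of_ne hx fun hx' => ?_, h⟩
  rw [refl_eq_self hx'] at h
  exact lt_irrefl _ h

lemma le_refl_of_sidePos_eq_zero {e : 𝔼} {μ : ℝ} {v : 𝔼 → ℝ} {x : 𝔼}
    (h : sidePos e μ (reflDiff e μ v) x = 0) (hx : ⟪e, x⟫ ≤ μ) : v x ≤ v (refl e μ x) := by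
  rw [sidePos_of_le hx, max_eq_right_iff, reflDiff, sub_nonpos] at h
  exact h

/-- Reflections in converging hyperplanes converge almost everywhere along a subsequence. -/
lemma exists_seq_tendsto_refl {e : 𝔼} (he : ‖e‖ = 1) {v : 𝔼 → ℝ} {q : ℝ≥0∞} (hq1 : 1 ≤ q)
    (hq : q ≠ ⊤) (hv : MemLp v q volume) {μ : ℕ → ℝ} {ν : ℝ} (hμ : Tendsto μ atTop (𝓝 ν)) :
    ∃ ns : ℕ → ℕ, StrictMono ns ∧
      ∀ᵐ x, Tendsto (fun i => v (refl e (μ (ns i)) x)) atTop (𝓝 (v (refl e ν x))) := by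
  have h1 := (tendsto_eLpNorm_comp_sub hq1 hq (continuous_refl e)
    (measurePreserving_refl he) hv ν).comp hμ
  have hm : ∀ t, AEStronglyMeasurable (fun x => v (refl e t x)) volume := fun t =>
    hv.1.comp_measurePreserving (measurePreserving_refl he t)
  exact (tendstoInMeasure_of_tendsto_eLpNorm (by positivity) (fun n => hm (μ n)) (hm ν)
    h1).exists_seq_tendsto_ae

/-- The set of admissible positions of the hyperplane is closed. -/
lemma ae_le_refl_of_tendsto {e : 𝔼} (he : ‖e‖ = 1) {v : 𝔼 → ℝ} {q : ℝ≥0∞} (hq1 : 1 ≤ q)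
    (hq : q ≠ ⊤) (hv : MemLp v q volume) {μ : ℕ → ℝ} {ν : ℝ} (hμ : Tendsto μ atTop (𝓝 ν))
    (h : ∀ n, ∀ᵐ x, ⟪e, x⟫ ≤ μ n → v x ≤ v (refl e (μ n) x)) :
    ∀ᵐ x, ⟪e, x⟫ ≤ ν → v x ≤ v (refl e ν x) := by
  obtain ⟨ns, hns, hlim⟩ := exists_seq_tendsto_refl he hq1 hq hv hμ
  filter_upwards [hlim, ae_all_iff.2 h] with x hx1 hx2 hx
  rcases hx.lt_or_eq with hx | hx
  · refine ge_of_tendsto hx1 ?_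
    filter_upwards [(hμ.comp hns.tendsto_atTop).eventually (lt_mem_nhds hx)] with i hi
    exact hx2 _ hi.le
  · rw [refl_eq_self hx]

/-- The moving plane can be pushed beyond a position at which the solution lies strictly below its
reflection. -/
lemma IsEnergySolution.exists_lt_of_strict (hN0 : 0 < N) {s lam p r θ : ℝ} (hs0 : 0 < s)
    (hs1 : s < 1) (hθ1 : θ < 1) (hθ : (N : ℝ) * θ = 2 * s) (hr : r = 2 / (1 - θ)) (hlam : 0 < lam)
    (hp : 2 < p) (hpr : p ≤ r) {H : Set 𝔼} (hHm : MeasurableSet H) {e : 𝔼} (he : ‖e‖ = 1)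
    (hH : ∀ x y : 𝔼, x ∈ H → ⟪e, x⟫ ≤ ⟪e, y⟫ → y ∈ H) {v : 𝔼 → ℝ}
    (hv : IsEnergySolution s lam p H v) {ν : ℝ}
    (hstrict : ∀ᵐ x, x ∈ H → ⟪e, x⟫ < ν → v x < v (refl e ν x)) :
    ∃ η > 0, ∀ μ, ν < μ → μ < ν + η → ∀ᵐ x, ⟪e, x⟫ ≤ μ → v x ≤ v (refl e μ x) := by
  obtain ⟨δ, hδ, hsmall⟩ := hv.exists_small_mass hN0 hs0 hs1 hθ1 hθ hr hlam hp hpr hHm he hH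
  by_contra hcon
  have hr0 : 0 < r := by linarith
  have hvm := hv.hardySobolev.measurable
  have hvr := hv.hardySobolev.lintegral_rpow_lt_top hN0 hs0 hs1 hθ1 hθ hr
  have hvL := memLp_of_lintegral_rpow hr0 hvm.aestronglyMeasurable hvr
  have hbad : ∀ n : ℕ, ∃ μ, ν < μ ∧ μ < ν + 1 / ((n : ℝ) + 1) ∧
      ¬ ∀ᵐ x, ⟪e, x⟫ ≤ μ → v x ≤ v (refl e μ x) := fun n => by
    by_contra h
    exact hcon ⟨1 / ((n : ℝ) + 1), by positivity, fun μ h1 h2 =>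
      by_contra fun h3 => h ⟨μ, h1, h2, h3⟩⟩
  choose μ hμ1 hμ2 hμ3 using hbad
  have hμ : Tendsto μ atTop (𝓝 ν) := by
    refine tendsto_of_tendsto_of_tendsto_of_le_of_le tendsto_const_nhds ?_
      (fun n => (hμ1 n).le) (fun n => (hμ2 n).le)
    simpa using tendsto_one_div_add_atTop_nhds_zero_nat.const_add ν
  obtain ⟨ns, hns, hlim⟩ := exists_seq_tendsto_refl he
    (ENNReal.one_le_ofReal.2 (by linarith : (1 : ℝ) ≤ r)) ENNReal.ofReal_ne_top hvL hμ
  let B : ℕ → Set 𝔼 := fun i => H ∩ {x | 0 < sidePos e (μ (ns i)) (reflDiff e (μ (ns i)) v) x}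
  have hBm : ∀ i, MeasurableSet (B i) := fun i => by
    have hd := hv.hardySobolev.reflDiff hs0 he (μ (ns i))
    exact hHm.inter (measurableSet_lt measurable_const
      (hd.sidePos hs0 he (reflDiff_refl he _ v)).measurable)
  have hmass : ∀ i, δ ≤ ∫⁻ x, (B i).indicator (fun x => ‖v x‖ₑ ^ r) x := fun i => by
    rw [lintegral_indicator (hBm i)]
    by_contra! h
    refine hμ3 (ns i) ?_
    filter_upwards [hsmall _ h] with x hx hxμ
    exact le_refl_of_sidePos_eq_zero hx hxμ
  have hto : Tendsto (fun i => ∫⁻ x, (B i).indicator (fun x => ‖v x‖ₑ ^ r) x) atTop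
      (𝓝 (∫⁻ _ : 𝔼, 0)) := by
    refine tendsto_lintegral_of_dominated_convergence (fun x => ‖v x‖ₑ ^ r)
      (fun i => Measurable.indicator (by fun_prop) (hBm i))
      (fun i => .of_forall fun x => Set.indicator_le_self _ _ x) hvr.ne ?_
    filter_upwards [hlim, hstrict, ae_inner_ne he ν] with x h1 h2 h3
    refine tendsto_const_nhds.congr' ?_
    have h4 : ∀ᶠ i in atTop, x ∉ B i := by
      rcases h3.lt_or_gt with hx | hx
      · by_cases hxH : x ∈ H
        · filter_upwards [h1.eventually (lt_mem_nhds (h2 hxH hx))] with i hi hxB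
          exact absurd (lt_of_sidePos_pos hxB.2).2 (not_lt.2 hi.le)
        · exact .of_forall fun i hxB => hxH hxB.1
      · filter_upwards [(hμ.comp hns.tendsto_atTop).eventually (gt_mem_nhds hx)] with i hi hxB
        exact absurd (lt_of_sidePos_pos hxB.2).1 (not_lt.2 hi.le)
    filter_upwards [h4] with i hi
    rw [Set.indicator_of_notMem hi]
  rw [lintegral_zero] at hto
  exact absurd (ge_of_tendsto' hto hmass) (not_le.2 hδ)

/-- Symmetry about a hyperplane inside the half-space is impossible for a nontrivial solution,
because the equations at mirror points `x ∉ H` and `refl e ν x ∈ H` differ by `v^{p-1}`. -/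
lemma IsEnergySolution.ae_eq_zero_of_symmetric (hN0 : 0 < N) {s lam p : ℝ} (hs0 : 0 < s)
    (hs1 : s < 1) (hlam : 0 < lam) (hp : 1 < p) {H : Set 𝔼} {e : 𝔼} (he : ‖e‖ = 1) {c : ℝ}
    (hHc : H ⊆ {x | c ≤ ⟪e, x⟫}) (hcH : {x | c < ⟪e, x⟫} ⊆ H)
    (hH : ∀ x y : 𝔼, x ∈ H → ⟪e, x⟫ ≤ ⟪e, y⟫ → y ∈ H) {v : 𝔼 → ℝ}
    (hv : IsEnergySolution s lam p H v)
    (hlow : ∀ μ ≤ c, ∀ᵐ x, ⟪e, x⟫ ≤ μ → v x ≤ v (refl e μ x)) {ν : ℝ} (hν : c < ν)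
    (hsym : ∀ᵐ x, ⟪e, x⟫ < ν → v (refl e ν x) = v x) : ∀ᵐ x, v x = 0 := by
  have hp1 : 0 < p - 1 := by linarith
  have hd0 : ∀ᵐ x, reflDiff e ν v x = 0 := by
    filter_upwards [hsym, (measurePreserving_refl he ν).quasiMeasurePreserving.ae hsym] with x h1 h2
    rcases lt_trichotomy ⟪e, x⟫ ν with h | h | h
    · rw [reflDiff, h1 h, sub_self]
    · rw [reflDiff, refl_eq_self h, sub_self]
    · rw [reflDiff, ← h2 (by rw [inner_refl he]; linarith), refl_refl he, sub_self]
  -- outside `H` the difference of the two equations reads `v^{p-1} = 0`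
  have hzero : ∀ᵐ x, ⟪e, x⟫ < c → v x = 0 := by
    have h1 : ∀ n : ℕ, ∀ᵐ x, v x ^ (p - 1) * sideBump e c ((n : ℝ) + 1) x = 0 := fun n => by
      have hX := hardySobolev_sideBump hN0 hs0 hs1 he c (R := (n : ℝ) + 1) (by simp)
      have hw := hv.reflDiff_weak hs0 he ν hX (ρ := 2 * ((n : ℝ) + 1))
        (fun x => sideBump_eq_zero_of_norm e c (by positivity))
      have e1 : ∀ᵐ z : 𝔼 × 𝔼, quot s (reflDiff e ν v) z *
          quot s (sideBump e c ((n : ℝ) + 1)) z = 0 := by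
        have a1 : ∀ᵐ z : 𝔼 × 𝔼, reflDiff e ν v z.1 = 0 :=
          Measure.quasiMeasurePreserving_fst.ae hd0
        have a2 : ∀ᵐ z : 𝔼 × 𝔼, reflDiff e ν v z.2 = 0 :=
          Measure.quasiMeasurePreserving_snd.ae hd0
        filter_upwards [a1, a2] with z h1 h2
        simp only [quot, h1, h2, sub_self, zero_mul]
      have e2 : (fun x => (rhs lam p H v x - rhs lam p H v (refl e ν x)) *
          sideBump e c ((n : ℝ) + 1) x) =ᵐ[volume]
          fun x => -(v x ^ (p - 1) * sideBump e c ((n : ℝ) + 1) x) := by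
        filter_upwards [hd0] with x hx
        rcases lt_or_ge ⟪e, x⟫ c with h | h
        · have m1 : x ∉ H := fun hxH => absurd (hHc hxH) (not_le.2 h)
          have m2 : refl e ν x ∈ H := hcH (by
            change c < ⟪e, refl e ν x⟫
            rw [inner_refl he]; linarith)
          have m3 : v (refl e ν x) = v x := by unfold reflDiff at hx; linarith
          simp only [rhs, Set.indicator_of_notMem m1, Set.indicator_of_mem m2, m3]
          ring
        · rw [sideBump_eq_zero_of_side _ h]; simp
      rw [integral_eq_zero_of_ae e1, integral_congr_ae e2, integral_neg, eq_comm, neg_eq_zero] at hw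
      have hi := (hw.1.congr e2).neg
      simp only [Pi.neg_def, neg_neg] at hi
      exact (integral_eq_zero_iff_of_nonneg (fun x => mul_nonneg
        (Real.rpow_nonneg (hv.nonneg x) _) (sideBump_nonneg _ _ _ _)) hi).1 hw.2
    filter_upwards [ae_all_iff.2 h1] with x hx hxc
    have h2 := sideBump_pos (R := (⌈‖x‖⌉₊ : ℝ) + 1) (by positivity) hxc
      ((Nat.le_ceil _).trans (by simp))
    have h3 := (mul_eq_zero.1 (hx ⌈‖x‖⌉₊)).resolve_right h2.ne'
    exact (Real.rpow_eq_zero (hv.nonneg x) hp1.ne').1 h3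
  -- in the strip `c - 2 < ⟪e, x⟫ < c - 1` both `v` and its reflection in `⟪e, x⟫ = c - 1` vanish,
  -- which excludes strict inequality, and symmetry transports the zeros to all of the space
  have hzσ := (measurePreserving_refl he (c - 1)).quasiMeasurePreserving.ae hzero
  rcases hv.ae_lt_or_ae_eq hN0 hs0 hs1 hlam hp.le he hH (hlow (c - 1) (by linarith)) with h | h
  · exfalso
    have h1 : ∀ᵐ x, ¬ (x ∈ {x : 𝔼 | c - 2 < ⟪e, x⟫} ∩ {x | ⟪e, x⟫ < c - 1}) := by
      filter_upwards [h, hzero, hzσ] with x a1 a2 a3 hx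
      have b1 : c - 2 < ⟪e, x⟫ := hx.1
      have b2 : ⟪e, x⟫ < c - 1 := hx.2
      have a4 := a1 b2
      rw [a2 (by linarith), a3 (by rw [inner_refl he]; linarith)] at a4
      exact lt_irrefl _ a4
    have hopen : IsOpen ({x : 𝔼 | c - 2 < ⟪e, x⟫} ∩ {x | ⟪e, x⟫ < c - 1}) :=
      (isOpen_lt (by fun_prop) (by fun_prop)).inter (isOpen_lt (by fun_prop) (by fun_prop))
    refine (hopen.measure_pos volume ⟨(c - 3 / 2) • e, ?_, ?_⟩).ne' (by
      rw [measure_eq_zero_iff_ae_notMem]; exact h1)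
    · simp only [Set.mem_ofPred_eq, inner_smul_right, real_inner_self_eq_norm_sq, he]; linarith
    · simp only [Set.mem_ofPred_eq, inner_smul_right, real_inner_self_eq_norm_sq, he]; linarith
  · have hσ := (measurePreserving_refl he (c - 1)).quasiMeasurePreserving.ae h
    filter_upwards [hzero, hzσ, hσ] with x h1 h2 h3
    rcases lt_or_ge ⟪e, x⟫ c with hx | hx
    · exact h1 hx
    · have h4 := h3 (by rw [inner_refl he]; linarith)
      rw [refl_refl he] at h4
      rw [h4]
      exact h2 (by rw [inner_refl he]; linarith)

/-- A function of finite mass that lies below its reflection in all parallel hyperplanes vanishes: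
its mass escapes to infinity. -/
lemma ae_eq_zero_of_forall_le_refl {e : 𝔼} (he : ‖e‖ = 1) {v : 𝔼 → ℝ} {r : ℝ} (hr : 0 < r)
    (hvm : Measurable v) (hv0 : ∀ x, 0 ≤ v x) (hvr : ∫⁻ x, ‖v x‖ₑ ^ r < ⊤)
    (h : ∀ μ : ℝ, ∀ᵐ x, ⟪e, x⟫ ≤ μ → v x ≤ v (refl e μ x)) : ∀ᵐ x, v x = 0 := by
  have hS : ∀ μ : ℝ, MeasurableSet {x : 𝔼 | ⟪e, x⟫ ≤ μ} := measurableSet_side e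
  have hT : ∀ μ : ℝ, MeasurableSet {x : 𝔼 | μ ≤ ⟪e, x⟫} := fun μ =>
    measurableSet_le measurable_const (by fun_prop)
  have h1 : ∀ μ : ℝ, ∫⁻ x, {x | ⟪e, x⟫ ≤ μ}.indicator (fun x => ‖v x‖ₑ ^ r) x ≤
      ∫⁻ x, {x | μ ≤ ⟪e, x⟫}.indicator (fun x => ‖v x‖ₑ ^ r) x := fun μ => by
    have hm : Measurable ({x | μ ≤ ⟪e, x⟫}.indicator (fun x => ‖v x‖ₑ ^ r)) :=
      Measurable.indicator (by fun_prop) (hT μ)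
    rw [← (measurePreserving_refl he μ).lintegral_comp hm]
    refine lintegral_mono_ae ?_
    filter_upwards [h μ] with x hx
    by_cases hxμ : ⟪e, x⟫ ≤ μ
    · rw [Set.indicator_of_mem (s := {x | ⟪e, x⟫ ≤ μ}) hxμ, Set.indicator_of_mem (by
        change μ ≤ ⟪e, refl e μ x⟫
        rw [inner_refl he]; linarith)]
      gcongr
      rw [Real.enorm_of_nonneg (hv0 _), Real.enorm_of_nonneg (hv0 _)]
      exact ENNReal.ofReal_le_ofReal (hx hxμ)
    · rw [Set.indicator_of_notMem (s := {x | ⟪e, x⟫ ≤ μ}) hxμ]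
      exact zero_le
  have h2 : Tendsto (fun n : ℕ => ∫⁻ x, {x | (n : ℝ) ≤ ⟪e, x⟫}.indicator (fun x => ‖v x‖ₑ ^ r) x)
      atTop (𝓝 (∫⁻ _ : 𝔼, 0)) := by
    refine tendsto_lintegral_of_dominated_convergence (fun x => ‖v x‖ₑ ^ r)
      (fun n => Measurable.indicator (by fun_prop) (hT n))
      (fun n => .of_forall fun x => Set.indicator_le_self _ _ x) hvr.ne (.of_forall fun x => ?_)
    refine tendsto_const_nhds.congr' ?_
    filter_upwards [eventually_gt_atTop ⌈⟪e, x⟫⌉₊] with n hn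
    rw [Set.indicator_of_notMem]
    exact not_le.2 (Nat.lt_of_ceil_lt hn)
  rw [lintegral_zero] at h2
  have h3 : ∀ m : ℕ, ∀ᵐ x, {x | ⟪e, x⟫ ≤ (m : ℝ)}.indicator (fun x => ‖v x‖ₑ ^ r) x = 0 :=
      fun m => by
    have hm : Measurable ({x | ⟪e, x⟫ ≤ (m : ℝ)}.indicator (fun x => ‖v x‖ₑ ^ r)) :=
      Measurable.indicator (by fun_prop) (hS m)
    refine (lintegral_eq_zero_iff hm).1 (le_antisymm (ge_of_tendsto h2 ?_) (zero_le))
    filter_upwards [eventually_ge_atTop m] with n hn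
    refine le_trans (lintegral_mono fun x => ?_) (h1 n)
    refine Set.indicator_le_indicator_of_subset (fun y (hy : ⟪e, y⟫ ≤ (m : ℝ)) => ?_)
      (fun _ => zero_le) x
    exact hy.trans (by exact_mod_cast hn)
  filter_upwards [ae_all_iff.2 h3] with x hx
  have h4 := hx ⌈⟪e, x⟫⌉₊
  rw [Set.indicator_of_mem (s := {y : 𝔼 | ⟪e, y⟫ ≤ ((⌈⟪e, x⟫⌉₊ : ℕ) : ℝ)}) (Nat.le_ceil ⟪e, x⟫),
    ENNReal.rpow_eq_zero_iff_of_pos hr] at h4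
  simpa using h4

/-- Nonexistence for solutions tested against all compactly supported functions of finite energy. -/
lemma IsEnergySolution.ae_eq_zero (hN0 : 0 < N) {s lam p r θ : ℝ} (hs0 : 0 < s)
    (hs1 : s < 1) (hθ1 : θ < 1) (hθ : (N : ℝ) * θ = 2 * s) (hr : r = 2 / (1 - θ)) (hlam : 0 < lam)
    (hp : 2 < p) (hpr : p ≤ r) {H : Set 𝔼} (hHm : MeasurableSet H) {e : 𝔼} (he : ‖e‖ = 1) {c : ℝ}
    (hHc : H ⊆ {x | c ≤ ⟪e, x⟫}) (hcH : {x | c < ⟪e, x⟫} ⊆ H)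
    (hH : ∀ x y : 𝔼, x ∈ H → ⟪e, x⟫ ≤ ⟪e, y⟫ → y ∈ H) {v : 𝔼 → ℝ}
    (hv : IsEnergySolution s lam p H v) : ∀ᵐ x, v x = 0 := by
  have hr0 : 0 < r := by linarith
  have hvm := hv.hardySobolev.measurable
  have hvr := hv.hardySobolev.lintegral_rpow_lt_top hN0 hs0 hs1 hθ1 hθ hr
  have hvL := memLp_of_lintegral_rpow hr0 hvm.aestronglyMeasurable hvr
  have hlow : ∀ μ ≤ c, ∀ᵐ x, ⟪e, x⟫ ≤ μ → v x ≤ v (refl e μ x) := fun μ hμ => by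
    obtain ⟨δ, hδ, hsmall⟩ := hv.exists_small_mass hN0 hs0 hs1 hθ1 hθ hr hlam hp hpr hHm he hH
    have hempty : H ∩ {x | 0 < sidePos e μ (reflDiff e μ v) x} = ∅ :=
      Set.eq_empty_of_forall_notMem fun x hx => by
        have h1 : c ≤ ⟪e, x⟫ := hHc hx.1
        have h2 := (lt_of_sidePos_pos hx.2).1
        linarith
    filter_upwards [hsmall μ (by rw [hempty]; simpa using hδ)] with x hx hxμ
    exact le_refl_of_sidePos_eq_zero hx hxμ
  by_cases hall : ∀ μ : ℝ, ∀ᵐ x, ⟪e, x⟫ ≤ μ → v x ≤ v (refl e μ x)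
  · exact ae_eq_zero_of_forall_le_refl he hr0 hvm hv.nonneg hvr hall
  obtain ⟨μ₀, hμ₀⟩ := not_forall.1 hall
  let S : Set ℝ := {μ | ∀ ν ≤ μ, ∀ᵐ x, ⟪e, x⟫ ≤ ν → v x ≤ v (refl e ν x)}
  have hcS : c ∈ S := hlow
  have hSb : BddAbove S := ⟨μ₀, fun μ hμ => by
    by_contra! h
    exact hμ₀ (hμ μ₀ h.le)⟩
  set m := sSup S with hm
  have hcm : c ≤ m := le_csSup hSb hcS
  have hlt : ∀ ν < m, ∀ᵐ x, ⟪e, x⟫ ≤ ν → v x ≤ v (refl e ν x) := fun ν hν => by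
    obtain ⟨μ, hμS, hμ⟩ := exists_lt_of_lt_csSup ⟨c, hcS⟩ hν
    exact hμS ν hμ.le
  have hmle : ∀ᵐ x, ⟪e, x⟫ ≤ m → v x ≤ v (refl e m x) := by
    refine ae_le_refl_of_tendsto he (ENNReal.one_le_ofReal.2 (by linarith : (1 : ℝ) ≤ r))
      ENNReal.ofReal_ne_top hvL (μ := fun n : ℕ => m - 1 / ((n : ℝ) + 1)) ?_ fun n => hlt _ ?_
    · simpa using tendsto_one_div_add_atTop_nhds_zero_nat.const_sub m
    · have : (0 : ℝ) < 1 / ((n : ℝ) + 1) := by positivity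
      linarith
  -- the plane cannot be moved beyond `m`
  have hmax : ¬ ∀ᵐ x, x ∈ H → ⟪e, x⟫ < m → v x < v (refl e m x) := fun hstrict => by
    obtain ⟨η, hη, hnext⟩ := hv.exists_lt_of_strict hN0 hs0 hs1 hθ1 hθ hr hlam hp hpr hHm he hH
      hstrict
    have : m + η / 2 ∈ S := fun ν hν => by
      rcases lt_trichotomy ν m with h | h | h
      · exact hlt ν h
      · rw [h]; exact hmle
      · exact hnext ν h (by linarith)
    linarith [le_csSup hSb this]
  rcases hcm.eq_or_lt with hcm | hcm
  · refine absurd (.of_forall fun x hxH hxm => ?_) hmax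
    have : c ≤ ⟪e, x⟫ := hHc hxH
    linarith
  rcases hv.ae_lt_or_ae_eq hN0 hs0 hs1 hlam (by linarith) he hH hmle with h | h
  · refine absurd ?_ hmax
    filter_upwards [h] with x hx _ using hx
  · exact hv.ae_eq_zero_of_symmetric hN0 hs0 hs1 hlam (by linarith) he hHc hcH hH hlow hcm h

/-! ### From distributional solutions to energy solutions -/

lemma holderTriple_critical {r : ℝ} (hr : 1 < r) :
    ENNReal.HolderTriple (ENNReal.ofReal (r / (r - 1))) (ENNReal.ofReal r) 1 :=
  (Real.HolderConjugate.conjExponent hr).symm.ennrealOfReal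

/-- The equation may be tested against compactly supported functions of finite energy as soon as
it holds for smooth ones. -/
lemma isEnergySolution_of_contDiff (hN0 : 0 < N) {s lam p r θ : ℝ} (hs0 : 0 < s)
    (hs1 : s < 1) (hθ1 : θ < 1) (hθ : (N : ℝ) * θ = 2 * s) (hr : r = 2 / (1 - θ)) (hlam : 0 < lam)
    (hp : 2 < p) (hpr : p ≤ r) {H : Set 𝔼} (hHm : MeasurableSet H) {v : 𝔼 → ℝ}
    (hv : HardySobolev s v) (hv0 : ∀ x, 0 ≤ v x) (hsol : IsWeakSolution s lam p H v) :
    IsEnergySolution s lam p H v := by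
  have hr2 : 2 ≤ r := by linarith
  have hr0 : 0 < r := by linarith
  have := holderTriple_critical (r := r) (by linarith)
  have hLr : ∀ {u : 𝔼 → ℝ}, HardySobolev s u → MemLp u (ENNReal.ofReal r) volume := fun hu =>
    memLp_of_lintegral_rpow hr0 hu.measurable.aestronglyMeasurable
      (hu.lintegral_rpow_lt_top hN0 hs0 hs1 hθ1 hθ hr)
  have hgm : Measurable (rhs lam p H v) := measurable_rhs hHm hv.measurable
  have hg := memLp_indicator_rhs hlam.le (by linarith) hpr hr2 hHm hv.measurable hv0 (hLr hv)
  have hint : ∀ (φ : 𝔼 → ℝ) (ρ : ℝ), MemLp φ (ENNReal.ofReal r) volume →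
      (∀ x, ρ ≤ ‖x‖ → φ x = 0) → Integrable fun x => rhs lam p H v x * φ x := fun φ ρ hφ h0 => by
    have h1 : Integrable fun x => (Metric.ball 0 ρ).indicator (rhs lam p H v) x * φ x :=
      (hg ρ).integrable_mul hφ
    refine h1.congr (.of_forall fun x => ?_)
    beta_reduce
    by_cases hx : x ∈ Metric.ball (0 : 𝔼) ρ
    · rw [Set.indicator_of_mem hx]
    · rw [h0 x (by simpa using hx), mul_zero, mul_zero]
  refine ⟨hv, hv0, fun φ ρ hφ h0 => hint φ ρ (hLr hφ) h0, fun φ ρ hφ h0 => ?_⟩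
  refine weak_eq_of_hasCompactSupport (ENNReal.one_le_ofReal.2 (by linarith : (1 : ℝ) ≤ r))
    ENNReal.ofReal_ne_top hv hgm hg (fun ψ hψ hψc => ?_) hφ.measurable hφ.memLp_quot (hLr hφ) h0
  obtain ⟨ρ', hρ'⟩ := hψc.isCompact.isBounded.subset_ball 0
  have i1 := hint ψ ρ' (hψ.continuous.memLp_of_hasCompactSupport hψc) fun x hx =>
    image_eq_zero_of_notMem_tsupport fun h => by
      have := hρ' h
      rw [Metric.mem_ball, dist_zero_right] at this
      linarith
  have i2 : Integrable fun x => v x * ψ x := by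
    have := ENNReal.HolderTriple.symm (p := ENNReal.ofReal (r / (r - 1)))
      (q := ENNReal.ofReal r) (r := 1)
    exact (hLr hv).integrable_mul (q := ENNReal.ofReal (r / (r - 1)))
      (hψ.continuous.memLp_of_hasCompactSupport hψc)
  have h1 := hsol ψ hψ hψc
  rw [gagliardoForm_eq] at h1
  have h2 : ∀ x, H.indicator (fun x => v x ^ (p - 1)) x * ψ x =
      rhs lam p H v x * ψ x + lam * (v x * ψ x) := fun x => by
    unfold rhs; ring
  simp only [h2] at h1
  rw [integral_add i1 (i2.const_mul lam), integral_const_mul] at h1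
  linarith

end FracHalfSpace

open FracHalfSpace

theorem lemma3p4 (N : ℕ) (s : ℝ) (hs0 : 0 < s) (hs1 : s < 1) (hN : 2 * s < (N : ℝ))
    (p : ℝ) (hp2 : 2 < p) (hp : p < 2 * (N : ℝ) / ((N : ℝ) - 2 * s))
    (V : EuclideanSpace ℝ (Fin N) → ℝ) (hVcont : Continuous V) (hVnonneg : ∀ x, 0 ≤ V x)
    (hVdecay : 0 < liminf (fun x => ENNReal.ofReal (V x * ‖x‖ ^ (2 * s)))
      (cocompact (EuclideanSpace ℝ (Fin N))))
    (ε : ℝ) (hε : 0 < ε) (lam : ℝ) (hlam : 0 < lam)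
    (H : Set (EuclideanSpace ℝ (Fin N))) (hH : IsHalfSpace H)
    (v : EuclideanSpace ℝ (Fin N) → ℝ) (hv : MemWeightedSobolev s ε V v)
    (hvnonneg : ∀ᵐ x, 0 ≤ v x) (hsol : IsWeakSolution s lam p H v) :
    ∀ᵐ x, v x = 0 := by
  have hNR : (0 : ℝ) < N := by linarith
  have hN0 : 0 < N := by exact_mod_cast hNR
  have hNs : 0 < (N : ℝ) - 2 * s := by linarith
  obtain ⟨θ, hθdef⟩ : ∃ θ : ℝ, θ = 2 * s / N := ⟨_, rfl⟩
  have hθ : (N : ℝ) * θ = 2 * s := by rw [hθdef]; field_simp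
  have hθ1 : θ < 1 := by rw [hθdef, div_lt_one hNR]; exact hN
  have hr : 2 * (N : ℝ) / ((N : ℝ) - 2 * s) = 2 / (1 - θ) := by
    rw [hθdef]; field_simp
  -- a nonnegative measurable representative
  obtain ⟨v', hv'm, hv'0, hvv'⟩ : ∃ v' : EuclideanSpace ℝ (Fin N) → ℝ, Measurable v' ∧
      (∀ x, 0 ≤ v' x) ∧ v =ᵐ[volume] v' := by
    refine ⟨fun x => max (hv.aestronglyMeasurable.mk v x) 0,
      hv.aestronglyMeasurable.stronglyMeasurable_mk.measurable.max measurable_const,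
      fun x => le_max_right _ _, ?_⟩
    filter_upwards [hv.aestronglyMeasurable.ae_eq_mk, hvnonneg] with x h1 h2
    rw [← h1, max_eq_left h2]
  have hprod1 : ∀ᵐ z : EuclideanSpace ℝ (Fin N) × EuclideanSpace ℝ (Fin N), v z.1 = v' z.1 :=
    Measure.quasiMeasurePreserving_fst.ae hvv'
  have hprod2 : ∀ᵐ z : EuclideanSpace ℝ (Fin N) × EuclideanSpace ℝ (Fin N), v z.2 = v' z.2 :=
    Measure.quasiMeasurePreserving_snd.ae hvv'
  have hnorm : weightedNormSq s ε V v' < ⊤ := by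
    have h1 : weightedNormSq s ε V v' = weightedNormSq s ε V v := by
      unfold weightedNormSq gagliardoEnergy
      congr 1
      · congr 1
        refine lintegral_congr_ae ?_
        filter_upwards [hprod1, hprod2] with z a b
        rw [a, b]
      · refine lintegral_congr_ae ?_
        filter_upwards [hvv'] with x a
        rw [a]
    rw [h1]; exact hv.weightedNormSq_lt_top
  have hsol' : IsWeakSolution s lam p H v' := fun φ hφ hφc => by
    have h1 : gagliardoForm s v' φ = gagliardoForm s v φ := by
      refine integral_congr_ae ?_
      filter_upwards [hprod1, hprod2] with z a b
      rw [a, b]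
    have h2 : ∫ x, v' x * φ x = ∫ x, v x * φ x := by
      refine integral_congr_ae ?_
      filter_upwards [hvv'] with x a
      rw [a]
    have h3 : ∫ x, H.indicator (fun x => v' x ^ (p - 1)) x * φ x =
        ∫ x, H.indicator (fun x => v x ^ (p - 1)) x * φ x := by
      refine integral_congr_ae ?_
      filter_upwards [hvv'] with x a
      simp only [Set.indicator, a]
    rw [h1, h2, h3]
    exact hsol φ hφ hφc
  have hX : HardySobolev s v' :=
    hardySobolev_of_memWeightedSobolev hN0 hs0 hε hVcont.measurable hVnonneg hVdecay hv'm hnorm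
  obtain ⟨e₀, c₀, he₀, hH₀⟩ := hH
  have hn : 0 < ‖e₀‖ := norm_pos_iff.2 he₀
  -- normalization of the normal vector
  obtain ⟨e, c, he, hHe⟩ : ∃ (e : EuclideanSpace ℝ (Fin N)) (c : ℝ), ‖e‖ = 1 ∧
      (H = {x | c ≤ ⟪e, x⟫} ∨ H = {x | c < ⟪e, x⟫}) := by
    refine ⟨‖e₀‖⁻¹ • e₀, ‖e₀‖⁻¹ * c₀, norm_smul_inv_norm he₀, ?_⟩
    simpa only [real_inner_smul_left, mul_le_mul_iff_right₀ (inv_pos.2 hn),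
      mul_lt_mul_iff_right₀ (inv_pos.2 hn)] using hH₀
  have hHm : MeasurableSet H := by
    rcases hHe with h | h <;> rw [h]
    · exact measurableSet_le measurable_const (by fun_prop)
    · exact measurableSet_lt measurable_const (by fun_prop)
  have hHc : H ⊆ {x | c ≤ ⟪e, x⟫} := by
    rcases hHe with h | h <;> rw [h]
    exact fun x (hx : c < ⟪e, x⟫) => hx.le
  have hcH : {x | c < ⟪e, x⟫} ⊆ H := by
    rcases hHe with h | h <;> rw [h]
    exact fun x (hx : c < ⟪e, x⟫) => hx.le
  have hmono : ∀ x y : EuclideanSpace ℝ (Fin N), x ∈ H → ⟪e, x⟫ ≤ ⟪e, y⟫ → y ∈ H := by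
    rcases hHe with h | h <;> rw [h]
    · exact fun x y (hx : c ≤ ⟪e, x⟫) hxy => hx.trans hxy
    · exact fun x y (hx : c < ⟪e, x⟫) hxy => hx.trans_le hxy
  rw [hr] at hp
  have hE := isEnergySolution_of_contDiff hN0 hs0 hs1 hθ1 hθ rfl hlam hp2 hp.le hHm hX hv'0 hsol'
  have h0 := hE.ae_eq_zero hN0 hs0 hs1 hθ1 hθ rfl hlam hp2 hp.le hHm he hHc hcH hmono
  filter_upwards [hvv', h0] with x a b
  rw [a, b]
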